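/- **Setting.** Let $n,j\ge 1$ be integers and let $e_{ik}$ be the elementary $(2n+1)\times(2n+1)$ matrices. Put $$\rho_n=\sum_{i=1}^{2n+1}(-1)^{n+i-1}e_{i,2n+2-i},\qquad \beta=\tfrac12(e_{1,2n}+e_{2,2n+1}),\qquad b=\sum_{i=1}^{2n}e_{i+1,i},\qquad A^\sharp=\rho_nA^t\rho_n .$$ Let $O_{\mathbb C}(n+1,n)=\{g\in SL(2n+1,\mathbb C): g^t\rho_n g=\rho_n\}$, let $o(n+1,n)=\{A\in gl(2n+1,\mathbb R): A^t\rho_n+\rho_nA=0\}$, and let $\mathcal B_n^+$ be the set of upper triangular matrices in $o(n+1,n)$. Let $U\subset\mathbb R^2$ be open (coordinates $(x,t)$) and let $q:U\to\mathcal B_n^+$ be smooth. Denote by $T(q,\lambda)=\beta\lambda+\sum_{i\le 0}T_{1,i}(q)\lambda^i$ the unique formal series with smooth coefficients in $o(n+1,n)$ such that $$[\partial_x+\beta\lambda+b+q,\;T(q,\lambda)]=0,\qquad T(q,\lambda)^{2n+1}=\lambda\,T(q,\lambda).$$ Let $T_{2j-1,0}(q)$ be the coefficient of $\lambda^0$ in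 $T(q,\lambda)^{2j-1}$, and let $(\cdot)_+$ denote the part of a series with non-negative powers of $\lambda$. The map $q$ is a *solution of the $(2j-1)$-th $\hat B_n^{(1)}$-flow on $U$* if $q_t=[\partial_x+b+q,\,T_{2j-1,0}(q)]$ on $U$. A *frame* of the solution $q$ on $U$ is a map $F(x,t,\lambda)\in O_{\mathbb C}(n+1,n)$, $(x,t)\in U$, $\lambda\in\mathbb C$, smooth in $(x,t)$ and holomorphic in $\lambda\in\mathbb C$, with $$F^{-1}F_x=\beta\lambda+b+q,\qquad F^{-1}F_t=(T(q,\lambda)^{2j-1})_+,\qquad \overline{F(x,t,\bar\lambda)}=F(x,t,\lambda).$$ For real $\alpha_1\ne\alpha_2$ and a real projection $\pi$ put $$g_{\alpha_1,\alpha_2,\pi}(\lambda)=I+\frac{\alpha_2-\alpha_1}{\lambda-\alpha_2}\,\pi+\frac{\alpha_1-\alpha_2}{\lambda-\alpha_1}\,\pi^\sharp .$$ **Theorem.** Let $F$ be a frame on $\mathbb R^2$ of a solution $q$ on $\mathbb R^2$ of the $(2j-1)$-th $\hat B_n^{(1)}$-flow, let $\pi$ be a rank-one projection of $\mathbb R^{2n+1}$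 onto $V_1$ along $V_2$ with $\pi\pi^\sharp=\pi^\sharp\pi=0$, and let $\alpha_1\neq\alpha_2$ be real. Put $\tilde V_i(x,t)=F(x,t,\alpha_i)^{-1}V_i$ for $i=1,2$, and let $\mathcal O\subset\mathbb R^2$ be an open set such that $\mathbb R^{2n+1}=\tilde V_1(x,t)\oplus\tilde V_2(x,t)$ for all $(x,t)\in\mathcal O$. For $(x,t)\in\mathcal O$ let $\tilde\pi(x,t)$ be the projection onto $\tilde V_1(x,t)$ along $\tilde V_2(x,t)$. Then: 1. $\tilde\pi\tilde\pi^\sharp=\tilde\pi^\sharp\tilde\pi=0$ on $\mathcal O$; 2. $\tilde q=q+(\alpha_1-\alpha_2)[\beta,\tilde\pi-\tilde\pi^\sharp]$ is a smooth solution of the $(2j-1)$-th $\hat B_n^{(1)}$-flow on $\mathcal O$, with values in $\mathcal B_n^+$; 3. $\tilde F(x,t,\lambda)=g_{\alpha_1,\alpha_2,\pi}(\lambda)\,F(x,t,\lambda)\,g_{\alpha_1,\alpha_2,\tilde\pi(x,t)}(\lambda)^{-1}$, defined for $\lambda\ne\alpha_1,\alpha_2$, extends holomorphically in $\lambda$ to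 $\mathbb C$, and the extension is a frame of $\tilde q$ on $\mathcal O$. -/

import Mathlib

open scoped Matrix ContDiff

noncomputable section

namespace BHat

/-- Square matrices of size `2n+1`. Rows and columns are numbered from `0`, so that the
elementary matrix `e_{i,k}` of the usual (one-based) notation sits at position `(i-1, k-1)`. -/
abbrev Mat (n : ℕ) (K : Type*) := Matrix (Fin (2 * n + 1)) (Fin (2 * n + 1)) K

/-- `ρ_n = ∑_{i=1}^{2n+1} (-1)^(n+i-1) e_{i, 2n+2-i}`, the Gram matrix of the bilinear form
`⟨X, Y⟩ = Xᵀ ρ_n Y` of index `n`. -/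
def rho (n : ℕ) (K : Type*) [Field K] : Mat n K :=
  Matrix.of fun i k => if (i : ℕ) + (k : ℕ) = 2 * n then (-1) ^ (n + (i : ℕ)) else 0

/-- `β = (1/2) (e_{1, 2n} + e_{2, 2n+1})`. -/
def beta (n : ℕ) : Mat n ℝ :=
  Matrix.of fun i k =>
    if ((i : ℕ) = 0 ∧ (k : ℕ) + 1 = 2 * n) ∨ ((i : ℕ) = 1 ∧ (k : ℕ) = 2 * n) then 1 / 2 else 0

/-- `b = ∑_{i=1}^{2n} e_{i+1, i}`. -/
def bMat (n : ℕ) : Mat n ℝ :=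
  Matrix.of fun i k => if (i : ℕ) = (k : ℕ) + 1 then 1 else 0

/-- Membership in the Lie algebra `o(n+1,n)` (the trace condition is automatic). -/
def IsOrthLie (n : ℕ) (A : Mat n ℝ) : Prop :=
  Aᵀ * rho n ℝ + rho n ℝ * A = 0

/-- Membership in `𝓑_n^+`, the upper triangular matrices in `o(n+1,n)`. -/
def IsBorel (n : ℕ) (A : Mat n ℝ) : Prop :=
  IsOrthLie n A ∧ ∀ i k, k < i → A i k = 0

/-- Membership in the group `O_ℂ(n+1,n) ⊆ SL(2n+1, ℂ)`. -/
def IsOrthGroup (n : ℕ) (g : Mat n ℂ) : Prop :=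
  g.det = 1 ∧ gᵀ * rho n ℂ * g = rho n ℂ

/-- The adjoint `A^♯ = ρ_n Aᵀ ρ_n` with respect to the form `⟨X, Y⟩ = Xᵀ ρ_n Y`. -/
def sharp {n : ℕ} (A : Mat n ℝ) : Mat n ℝ :=
  rho n ℝ * Aᵀ * rho n ℝ

/-- A real matrix viewed as a complex one. -/
def toC {n : ℕ} (A : Mat n ℝ) : Mat n ℂ :=
  A.map Complex.ofReal

/-- Smoothness on an open set `U` of the `(x, t)`-plane, entry by entry. -/
def SmoothMat {n : ℕ} {K : Type*} [NormedAddCommGroup K] [NormedSpace ℝ K]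
    (U : Set (ℝ × ℝ)) (f : ℝ × ℝ → Mat n K) : Prop :=
  ∀ i k, ContDiffOn ℝ ∞ (fun p => f p i k) U

/-- The partial derivative in `x` (the first variable) of a matrix-valued function. -/
def partialX {n : ℕ} {K : Type*} [NormedAddCommGroup K] [NormedSpace ℝ K]
    (f : ℝ × ℝ → Mat n K) (p : ℝ × ℝ) : Mat n K :=
  Matrix.of fun i k => deriv (fun s => f (s, p.2) i k) p.1

/-- The partial derivative in `t` (the second variable) of a matrix-valued function. -/
def partialT {n : ℕ} {K : Type*} [NormedAddCommGroup K] [NormedSpace ℝ K]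
    (f : ℝ × ℝ → Mat n K) (p : ℝ × ℝ) : Mat n K :=
  Matrix.of fun i k => deriv (fun s => f (p.1, s) i k) p.2

/-- Formal series `∑_{i ≤ N} ξ_i λ^i` with real matrix coefficients, as Laurent series in the
variable `λ⁻¹`: the coefficient of `λ^i` is `ξ.coeff (-i)`. -/
abbrev Loop (n : ℕ) := LaurentSeries (Mat n ℝ)

/-- The coefficient `ξ_i` of `λ^i`. -/
def lcoeff {n : ℕ} (ξ : Loop n) (i : ℤ) : Mat n ℝ :=
  ξ.coeff (-i)

/-- The monomial `A λ^i`. -/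
def lmono {n : ℕ} (i : ℤ) (A : Mat n ℝ) : Loop n :=
  HahnSeries.single (-i) A

/-- `T` is the series `T(q, λ)` on the open set `U`: the solution
`T = β λ + ∑_{i ≤ 0} T_i λ^i`, with smooth `o(n+1,n)`-valued coefficients, of
`[∂_x + β λ + b + q, T] = 0` and `T^(2n+1) = λ T`.
For given `q` there is exactly one such `T` on `U`; its coefficients are differential
polynomials in `q`. -/
structure IsResolvent (n : ℕ) (U : Set (ℝ × ℝ)) (q : ℝ × ℝ → Mat n ℝ)
    (T : ℝ × ℝ → Loop n) : Prop where
  smooth : ∀ i : ℤ, SmoothMat U fun p => lcoeff (T p) i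
  orth : ∀ p ∈ U, ∀ i : ℤ, IsOrthLie n (lcoeff (T p) i)
  degree_le : ∀ p ∈ U, ∀ i : ℤ, 1 < i → lcoeff (T p) i = 0
  leading : ∀ p ∈ U, lcoeff (T p) 1 = beta n
  commute : ∀ p ∈ U, ∀ i : ℤ,
    partialX (fun r => lcoeff (T r) i) p +
      lcoeff ⁅lmono 1 (beta n) + lmono 0 (bMat n + q p), T p⁆ i = 0
  power : ∀ p ∈ U, T p ^ (2 * n + 1) = lmono 1 1 * T p

/-- `q : U → 𝓑_n^+` is a smooth solution on `U` of the `(2j-1)`-th flow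
`q_t = [∂_x + b + q, T_{2j-1,0}(q)]`, where `T_{2j-1,0}(q)` is the coefficient of `λ^0` in
`T(q, λ)^(2j-1)`. -/
def IsSolution (n j : ℕ) (U : Set (ℝ × ℝ)) (q : ℝ × ℝ → Mat n ℝ) : Prop :=
  SmoothMat U q ∧ (∀ p ∈ U, IsBorel n (q p)) ∧
    ∃ T : ℝ × ℝ → Loop n, IsResolvent n U q T ∧
      ∀ p ∈ U, partialT q p =
        partialX (fun r => lcoeff (T r ^ (2 * j - 1)) 0) p +
          ⁅bMat n + q p, lcoeff (T p ^ (2 * j - 1)) 0⁆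

/-- The value at `l : ℂ` of the part `∑_{0 ≤ i ≤ N} ξ_i λ^i` of a series `ξ`. This is the value
`ξ_+(l)` of the full polynomial part whenever `ξ` has degree at most `N` in `λ`. -/
def plusEval {n : ℕ} (N : ℕ) (ξ : Loop n) (l : ℂ) : Mat n ℂ :=
  ∑ i ∈ Finset.range (N + 1), l ^ i • toC (lcoeff ξ (i : ℤ))

/-- `F(x, t, λ)` is a frame on `U` of the solution `q` of the `(2j-1)`-th flow: it takes values
in `O_ℂ(n+1,n)`, is smooth in `(x, t)` and entire in `λ`, and satisfies
`F⁻¹ F_x = β λ + b + q`, `F⁻¹ F_t = (T(q,λ)^(2j-1))_+`, `conj F(x,t,conj λ) = F(x,t,λ)`.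
As `T` has degree one in `λ`, the degree of `T^(2j-1)` is at most `2j-1`. -/
def IsFrame (n j : ℕ) (U : Set (ℝ × ℝ)) (q : ℝ × ℝ → Mat n ℝ)
    (F : ℝ × ℝ → ℂ → Mat n ℂ) : Prop :=
  (∀ l : ℂ, SmoothMat U fun p => F p l) ∧
  (∀ p ∈ U, ∀ i k, Differentiable ℂ fun l => F p l i k) ∧
  (∀ p ∈ U, ∀ l : ℂ, IsOrthGroup n (F p l)) ∧
  (∀ p ∈ U, ∀ l : ℂ, (F p (starRingEnd ℂ l)).map (starRingEnd ℂ) = F p l) ∧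
  (∀ p ∈ U, ∀ l : ℂ, (F p l)⁻¹ * partialX (fun r => F r l) p =
      l • toC (beta n) + toC (bMat n + q p)) ∧
  ∃ T : ℝ × ℝ → Loop n, IsResolvent n U q T ∧
    ∀ p ∈ U, ∀ l : ℂ, (F p l)⁻¹ * partialT (fun r => F r l) p =
      plusEval (2 * j - 1) (T p ^ (2 * j - 1)) l

/-- `P` is the projection of `ℝ^(2n+1)` onto `V₁` along `V₂`. -/
def IsProjection {n : ℕ} (P : Mat n ℝ) (V₁ V₂ : Submodule ℝ (Fin (2 * n + 1) → ℝ)) : Prop :=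
  P * P = P ∧ LinearMap.range P.mulVecLin = V₁ ∧ LinearMap.ker P.mulVecLin = V₂

/-- The subspace `A⁻¹ V` of `ℝ^(2n+1)`, for an invertible complex matrix `A` with real entries. -/
def invImage {n : ℕ} (A : Mat n ℂ) (V : Submodule ℝ (Fin (2 * n + 1) → ℝ)) :
    Submodule ℝ (Fin (2 * n + 1) → ℝ) :=
  V.map ((A.map Complex.re)⁻¹).mulVecLin

/-- The rational loop
`g_{α₁,α₂,π}(λ) = I + (α₂-α₁)/(λ-α₂) π + (α₁-α₂)/(λ-α₁) π^♯`, for `λ ≠ α₁, α₂`. -/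
def gLoop {n : ℕ} (α₁ α₂ : ℝ) (P : Mat n ℝ) (l : ℂ) : Mat n ℂ :=
  1 + (((α₂ : ℂ) - α₁) / (l - α₂)) • toC P + (((α₁ : ℂ) - α₂) / (l - α₁)) • toC (sharp P)

end BHat

end

/-!
Write `A*` for the adjoint `ρ Aᵀ ρ`, `π` for the given projection, `Q(x, t)` for the transported one
and `g_π`, `g_Q` for the rational loops. The inverse of `g_Q` is its adjoint, obtained by exchanging
the two poles, and on the level of the operators the theorem says that the gauge transformation by
`g_Q` takes polynomials in `λ` to polynomials.

*Transport.* As the image and the kernel of `Q` are moved by the orthogonal matrices `F(α₁)⁻¹` and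
`F(α₂)⁻¹`, isotropy is preserved, so that `Q Q* = Q* Q = 0` (`IsTransported.mul_adj_eq_zero`,
`IsTransported.adj_mul_eq_zero`). Because `π` has rank one, `Q` is a scalar multiple of
`F(α₁)⁻¹ π F(α₂)`, hence smooth (`IsTransported.eq_smul`), and along `F' = F A(λ)` it obeys
`Q' = Q A(α₂) (1 - Q) - (1 - Q) A(α₁) Q` (`hasMatDeriv_transported`).

*No poles.* The loop `g_Q` is a product of two Darboux factors, one built from `Q` and one from
`Q*`. For each factor the residues of the transformed object vanish by the choice of `Q`. The second
factor meets one further term, in which a skew-adjoint matrix `X` stands between `Q` and `Q*` (or `π` and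
`π*`); it vanishes because `Q X Q*` is skew-adjoint and, `Q` having rank one, also a multiple of a
self-adjoint matrix (`mul_skew_mul_adj`). For the two linear operators this yields polynomial gauge
transforms (`darboux_darboux_mul`, `exists_isGauge`, `isGauge_linear`), and for
`g_π F g_Q⁻¹` an entire function (`exists_entire_dressing`).

*The flow.* The transform of `β λ + b + q` is `β λ + b + q̃`, so `T̃ = g_Q T g_Q⁻¹`, expanded at
`λ = ∞`, is the resolvent of `q̃` (`isResolvent_conj`). As `g_Q = 1 + O(λ⁻¹)`, the transform of
`(T^(2j-1))_+` differs from `T̃^(2j-1)` by negative powers only; being a polynomial, it is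
`(T̃^(2j-1))_+` (`IsGauge.eq_plusPoly`).

*The frame.* Off the poles the dressed frame satisfies the transformed linear equations by a direct
computation (`hasMatDeriv_dressed`). That it is smooth in `(x, t)` and satisfies them at
`λ = α₁, α₂` too follows from Cauchy's formula on a circle around both poles, with Grönwall's
inequality for the uniform bounds (`hasFDerivAt_of_linear`). The algebraic conditions extend to the
poles by continuity. The flow equation for `q̃` is the compatibility condition of the two
equations for the frame at `λ = 0` (`isSolution_of_isFrame`).
-/

namespace BHat

/-! ### Calculus of matrix-valued functions -/

/-- `f'` is the derivative at `s` of the matrix-valued function `f`, entry by entry. -/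
def HasMatDeriv {n : ℕ} {K : Type*} [NormedAddCommGroup K] [NormedSpace ℝ K]
    (f : ℝ → Mat n K) (f' : Mat n K) (s : ℝ) : Prop :=
  ∀ i k, HasDerivAt (fun u => f u i k) (f' i k) s

namespace HasMatDeriv

section

variable {n : ℕ} {K : Type*} [NormedCommRing K] [NormedAlgebra ℝ K] {f g : ℝ → Mat n K}
  {f' g' : Mat n K} {s : ℝ}

theorem unique (hf : HasMatDeriv f f' s) (hg : HasMatDeriv f g' s) : f' = g' := by
  ext i k
  exact (hf i k).unique (hg i k)

theorem add (hf : HasMatDeriv f f' s) (hg : HasMatDeriv g g' s) :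
    HasMatDeriv (fun u => f u + g u) (f' + g') s :=
  fun i k => (hf i k).add (hg i k)

theorem sub (hf : HasMatDeriv f f' s) (hg : HasMatDeriv g g' s) :
    HasMatDeriv (fun u => f u - g u) (f' - g') s :=
  fun i k => (hf i k).sub (hg i k)

theorem const (c : Mat n K) : HasMatDeriv (fun _ => c) 0 s :=
  fun i k => hasDerivAt_const s (c i k)

theorem const_smul (c : K) (hf : HasMatDeriv f f' s) : HasMatDeriv (fun u => c • f u) (c • f') s :=
  fun i k => (hf i k).const_mul c

theorem sum {ι : Type*} {I : Finset ι} {f : ι → ℝ → Mat n K} {f' : ι → Mat n K}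
    (hf : ∀ a ∈ I, HasMatDeriv (f a) (f' a) s) :
    HasMatDeriv (fun u => ∑ a ∈ I, f a u) (∑ a ∈ I, f' a) s := by
  intro i k
  simp only [Matrix.sum_apply]
  exact HasDerivAt.fun_sum fun a ha => hf a ha i k

theorem mul (hf : HasMatDeriv f f' s) (hg : HasMatDeriv g g' s) :
    HasMatDeriv (fun u => f u * g u) (f' * g s + f s * g') s := by
  intro i k
  simp only [Matrix.mul_apply, Matrix.add_apply, ← Finset.sum_add_distrib]
  exact HasDerivAt.fun_sum fun l _ => (hf i l).mul (hg l k)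

theorem const_mul (c : Mat n K) (hf : HasMatDeriv f f' s) :
    HasMatDeriv (fun u => c * f u) (c * f') s := by
  simpa using (const c).mul hf

theorem mul_const (hf : HasMatDeriv f f' s) (c : Mat n K) :
    HasMatDeriv (fun u => f u * c) (f' * c) s := by
  simpa using hf.mul (const c)

theorem transpose (hf : HasMatDeriv f f' s) : HasMatDeriv (fun u => (f u)ᵀ) f'ᵀ s :=
  fun i k => hf k i

theorem congr_of_eventuallyEq (hf : HasMatDeriv f f' s) (h : ∀ᶠ u in nhds s, g u = f u) :
    HasMatDeriv g f' s :=
  fun i k => (hf i k).congr_of_eventuallyEq (h.mono fun u hu => by simp [hu])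

end

theorem toC {n : ℕ} {f : ℝ → Mat n ℝ} {f' : Mat n ℝ} {s : ℝ} (hf : HasMatDeriv f f' s) :
    HasMatDeriv (fun u => BHat.toC (f u)) (BHat.toC f') s :=
  fun i k => (hf i k).ofReal_comp

theorem re {n : ℕ} {f : ℝ → Mat n ℂ} {f' : Mat n ℂ} {s : ℝ} (hf : HasMatDeriv f f' s) :
    HasMatDeriv (fun u => (f u).map Complex.re) (f'.map Complex.re) s :=
  fun i k => Complex.reCLM.hasFDerivAt.comp_hasDerivAt s (hf i k)

end HasMatDeriv

section Partial

variable {n : ℕ} {K : Type*} [NormedCommRing K] [NormedAlgebra ℝ K]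

theorem partialX_eq {f : ℝ × ℝ → Mat n K} {p : ℝ × ℝ} {D : Mat n K}
    (h : HasMatDeriv (fun s => f (s, p.2)) D p.1) : partialX f p = D := by
  ext i k
  exact (h i k).deriv

theorem partialT_eq {f : ℝ × ℝ → Mat n K} {p : ℝ × ℝ} {D : Mat n K}
    (h : HasMatDeriv (fun s => f (p.1, s)) D p.2) : partialT f p = D := by
  ext i k
  exact (h i k).deriv

theorem hasDerivAt_lineX {E : Type*} [NormedAddCommGroup E] [NormedSpace ℝ E]
    {f : ℝ × ℝ → E} {L : ℝ × ℝ →L[ℝ] E} {p : ℝ × ℝ} (h : HasFDerivAt f L p) :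
    HasDerivAt (fun s => f (s, p.2)) (L (1, 0)) p.1 :=
  HasFDerivAt.comp_hasDerivAt (f := fun s : ℝ => (s, p.2)) p.1 h
    ((hasDerivAt_id p.1).prodMk (hasDerivAt_const p.1 p.2))

theorem hasDerivAt_lineT {E : Type*} [NormedAddCommGroup E] [NormedSpace ℝ E]
    {f : ℝ × ℝ → E} {L : ℝ × ℝ →L[ℝ] E} {p : ℝ × ℝ} (h : HasFDerivAt f L p) :
    HasDerivAt (fun s => f (p.1, s)) (L (0, 1)) p.2 :=
  HasFDerivAt.comp_hasDerivAt (f := fun s : ℝ => (p.1, s)) p.2 h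
    ((hasDerivAt_const p.2 p.1).prodMk (hasDerivAt_id p.2))

/-- The linear map `(x, t) ↦ x u + t v`: the differential of a map with partial derivatives
`u` and `v`. -/
noncomputable def pairCLM {E : Type*} [NormedAddCommGroup E] [NormedSpace ℝ E] (u v : E) :
    ℝ × ℝ →L[ℝ] E :=
  (ContinuousLinearMap.fst ℝ ℝ ℝ).smulRight u + (ContinuousLinearMap.snd ℝ ℝ ℝ).smulRight v

@[simp] theorem pairCLM_apply {E : Type*} [NormedAddCommGroup E] [NormedSpace ℝ E] (u v : E)
    (w : ℝ × ℝ) : pairCLM u v w = w.1 • u + w.2 • v := rfl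

theorem eq_pairCLM {E : Type*} [NormedAddCommGroup E] [NormedSpace ℝ E] (L : ℝ × ℝ →L[ℝ] E) :
    L = pairCLM (L (1, 0)) (L (0, 1)) := by
  ext <;> simp

theorem norm_pairCLM_le {E : Type*} [NormedAddCommGroup E] [NormedSpace ℝ E] (u v : E) :
    ‖pairCLM u v‖ ≤ ‖u‖ + ‖v‖ := by
  refine ContinuousLinearMap.opNorm_le_bound _ (by positivity) fun w => ?_
  rw [pairCLM_apply, add_mul]
  refine (norm_add_le _ _).trans (add_le_add ?_ ?_)
  · rw [norm_smul, mul_comm]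
    exact mul_le_mul_of_nonneg_left (norm_fst_le w) (norm_nonneg _)
  · rw [norm_smul, mul_comm]
    exact mul_le_mul_of_nonneg_left (norm_snd_le w) (norm_nonneg _)

theorem SmoothMat.hasFDerivAt {U : Set (ℝ × ℝ)} (hU : IsOpen U) {f : ℝ × ℝ → Mat n K}
    (hf : SmoothMat U f) {p : ℝ × ℝ} (hp : p ∈ U) (i k : Fin (2 * n + 1)) :
    HasFDerivAt (fun r => f r i k) (pairCLM (partialX f p i k) (partialT f p i k)) p := by
  have h := ((hf i k).contDiffAt (hU.mem_nhds hp)).differentiableAt (by simp)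
    |>.hasFDerivAt
  have e := eq_pairCLM (fderiv ℝ (fun r => f r i k) p)
  rw [← (hasDerivAt_lineX h).deriv, ← (hasDerivAt_lineT h).deriv] at e
  rw [e] at h
  exact h

theorem SmoothMat.hasMatDerivX {U : Set (ℝ × ℝ)} (hU : IsOpen U) {f : ℝ × ℝ → Mat n K}
    (hf : SmoothMat U f) {p : ℝ × ℝ} (hp : p ∈ U) :
    HasMatDeriv (fun s => f (s, p.2)) (partialX f p) p.1 := fun i k => by
  simpa using hasDerivAt_lineX (hf.hasFDerivAt hU hp i k)

theorem SmoothMat.hasMatDerivT {U : Set (ℝ × ℝ)} (hU : IsOpen U) {f : ℝ × ℝ → Mat n K}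
    (hf : SmoothMat U f) {p : ℝ × ℝ} (hp : p ∈ U) :
    HasMatDeriv (fun s => f (p.1, s)) (partialT f p) p.2 := fun i k => by
  simpa using hasDerivAt_lineT (hf.hasFDerivAt hU hp i k)

variable {U : Set (ℝ × ℝ)} {f g : ℝ × ℝ → Mat n K}

theorem SmoothMat.add (hf : SmoothMat U f) (hg : SmoothMat U g) :
    SmoothMat U fun p => f p + g p :=
  fun i k => (hf i k).add (hg i k)

theorem SmoothMat.sub (hf : SmoothMat U f) (hg : SmoothMat U g) :
    SmoothMat U fun p => f p - g p :=
  fun i k => (hf i k).sub (hg i k)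

theorem SmoothMat.sum {ι : Type*} {s : Finset ι} {f : ι → ℝ × ℝ → Mat n K}
    (hf : ∀ a ∈ s, SmoothMat U (f a)) : SmoothMat U fun p => ∑ a ∈ s, f a p := by
  intro i k
  simp only [Matrix.sum_apply]
  exact ContDiffOn.sum fun a ha => hf a ha i k

theorem SmoothMat.mul (hf : SmoothMat U f) (hg : SmoothMat U g) :
    SmoothMat U fun p => f p * g p := by
  intro i k
  simp only [Matrix.mul_apply]
  exact ContDiffOn.sum fun l _ => (hf i l).mul (hg l k)

theorem smoothMat_const (c : Mat n K) : SmoothMat U fun _ => c :=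
  fun _ _ => contDiffOn_const

theorem SmoothMat.const_smul (c : K) (hf : SmoothMat U f) : SmoothMat U fun p => c • f p :=
  fun i k => contDiffOn_const.mul (hf i k)

theorem SmoothMat.transpose (hf : SmoothMat U f) : SmoothMat U fun p => (f p)ᵀ :=
  fun i k => hf k i

theorem SmoothMat.congr (hf : SmoothMat U f) (h : ∀ p ∈ U, g p = f p) : SmoothMat U g :=
  fun i k => (hf i k).congr fun p hp => by rw [h p hp]

theorem SmoothMat.mono {V : Set (ℝ × ℝ)} (hf : SmoothMat U f) (h : V ⊆ U) : SmoothMat V f :=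
  fun i k => (hf i k).mono h

theorem SmoothMat.toC {f : ℝ × ℝ → Mat n ℝ} (hf : SmoothMat U f) :
    SmoothMat U fun p => BHat.toC (f p) :=
  fun i k => Complex.ofRealCLM.contDiff.comp_contDiffOn (hf i k)

theorem SmoothMat.re {f : ℝ × ℝ → Mat n ℂ} (hf : SmoothMat U f) :
    SmoothMat U fun p => (f p).map Complex.re :=
  fun i k => Complex.reCLM.contDiff.comp_contDiffOn (hf i k)

end Partial

/-! ### Entire families of matrices depending on a parameter -/

/-- If `g(p, z)` is entire in `z`, is differentiable in `p` for `z` on a circle around `z₀`, and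
the differentials are bounded there and entire in `z`, then it is differentiable in `p` for
`z = z₀` as well: `g(p, z₀)` is the mean of `g(p, ·)` over the circle. -/
theorem hasFDerivAt_of_entire {H : Type*} [NormedAddCommGroup H] [NormedSpace ℝ H]
    [FiniteDimensional ℝ H] {g : H → ℂ → ℂ} {g' : H → ℂ → H →L[ℝ] ℂ} {p₀ : H} {z₀ : ℂ}
    {R ε C : ℝ} (hR : 0 < R) (hε : 0 < ε)
    (hent : ∀ p ∈ Metric.ball p₀ ε, Differentiable ℂ (g p))
    (hd : ∀ p ∈ Metric.ball p₀ ε, ∀ z ∈ Metric.sphere z₀ R,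
      HasFDerivAt (fun p => g p z) (g' p z) p)
    (hb : ∀ p ∈ Metric.ball p₀ ε, ∀ z ∈ Metric.sphere z₀ R, ‖g' p z‖ ≤ C)
    (hent' : ∀ v, Differentiable ℂ fun z => g' p₀ z v) :
    HasFDerivAt (fun p => g p z₀) (g' p₀ z₀) p₀ := by
  have mean : ∀ f : ℂ → ℂ, Differentiable ℂ f →
      ((2 * Real.pi)⁻¹ : ℝ) • ∫ θ in (0 : ℝ)..(2 * Real.pi), f (circleMap z₀ R θ) = f z₀ := by
    intro f hf
    exact DiffContOnCl.circleAverage (R := R) hf.diffContOnCl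
  have hsph : ∀ θ, circleMap z₀ R θ ∈ Metric.sphere z₀ R :=
    fun θ => circleMap_mem_sphere z₀ hR.le θ
  have hp₀ : p₀ ∈ Metric.ball p₀ ε := Metric.mem_ball_self hε
  have hcont' : Continuous fun θ => g' p₀ (circleMap z₀ R θ) := by
    rw [continuous_clm_apply]
    exact fun v => (hent' v).continuous.comp (continuous_circleMap z₀ R)
  have hint := intervalIntegral.hasFDerivAt_integral_of_dominated_of_fderiv_le
    (μ := MeasureTheory.volume) (𝕜 := ℝ) (a := 0) (b := 2 * Real.pi) (bound := fun _ => C)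
    (F := fun p θ => g p (circleMap z₀ R θ)) (F' := fun p θ => g' p (circleMap z₀ R θ))
    (x₀ := p₀) (Metric.ball_mem_nhds p₀ hε)
    (by
      filter_upwards [Metric.ball_mem_nhds p₀ hε] with p hp
      exact ((hent p hp).continuous.comp (continuous_circleMap z₀ R)).aestronglyMeasurable)
    (((hent p₀ hp₀).continuous.comp (continuous_circleMap z₀ R)).intervalIntegrable _ _)
    hcont'.aestronglyMeasurable
    (.of_forall fun θ _ p hp => hb p hp _ (hsph θ))
    intervalIntegrable_const
    (.of_forall fun θ _ p hp => hd p hp _ (hsph θ))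
  have h2 := hint.const_smul ((2 * Real.pi)⁻¹ : ℝ)
  have h3 : ((2 * Real.pi)⁻¹ : ℝ) • ∫ θ in (0 : ℝ)..(2 * Real.pi), g' p₀ (circleMap z₀ R θ) =
      g' p₀ z₀ := by
    ext v
    rw [smul_apply, ContinuousLinearMap.intervalIntegral_apply
      (hcont'.intervalIntegrable _ _)]
    exact mean _ (hent' v)
  rw [h3] at h2
  refine h2.congr_of_eventuallyEq ?_
  filter_upwards [Metric.ball_mem_nhds p₀ hε] with p hp
  exact (mean _ (hent p hp)).symm

theorem norm_vecMul_le {m : Type*} [Fintype m] {M : Matrix m m ℂ} {K : ℝ}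
    (hM : ∀ i k, ‖M i k‖ ≤ K) (v : m → ℂ) : ‖v ᵥ* M‖ ≤ Fintype.card m * K * ‖v‖ := by
  rcases isEmpty_or_nonempty m with h | h
  · simp [Subsingleton.elim v 0]
  have hK : 0 ≤ K := (norm_nonneg _).trans (hM h.some h.some)
  refine (pi_norm_le_iff_of_nonneg (by positivity)).2 fun k => ?_
  refine (norm_sum_le _ _).trans ?_
  calc ∑ i, ‖v i * M i k‖ ≤ ∑ _i : m, ‖v‖ * K := Finset.sum_le_sum fun i _ => by
        rw [norm_mul]
        exact mul_le_mul (norm_le_pi_norm v i) (hM i k) (norm_nonneg _) (norm_nonneg _)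
    _ = Fintype.card m * K * ‖v‖ := by simp; ring

/-- Grönwall's bound for the linear equation `u' = u M` on row vectors. -/
theorem norm_le_exp_of_hasDerivAt_vecMul {m : Type*} [Fintype m] {u : ℝ → m → ℂ}
    {M : ℝ → Matrix m m ℂ} {K : ℝ}
    (hu : ∀ s ∈ Set.Icc (0 : ℝ) 1, HasDerivAt u (u s ᵥ* M s) s)
    (hM : ∀ s ∈ Set.Icc (0 : ℝ) 1, ∀ i k, ‖M s i k‖ ≤ K) :
    ‖u 1‖ ≤ ‖u 0‖ * Real.exp (Fintype.card m * K) := by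
  have h := norm_le_gronwallBound_of_norm_deriv_right_le (f := u) (f' := fun s => u s ᵥ* M s)
    (δ := ‖u 0‖) (K := Fintype.card m * K) (ε := 0) (a := 0) (b := 1)
    (fun s hs => (hu s hs).continuousAt.continuousWithinAt)
    (fun s hs => (hu s (Set.Ico_subset_Icc_self hs)).hasDerivWithinAt) le_rfl
    (fun s hs => by
      rw [add_zero]
      exact norm_vecMul_le (hM s (Set.Ico_subset_Icc_self hs)) _)
    1 (by simp)
  simpa [gronwallBound_ε0] using h

section Linear

variable {n : ℕ} {O : Set (ℝ × ℝ)}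

/-- `A(p, λ)` is a polynomial in `λ` whose coefficients are real matrices depending smoothly on
`p ∈ O`. -/
def IsPolyFamily (O : Set (ℝ × ℝ)) (A : ℝ × ℝ → ℂ → Mat n ℂ) : Prop :=
  ∃ (N : ℕ) (a : ℕ → ℝ × ℝ → Mat n ℝ), (∀ i, SmoothMat O (a i)) ∧
    ∀ p ∈ O, ∀ l, A p l = ∑ i ∈ Finset.range N, l ^ i • toC (a i p)

theorem IsPolyFamily.smoothMat {A : ℝ × ℝ → ℂ → Mat n ℂ} (hA : IsPolyFamily O A) (l : ℂ) :
    SmoothMat O fun p => A p l := by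
  obtain ⟨N, a, ha, hA⟩ := hA
  exact (SmoothMat.sum fun i _ => (ha i).toC.const_smul (l ^ i)).congr fun p hp => hA p hp l

theorem IsPolyFamily.differentiable {A : ℝ × ℝ → ℂ → Mat n ℂ} (hA : IsPolyFamily O A)
    {p : ℝ × ℝ} (hp : p ∈ O) (i k) : Differentiable ℂ fun l => A p l i k := by
  obtain ⟨N, a, ha, hA⟩ := hA
  simp only [hA p hp, Matrix.sum_apply, Matrix.smul_apply, smul_eq_mul]
  fun_prop

theorem IsPolyFamily.continuousOn {A : ℝ × ℝ → ℂ → Mat n ℂ} (hA : IsPolyFamily O A) :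
    ContinuousOn (fun x : (ℝ × ℝ) × ℂ => fun i k => A x.1 x.2 i k) (O ×ˢ Set.univ) := by
  obtain ⟨N, a, ha, hA⟩ := hA
  refine continuousOn_pi.2 fun i => continuousOn_pi.2 fun k => ?_
  have h : ContinuousOn (fun x : (ℝ × ℝ) × ℂ =>
      ∑ m ∈ Finset.range N, x.2 ^ m * toC (a m x.1) i k) (O ×ˢ Set.univ) := by
    refine continuousOn_finsetSum _ fun m _ => (continuousOn_snd.pow m).mul ?_
    exact ((ha m).toC i k).continuousOn.comp continuousOn_fst fun x hx => hx.1
  refine h.congr fun x hx => ?_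
  simp [hA x.1 hx.1, Matrix.sum_apply]

/-- On a small ball and on a circle in the `λ`-plane, solutions of `dG = G (A dx + B dt)` are
bounded, because they are bounded at the centre of the ball. -/
theorem exists_bound_of_linear (hO : IsOpen O) {G A B : ℝ × ℝ → ℂ → Mat n ℂ}
    (hG : ∀ p ∈ O, ∀ i k, Differentiable ℂ fun l => G p l i k)
    (hA : IsPolyFamily O A) (hB : IsPolyFamily O B) {p₀ : ℝ × ℝ} (hp₀ : p₀ ∈ O) {z₀ : ℂ} {R : ℝ}
    (hd : ∀ l ∈ Metric.sphere z₀ R, ∀ p ∈ O, ∀ i k, HasFDerivAt (fun r => G r l i k)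
      (pairCLM ((G p l * A p l) i k) ((G p l * B p l) i k)) p) :
    ∃ ε > 0, Metric.ball p₀ ε ⊆ O ∧ ∃ C, ∀ p ∈ Metric.ball p₀ ε, ∀ l ∈ Metric.sphere z₀ R, ∀ i k,
      ‖pairCLM ((G p l * A p l) i k) ((G p l * B p l) i k)‖ ≤ C := by
  obtain ⟨ε, hε, hball⟩ := Metric.nhds_basis_closedBall.mem_iff.1 (hO.mem_nhds hp₀)
  have hcomp : IsCompact (Metric.closedBall p₀ ε ×ˢ Metric.sphere z₀ R) :=
    (isCompact_closedBall p₀ ε).prod (isCompact_sphere z₀ R)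
  have bdd : ∀ M : ℝ × ℝ → ℂ → Mat n ℂ, IsPolyFamily O M → ∃ K, ∀ p ∈ Metric.closedBall p₀ ε,
      ∀ l ∈ Metric.sphere z₀ R, ∀ i k, ‖M p l i k‖ ≤ K := by
    intro M hM
    obtain ⟨K, hK⟩ := hcomp.exists_bound_of_continuousOn
      (hM.continuousOn.mono (Set.prod_mono hball (Set.subset_univ _)))
    exact ⟨K, fun p hp l hl i k => (norm_le_pi_norm _ k).trans
      ((norm_le_pi_norm (fun i k => M p l i k) i).trans (hK (p, l) ⟨hp, hl⟩))⟩
  obtain ⟨KA, hKA⟩ := bdd A hA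
  obtain ⟨KB, hKB⟩ := bdd B hB
  obtain ⟨C₀, hC₀⟩ := (isCompact_sphere z₀ R).exists_bound_of_continuousOn
    (f := fun l => fun i k => G p₀ l i k)
    (continuousOn_pi.2 fun i => continuousOn_pi.2 fun k =>
      (hG p₀ hp₀ i k).continuous.continuousOn)
  set N := Fintype.card (Fin (2 * n + 1))
  set E := Real.exp (N * (ε * KA + ε * KB))
  have key : ∀ p ∈ Metric.ball p₀ ε, ∀ l ∈ Metric.sphere z₀ R, ∀ i, ‖G p l i‖ ≤ C₀ * E := by
    intro p hp l hl i
    have hcurve : ∀ s ∈ Set.Icc (0 : ℝ) 1, p₀ + s • (p - p₀) ∈ Metric.closedBall p₀ ε := by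
      intro s hs
      rw [mem_closedBall_iff_norm, add_sub_cancel_left, norm_smul, Real.norm_of_nonneg hs.1]
      exact (mul_le_of_le_one_left (norm_nonneg _) hs.2).trans (mem_ball_iff_norm.1 hp).le
    have h := norm_le_exp_of_hasDerivAt_vecMul (u := fun s => G (p₀ + s • (p - p₀)) l i)
      (M := fun s => (p - p₀).1 • A (p₀ + s • (p - p₀)) l + (p - p₀).2 • B (p₀ + s • (p - p₀)) l)
      (K := ε * KA + ε * KB) (fun s hs => ?_) (fun s hs i k => ?_)
    · simp only [one_smul, zero_smul, add_zero, add_sub_cancel] at h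
      refine h.trans (mul_le_mul_of_nonneg_right ?_ (Real.exp_nonneg _))
      exact (norm_le_pi_norm (fun i k => G p₀ l i k) i).trans (hC₀ l hl)
    · rw [hasDerivAt_pi]
      intro k
      have h1 : HasDerivAt (fun s : ℝ => p₀ + s • (p - p₀)) (p - p₀) s := by
        simpa using ((hasDerivAt_id s).smul_const (p - p₀)).const_add p₀
      have h2 := (hd l hl _ (hball (hcurve s hs)) i k).comp_hasDerivAt s h1
      refine h2.congr_deriv ?_
      rw [Matrix.vecMul_add, Matrix.vecMul_smul, Matrix.vecMul_smul, pairCLM_apply]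
      rfl
    · have hw := (mem_ball_iff_norm.1 hp).le
      refine (norm_add_le _ _).trans (add_le_add ?_ ?_)
      · rw [Matrix.smul_apply, norm_smul]
        exact mul_le_mul ((norm_fst_le _).trans hw) (hKA _ (hcurve s hs) l hl i k)
          (norm_nonneg _) hε.le
      · rw [Matrix.smul_apply, norm_smul]
        exact mul_le_mul ((norm_snd_le _).trans hw) (hKB _ (hcurve s hs) l hl i k)
          (norm_nonneg _) hε.le
  refine ⟨ε, hε, Metric.ball_subset_closedBall.trans hball,
    N * KA * (C₀ * E) + N * KB * (C₀ * E), fun p hp l hl i k => ?_⟩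
  have hpc := Metric.ball_subset_closedBall hp
  have bound : ∀ (M : Mat n ℂ) (K : ℝ), (∀ i k, ‖M i k‖ ≤ K) →
      ‖(G p l * M) i k‖ ≤ N * K * (C₀ * E) := by
    intro M K hM
    have hK : 0 ≤ K := (norm_nonneg _).trans (hM i k)
    exact (norm_le_pi_norm (G p l i ᵥ* M) k).trans ((norm_vecMul_le hM _).trans
      (mul_le_mul_of_nonneg_left (key p hp l hl i) (by positivity)))
  exact (norm_pairCLM_le _ _).trans
    (add_le_add (bound _ _ (hKA p hpc l hl)) (bound _ _ (hKB p hpc l hl)))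

/-- Let `G(p, λ)` be entire in `λ` and satisfy `dG = G (A dx + B dt)`, with `A` and `B` polynomial
in `λ`, for all `λ` outside a bounded set. Then it does so for every `λ`. -/
theorem hasFDerivAt_of_linear (hO : IsOpen O) {G A B : ℝ × ℝ → ℂ → Mat n ℂ} {S : Set ℂ}
    (hS : Bornology.IsBounded S)
    (hG : ∀ p ∈ O, ∀ i k, Differentiable ℂ fun l => G p l i k)
    (hA : IsPolyFamily O A) (hB : IsPolyFamily O B)
    (hd : ∀ l ∉ S, ∀ p ∈ O, ∀ i k, HasFDerivAt (fun r => G r l i k)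
      (pairCLM ((G p l * A p l) i k) ((G p l * B p l) i k)) p)
    (l : ℂ) {p : ℝ × ℝ} (hp : p ∈ O) (i k) :
    HasFDerivAt (fun r => G r l i k)
      (pairCLM ((G p l * A p l) i k) ((G p l * B p l) i k)) p := by
  obtain ⟨r, hr⟩ := hS.subset_closedBall l
  -- a circle around `l` that encloses the exceptional set
  have hd' : ∀ z ∈ Metric.sphere l (|r| + 1), ∀ p ∈ O, ∀ i k, HasFDerivAt (fun r => G r z i k)
      (pairCLM ((G p z * A p z) i k) ((G p z * B p z) i k)) p := by
    intro z hz
    refine hd z fun hzS => ?_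
    have h1 := Metric.mem_closedBall.1 (hr hzS)
    rw [Metric.mem_sphere.1 hz] at h1
    linarith [le_abs_self r]
  obtain ⟨ε, hε, hball, C, hC⟩ := exists_bound_of_linear hO hG hA hB hp hd'
  refine hasFDerivAt_of_entire (g := fun p z => G p z i k)
    (g' := fun p z => pairCLM ((G p z * A p z) i k) ((G p z * B p z) i k))
    (R := |r| + 1) (C := C) (by positivity) hε (fun p hp => hG p (hball hp) i k)
    (fun p hp z hz => hd' z hz p (hball hp) i k) (fun p hp z hz => hC p hp z hz i k) fun v => ?_
  have hmul : ∀ M : ℝ × ℝ → ℂ → Mat n ℂ, IsPolyFamily O M →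
      Differentiable ℂ fun z => (G p z * M p z) i k := by
    intro M hM
    simp only [Matrix.mul_apply]
    exact Differentiable.fun_sum fun m _ => (hG p hp i m).mul (hM.differentiable hp m k)
  simp only [pairCLM_apply]
  exact ((hmul A hA).const_smul v.1).add ((hmul B hB).const_smul v.2)

theorem contDiffOn_pairCLM {m : ℕ∞ω} {u v : ℝ × ℝ → ℂ} (hu : ContDiffOn ℝ m u O)
    (hv : ContDiffOn ℝ m v O) : ContDiffOn ℝ m (fun p => pairCLM (u p) (v p)) O :=
  (contDiffOn_const.smulRight hu).add (contDiffOn_const.smulRight hv)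

/-- Solutions of `dG = G (A dx + B dt)` with smooth `A` and `B` are smooth. -/
theorem smoothMat_of_linear (hO : IsOpen O) {G A B : ℝ × ℝ → Mat n ℂ}
    (hA : SmoothMat O A) (hB : SmoothMat O B)
    (hd : ∀ p ∈ O, ∀ i k, HasFDerivAt (fun r => G r i k)
      (pairCLM ((G p * A p) i k) ((G p * B p) i k)) p) : SmoothMat O G := by
  have h : ∀ m : ℕ, ∀ i k, ContDiffOn ℝ m (fun p => G p i k) O := by
    intro m
    induction m with
    | zero =>
      intro i k
      exact contDiffOn_zero.2 fun p hp => (hd p hp i k).continuousAt.continuousWithinAt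
    | succ m ih =>
      intro i k
      have h1 : ∀ M : ℝ × ℝ → Mat n ℂ, SmoothMat O M →
          ContDiffOn ℝ m (fun p => (G p * M p) i k) O := by
        intro M hM
        simp only [Matrix.mul_apply]
        exact ContDiffOn.sum fun a _ => (ih i a).mul ((hM a k).of_le (by exact_mod_cast le_top))
      push_cast
      refine (contDiffOn_succ_iff_fderiv_of_isOpen hO).2
        ⟨fun p hp => (hd p hp i k).differentiableAt.differentiableWithinAt, by simp, ?_⟩
      exact (contDiffOn_pairCLM (h1 A hA) (h1 B hB)).congr fun p hp => (hd p hp i k).fderiv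
  exact fun i k => contDiffOn_infty.2 fun m => h m i k

end Linear

/-! ### Dressing polynomials with noncommuting coefficients -/

section Darboux

open Polynomial

variable {M : Type*} [Ring M] [Algebra ℝ M]

/-- The central polynomial `λ - α`. -/
noncomputable def lin (M : Type*) [Ring M] [Algebra ℝ M] (α : ℝ) : M[X] :=
  X - C (algebraMap ℝ M α)

theorem lin_mul_comm (α : ℝ) (A : M[X]) : lin M α * A = A * lin M α := by
  have h : C (algebraMap ℝ M α) * A = A * C (algebraMap ℝ M α) := by
    ext i
    simpa using Algebra.commutes α (A.coeff i)
  rw [lin, sub_mul, mul_sub, X_mul, h]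

theorem lin_sub_lin (α₁ α₂ : ℝ) : lin M α₁ - lin M α₂ = (α₂ - α₁) • 1 := by
  rw [lin, lin, sub_smul, Algebra.smul_def, Algebra.smul_def]
  simp [Polynomial.algebraMap_apply]

/-- Evaluation of a polynomial at the real number `α`. -/
noncomputable def evalR (α : ℝ) : M[X] →ₐ[ℝ] M :=
  eval₂AlgHom (AlgHom.id ℝ M) (algebraMap ℝ M α) fun x => (Algebra.commutes α x).symm

@[simp] theorem evalR_C (α : ℝ) (c : M) : evalR α (C c) = c := eval₂_C _ _

@[simp] theorem evalR_X (α : ℝ) : evalR α (X : M[X]) = algebraMap ℝ M α :=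
  eval₂_X _ _

/-- Division of `A` by `λ - α` with remainder `A(α)`; the quotient has its coefficients in any
real subspace that contains those of `A`. -/
theorem exists_eq_add_lin_mul (W : Submodule ℝ M) (α : ℝ) (A : M[X]) (hA : ∀ i, A.coeff i ∈ W) :
    evalR α A ∈ W ∧ ∃ A' : M[X], A = C (evalR α A) + lin M α * A' ∧ ∀ i, A'.coeff i ∈ W := by
  have mono : ∀ (m : ℕ) (c : M), c ∈ W → evalR α (monomial m c) ∈ W ∧ ∃ A' : M[X],
      monomial m c = C (evalR α (monomial m c)) + lin M α * A' ∧ ∀ i, A'.coeff i ∈ W := by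
    intro m
    induction m with
    | zero => exact fun c hc => ⟨by simpa using hc, 0, by simp, by simp⟩
    | succ m ih =>
      intro c hc
      obtain ⟨h1, A', h2, h3⟩ := ih c hc
      have e : evalR α (monomial (m + 1) c) = α • evalR α (monomial m c) := by
        rw [← X_mul_monomial, map_mul, evalR_X, Algebra.smul_def]
      refine ⟨e ▸ W.smul_mem α h1, monomial m c + α • A', ?_, fun i => ?_⟩
      · have h4 : monomial (m + 1) c = lin M α * monomial m c + α • monomial m c := by
          rw [lin, sub_mul, X_mul_monomial, Algebra.smul_def, Polynomial.algebraMap_apply]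
          simp
        rw [e, h4, mul_add]
        nth_rewrite 2 [h2]
        rw [smul_add, smul_C, mul_smul_comm]
        abel
      · rw [coeff_add, coeff_smul, coeff_monomial]
        refine W.add_mem ?_ (W.smul_mem α (h3 i))
        split_ifs
        · exact hc
        · exact W.zero_mem
  have h : ∀ s : Finset ℕ, evalR α (∑ m ∈ s, monomial m (A.coeff m)) ∈ W ∧ ∃ A' : M[X],
      ∑ m ∈ s, monomial m (A.coeff m) =
        C (evalR α (∑ m ∈ s, monomial m (A.coeff m))) + lin M α * A' ∧ ∀ i, A'.coeff i ∈ W := by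
    intro s
    induction s using Finset.induction_on with
    | empty => exact ⟨by simp, 0, by simp, by simp⟩
    | insert m s hm ih =>
      obtain ⟨h1, A', h2, h3⟩ := ih
      obtain ⟨k1, B', k2, k3⟩ := mono m _ (hA m)
      rw [Finset.sum_insert hm, map_add]
      refine ⟨W.add_mem k1 h1, B' + A', ?_, fun i => ?_⟩
      · rw [C_add, mul_add]
        nth_rewrite 1 [k2, h2]
        abel
      · rw [coeff_add]
        exact W.add_mem (k3 i) (h3 i)
  have e : ∑ m ∈ A.support, monomial m (A.coeff m) = A := A.as_sum_support.symm
  simpa only [e] using h A.support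

/-- The polynomial obtained from `A` by the gauge transformation with `1 + a / (λ - α₂) P`, where
`A₁` and `A₂` are the quotients of `A` by `λ - α₁` and `λ - α₂`. -/
noncomputable def darboux (a : ℝ) (P : M) (A A₁ A₂ : M[X]) : M[X] :=
  A + a • (C P * A₂ * C (1 - P)) - a • (C (1 - P) * A₁ * C P)

/-- If the projection `P` has the derivative `(P - 1) A(α₁) P + P A(α₂) (1 - P)`, then the gauge
transform of `A` with `1 + a / (λ - α₂) P` is again a polynomial in `λ`. Both sides are multiplied
by `λ - α₂`. -/
theorem darboux_mul {α₁ α₂ : ℝ} {P : M} (hP : P * P = P) {A A₁ A₂ : M[X]}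
    (h1 : A = C (evalR α₁ A) + lin M α₁ * A₁) (h2 : A = C (evalR α₂ A) + lin M α₂ * A₂) :
    darboux (α₂ - α₁) P A A₁ A₂ * (lin M α₂ + (α₂ - α₁) • C P) =
      (lin M α₂ + (α₂ - α₁) • C P) * A -
        (α₂ - α₁) • C (P * evalR α₂ A * (1 - P) - (1 - P) * evalR α₁ A * P) := by
  set a := α₂ - α₁
  set x : M[X] := C P
  have hx : x * x = x := by rw [← C_mul, hP]
  have hx1 : (C (1 - P) : M[X]) = 1 - x := by simp [x]
  have hx2 : (1 - x) * x = 0 := by rw [sub_mul, hx, one_mul, sub_self]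
  have hl : lin M α₁ = lin M α₂ + a • 1 := by rw [← lin_sub_lin α₁ α₂]; abel
  have e2 : lin M α₂ * A₂ = A - C (evalR α₂ A) := eq_sub_of_add_eq' h2.symm
  have e1 : lin M α₂ * A₁ + a • A₁ = A - C (evalR α₁ A) := by
    rw [← eq_sub_of_add_eq' h1.symm, hl, add_mul, smul_mul_assoc, one_mul]
  have t1 : lin M α₂ * darboux a P A A₁ A₂ =
      lin M α₂ * A + a • (x * (A - C (evalR α₂ A)) * (1 - x)) -
        a • ((1 - x) * (lin M α₂ * A₁) * x) := by
    rw [darboux, hx1, mul_sub, mul_add, mul_smul_comm, mul_smul_comm, ← e2]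
    change _ + a • (_ * (x * A₂ * (1 - x))) - a • (_ * ((1 - x) * A₁ * x)) = _
    simp only [← mul_assoc, lin_mul_comm α₂ x, lin_mul_comm α₂ (1 - x)]
  have t2 : darboux a P A A₁ A₂ * a • x = a • (A * x) - a • ((1 - x) * (a • A₁) * x) := by
    have z : x * A₂ * (1 - x) * x = 0 := by rw [mul_assoc, hx2, mul_zero]
    rw [darboux, hx1, mul_smul_comm, sub_mul, add_mul, smul_mul_assoc, smul_mul_assoc, z,
      mul_assoc _ x x, hx, smul_zero, add_zero, smul_sub]
    simp only [mul_smul_comm, smul_mul_assoc]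
  have t3 : (1 - x) * (lin M α₂ * A₁) * x + (1 - x) * (a • A₁) * x =
      (1 - x) * (A - C (evalR α₁ A)) * x := by
    rw [← add_mul, ← mul_add, e1]
  rw [mul_add, ← lin_mul_comm, t1, t2, add_mul, smul_mul_assoc]
  have t4 : (C (P * evalR α₂ A * (1 - P) - (1 - P) * evalR α₁ A * P) : M[X]) =
      x * C (evalR α₂ A) * (1 - x) - (1 - x) * C (evalR α₁ A) * x := by
    simp [x]
  rw [t4, ← sub_eq_zero]
  have t5 : a • ((1 - x) * (lin M α₂ * A₁) * x) =
      a • ((1 - x) * (A - C (evalR α₁ A)) * x) - a • ((1 - x) * (a • A₁) * x) := by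
    rw [← t3, smul_add]; abel
  rw [t5]
  simp only [mul_sub, sub_mul, one_mul, mul_one, smul_sub]
  abel

/-- The numerator `(λ - α₁)(λ - α₂) + a (λ - α₁) P - a (λ - α₂) S` of the rational loop with
residues `a P` at `α₂` and `-a S` at `α₁`, where `a = α₂ - α₁`. -/
noncomputable def numer (α₁ α₂ : ℝ) (P S : M) : M[X] :=
  lin M α₁ * lin M α₂ + (α₂ - α₁) • (lin M α₁ * C P) - (α₂ - α₁) • (lin M α₂ * C S)

/-- Two gauge transformations in succession, with `1 + a / (λ - α₂) P` and with
`1 - a / (λ - α₁) S`. The two vanishing hypotheses express that the second one does not see the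
change that the first one makes in `A(α₁)` and `A(α₂)`. -/
theorem darboux_darboux_mul {α₁ α₂ : ℝ} {P S : M} (hP : P * P = P) (hS : S * S = S)
    (hPS : P * S = 0) (hSP : S * P = 0) {A A₁ A₂ B₁ B₂ : M[X]}
    (h1 : A = C (evalR α₁ A) + lin M α₁ * A₁) (h2 : A = C (evalR α₂ A) + lin M α₂ * A₂)
    (hd1 : S * evalR α₁ A₁ * P = 0) (hd2 : P * evalR α₂ A₂ * S = 0)
    (k1 : darboux (α₂ - α₁) P A A₁ A₂ =
      C (evalR α₁ (darboux (α₂ - α₁) P A A₁ A₂)) + lin M α₁ * B₁)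
    (k2 : darboux (α₂ - α₁) P A A₁ A₂ =
      C (evalR α₂ (darboux (α₂ - α₁) P A A₁ A₂)) + lin M α₂ * B₂) :
    darboux (α₁ - α₂) S (darboux (α₂ - α₁) P A A₁ A₂) B₂ B₁ * numer α₁ α₂ P S =
      numer α₁ α₂ P S * A -
        ((α₂ - α₁) • (lin M α₁ * C (P * evalR α₂ A * (1 - P) - (1 - P) * evalR α₁ A * P)) -
        (α₂ - α₁) • (lin M α₂ * C (S * evalR α₁ A * (1 - S) - (1 - S) * evalR α₂ A * S))) := by
  have s1 := darboux_mul hP h1 h2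
  have s2 := darboux_mul (α₁ := α₂) (α₂ := α₁) hS k2 k1
  set a := α₂ - α₁ with ha
  have ha' : α₁ - α₂ = -a := by rw [ha]; ring
  rw [ha'] at s2 ⊢
  set B := darboux a P A A₁ A₂ with hB
  set B' := darboux (-a) S B B₂ B₁
  have hPS1 : (1 - P) * S = S := by rw [sub_mul, hPS, one_mul, sub_zero]
  have hSP1 : S * (1 - P) = S := by rw [mul_sub, hSP, mul_one, sub_zero]
  have e1 : S * evalR α₁ B = S * evalR α₁ A := by
    rw [hB, darboux]
    simp only [map_add, map_sub, map_smul, map_mul, map_one, evalR_C, mul_add, mul_sub,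
      mul_smul_comm, ← mul_assoc, hSP, zero_mul, mul_one, sub_zero, hd1, smul_zero, add_zero]
  have e2 : evalR α₂ B * S = evalR α₂ A * S := by
    rw [hB, darboux]
    simp only [map_add, map_sub, map_smul, map_mul, evalR_C, add_mul, sub_mul (_ + _),
      smul_mul_assoc, mul_assoc, hPS, hPS1, mul_zero, sub_zero, smul_zero]
    rw [← mul_assoc, hd2, smul_zero, add_zero]
  have hnum : numer α₁ α₂ P S = (lin M α₁ + (-a) • C S) * (lin M α₂ + a • C P) := by
    rw [numer, ← ha]
    have z : (C S * C P : M[X]) = 0 := by rw [← C_mul, hSP, C_0]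
    simp only [add_mul, mul_add, smul_mul_assoc, mul_smul_comm, z, smul_zero, add_zero,
      lin_mul_comm α₂ (C S), neg_smul, neg_mul, neg_zero]
    abel
  have e3 : C (S * evalR α₁ B * (1 - S) - (1 - S) * evalR α₂ B * S) * (lin M α₂ + a • C P) =
      lin M α₂ * C (S * evalR α₁ A * (1 - S) - (1 - S) * evalR α₂ A * S) +
        a • C (S * evalR α₁ A * P) := by
    rw [e1, mul_assoc (1 - S), e2, mul_add, ← lin_mul_comm, mul_smul_comm, ← C_mul,
      mul_assoc (1 - S)]
    congr 3
    rw [sub_mul, mul_assoc (S * _), sub_mul 1, hSP, one_mul, sub_zero,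
      show (1 - S) * (evalR α₂ A * S) * P = (1 - S) * evalR α₂ A * (S * P) by
        simp only [mul_assoc], hSP, mul_zero, sub_zero]
  have e4 : (lin M α₁ + (-a) • C S) * (a • C (P * evalR α₂ A * (1 - P) -
      (1 - P) * evalR α₁ A * P)) =
      a • (lin M α₁ * C (P * evalR α₂ A * (1 - P) - (1 - P) * evalR α₁ A * P)) +
        (a * a) • C (S * evalR α₁ A * P) := by
    rw [add_mul, mul_smul_comm, smul_mul_assoc, mul_smul_comm, ← C_mul, smul_smul]
    have : S * (P * evalR α₂ A * (1 - P) - (1 - P) * evalR α₁ A * P) = -(S * evalR α₁ A * P) := by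
      rw [mul_sub, ← mul_assoc, ← mul_assoc, hSP, zero_mul, zero_mul, ← mul_assoc, ← mul_assoc,
        hSP1, zero_sub]
    rw [this, C_neg, smul_neg, neg_mul, neg_smul, neg_neg]
  rw [hnum, ← mul_assoc, s2, sub_mul, smul_mul_assoc, e3, mul_assoc _ B, s1, mul_sub, e4,
    ← mul_assoc]
  module

end Darboux

section Dress

open Polynomial

variable {M R : Type*} [Ring M] [Algebra ℝ M] [Ring R] [Algebra ℝ R]

/-- The image `1 + a r₂ P - a r₁ S` of the rational loop
`1 + a / (λ - α₂) P - a / (λ - α₁) S` under a homomorphism `ψ` that sends `λ - αᵢ` to a unit with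
inverse `rᵢ`. -/
noncomputable def dress (ψ : M[X] →ₐ[ℝ] R) (r₁ r₂ : R) (a : ℝ) (P S : M) : R :=
  1 + a • (r₂ * ψ (C P)) - a • (r₁ * ψ (C S))

variable {ψ : M[X] →ₐ[ℝ] R} {r₁ r₂ : R} {α₁ α₂ : ℝ}

theorem dress_eq_mul_numer (h1 : r₁ * ψ (lin M α₁) = 1) (h2 : r₂ * ψ (lin M α₂) = 1)
    (c2 : ∀ x, r₂ * x = x * r₂) (P S : M) :
    dress ψ r₁ r₂ (α₂ - α₁) P S = r₁ * r₂ * ψ (numer α₁ α₂ P S) := by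
  have e1 : ∀ x, r₁ * r₂ * (ψ (lin M α₁) * x) = r₂ * x := fun x => by
    rw [mul_assoc, ← mul_assoc r₂, c2, mul_assoc, ← mul_assoc, h1, one_mul]
  have e2 : ∀ x, r₁ * r₂ * (ψ (lin M α₂) * x) = r₁ * x := fun x => by
    rw [mul_assoc, ← mul_assoc r₂, h2, one_mul]
  simp only [numer, dress, map_sub, map_add, map_smul, map_mul, mul_sub, mul_add, mul_smul_comm,
    e1, e2, h2]

/-- A gauge identity between polynomials passes to any algebra in which `λ - α₁` and `λ - α₂`
become invertible. -/
theorem map_mul_dress (h1 : r₁ * ψ (lin M α₁) = 1) (h2 : r₂ * ψ (lin M α₂) = 1)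
    (c1 : ∀ x, r₁ * x = x * r₁) (c2 : ∀ x, r₂ * x = x * r₂) {A B : M[X]} {P S D E : M}
    (h : B * numer α₁ α₂ P S = numer α₁ α₂ P S * A -
      ((α₂ - α₁) • (lin M α₁ * C D) - (α₂ - α₁) • (lin M α₂ * C E))) :
    ψ B * dress ψ r₁ r₂ (α₂ - α₁) P S = dress ψ r₁ r₂ (α₂ - α₁) P S * ψ A -
      ((α₂ - α₁) • (r₂ * ψ (C D)) - (α₂ - α₁) • (r₁ * ψ (C E))) := by
  have e1 : ∀ x, r₁ * r₂ * (ψ (lin M α₁) * x) = r₂ * x := fun x => by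
    rw [mul_assoc, ← mul_assoc r₂, c2, mul_assoc, ← mul_assoc, h1, one_mul]
  have e2 : ∀ x, r₁ * r₂ * (ψ (lin M α₂) * x) = r₁ * x := fun x => by
    rw [mul_assoc, ← mul_assoc r₂, h2, one_mul]
  have h' := congrArg (fun z => r₁ * r₂ * ψ z) h
  simp only [map_sub, map_smul, map_mul, mul_sub, mul_smul_comm, e1, e2] at h'
  have e3 : ψ B * (r₁ * r₂) = r₁ * r₂ * ψ B := by rw [mul_assoc, c2, ← mul_assoc, ← c1, mul_assoc]
  rw [dress_eq_mul_numer h1 h2 c2, mul_assoc (r₁ * r₂), ← h', ← mul_assoc, e3, mul_assoc]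

theorem smul_mul_eq_sub (h1 : r₁ * ψ (lin M α₁) = 1) (h2 : r₂ * ψ (lin M α₂) = 1)
    (c1 : ∀ x, r₁ * x = x * r₁) : (α₂ - α₁) • (r₁ * r₂) = r₂ - r₁ := by
  have h := congrArg (fun z => r₁ * (r₂ * ψ z)) (lin_sub_lin (M := M) α₁ α₂)
  simp only [map_sub, map_smul, map_one, mul_sub, mul_smul_comm, mul_one, h2] at h
  rw [← h, c1, mul_assoc, ← c1, h1, mul_one]

/-- The inverse of the rational loop is obtained by exchanging its two poles. -/
theorem dress_mul_dress (h1 : r₁ * ψ (lin M α₁) = 1) (h2 : r₂ * ψ (lin M α₂) = 1)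
    (c1 : ∀ x, r₁ * x = x * r₁) (c2 : ∀ x, r₂ * x = x * r₂) {P S : M} (hP : P * P = P)
    (hS : S * S = S) (hPS : P * S = 0) (hSP : S * P = 0) :
    dress ψ r₁ r₂ (α₂ - α₁) P S * dress ψ r₂ r₁ (α₁ - α₂) P S = 1 := by
  set a := α₂ - α₁ with ha
  have hr : a • (r₁ * r₂) = r₂ - r₁ := smul_mul_eq_sub h1 h2 c1
  have ha' : α₁ - α₂ = -a := by rw [ha]; ring
  rw [ha']
  set x := ψ (C P)
  set y := ψ (C S)
  have hx : x * x = x := by rw [← map_mul, ← C_mul, hP]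
  have hy : y * y = y := by rw [← map_mul, ← C_mul, hS]
  have hxy : x * y = 0 := by rw [← map_mul, ← C_mul, hPS, C_0, map_zero]
  have hyx : y * x = 0 := by rw [← map_mul, ← C_mul, hSP, C_0, map_zero]
  have m1 : ∀ r u v, (r * u) * (r₁ * v) = r * r₁ * (u * v) := fun r u v => by
    rw [mul_assoc, ← mul_assoc u, ← c1, mul_assoc, mul_assoc]
  have m2 : ∀ r u v, (r * u) * (r₂ * v) = r * r₂ * (u * v) := fun r u v => by
    rw [mul_assoc, ← mul_assoc u, ← c2, mul_assoc, mul_assoc]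
  have k1 : a • (r₁ * r₂ * x) = r₂ * x - r₁ * x := by rw [← smul_mul_assoc, hr, sub_mul]
  have k2 : a • (r₁ * r₂ * y) = r₂ * y - r₁ * y := by rw [← smul_mul_assoc, hr, sub_mul]
  have e : dress ψ r₁ r₂ a P S * dress ψ r₂ r₁ (-a) P S =
      1 + a • (r₂ * x - r₁ * x) - a • (a • (r₁ * r₂ * x)) +
        (a • (r₂ * y - r₁ * y) - a • (a • (r₁ * r₂ * y))) := by
    change (1 + a • (r₂ * x) - a • (r₁ * y)) * (1 + (-a) • (r₁ * x) - (-a) • (r₂ * y)) = _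
    simp only [add_mul, sub_mul, mul_add, mul_sub, one_mul, mul_one, smul_mul_assoc,
      mul_smul_comm, m1, m2, hx, hy, hxy, hyx, mul_zero, smul_zero, ← c1 r₂]
    module
  rw [e, k1, k2]
  abel

end Dress

/-! ### The adjoint with respect to the bilinear form -/

section Adjoint

variable {n : ℕ} {K : Type*} [Field K]

theorem rho_apply (i k : Fin (2 * n + 1)) :
    rho n K i k = if k = i.rev then (-1) ^ (n + (i : ℕ)) else 0 := by
  have h : ((i : ℕ) + (k : ℕ) = 2 * n) ↔ k = i.rev := by
    rw [Fin.ext_iff, Fin.val_rev]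
    omega
  simp only [rho, Matrix.of_apply, h]

theorem rho_transpose (n : ℕ) (K : Type*) [Field K] : (rho n K)ᵀ = rho n K := by
  ext i k
  simp only [Matrix.transpose_apply, rho, Matrix.of_apply, add_comm (k : ℕ)]
  split_ifs with h
  · have : (n + (k : ℕ)) + (n + (i : ℕ)) = 2 * (2 * n) := by omega
    have h2 : ((-1) ^ (n + (k : ℕ)) : K) * (-1) ^ (n + (i : ℕ)) = 1 := by
      rw [← pow_add, this, pow_mul]; simp
    have h3 : ((-1) ^ (n + (i : ℕ)) : K) * (-1) ^ (n + (i : ℕ)) = 1 := by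
      rw [← pow_add, ← two_mul, pow_mul]; simp
    exact mul_right_cancel₀ (b := (-1) ^ (n + (i : ℕ))) (by simp) (h2.trans h3.symm)
  · rfl

theorem rho_mul_rho (n : ℕ) (K : Type*) [Field K] : rho n K * rho n K = 1 := by
  ext i k
  simp only [Matrix.mul_apply, rho_apply, ite_mul, zero_mul, Finset.sum_ite_eq', Finset.mem_univ,
    if_true, Fin.rev_rev, Matrix.one_apply, eq_comm (a := k)]
  split_ifs with h
  · rw [← pow_add, Fin.val_rev]
    have : n + (i : ℕ) + (n + (2 * n + 1 - (i + 1))) = 2 * (2 * n) := by omega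
    rw [this, pow_mul]; simp
  · simp

/-- The adjoint `ρ Aᵀ ρ` over any field; over `ℝ` it is `sharp`. -/
def adj (A : Mat n K) : Mat n K := rho n K * Aᵀ * rho n K

theorem adj_mul (A B : Mat n K) : adj (A * B) = adj B * adj A := by
  have h : adj B * adj A = rho n K * Bᵀ * (rho n K * rho n K) * Aᵀ * rho n K := by
    simp only [adj, mul_assoc]
  rw [h, rho_mul_rho, mul_one, adj, Matrix.transpose_mul, mul_assoc (rho n K) Bᵀ]

theorem adj_adj (A : Mat n K) : adj (adj A) = A := by
  have h : adj (adj A) = (rho n K * rho n K) * A * (rho n K * rho n K) := by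
    simp only [adj, Matrix.transpose_mul, Matrix.transpose_transpose, rho_transpose, mul_assoc]
  rw [h, rho_mul_rho, one_mul, mul_one]

theorem adj_one : adj (1 : Mat n K) = 1 := by
  rw [adj, Matrix.transpose_one, mul_one, rho_mul_rho]

theorem adj_add (A B : Mat n K) : adj (A + B) = adj A + adj B := by
  simp [adj, mul_add, add_mul]

theorem adj_smul (c : K) (A : Mat n K) : adj (c • A) = c • adj A := by
  simp [adj]

/-- The adjoint as a linear map. -/
def adjL (n : ℕ) (K : Type*) [Field K] : Mat n K →ₗ[K] Mat n K where
  toFun := adj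
  map_add' := adj_add
  map_smul' := adj_smul

@[simp] theorem adjL_apply (A : Mat n K) : adjL n K A = adj A := rfl

theorem adj_sub (A B : Mat n K) : adj (A - B) = adj A - adj B := map_sub (adjL n K) A B

theorem adj_zero : adj (0 : Mat n K) = 0 := map_zero (adjL n K)

theorem adj_eq_sharp (A : Mat n ℝ) : adj A = sharp A := rfl

theorem isOrthLie_iff {A : Mat n ℝ} : IsOrthLie n A ↔ adj A = -A := by
  have h : adj A + A = rho n ℝ * (Aᵀ * rho n ℝ + rho n ℝ * A) := by
    rw [mul_add, ← mul_assoc, ← mul_assoc, rho_mul_rho, one_mul]; rfl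
  rw [← add_eq_zero_iff_eq_neg, IsOrthLie]
  constructor
  · intro h0
    rw [h, h0, mul_zero]
  · intro h0
    rw [h] at h0
    have := congrArg (fun B => rho n ℝ * B) h0
    simpa [← mul_assoc, rho_mul_rho] using this

/-- If `gᵀ ρ g = ρ`, then `adj g` is the inverse of `g`. -/
theorem adj_mul_self {g : Mat n K} (h : gᵀ * rho n K * g = rho n K) : adj g * g = 1 := by
  rw [adj, mul_assoc, mul_assoc, ← mul_assoc gᵀ, h, rho_mul_rho]

theorem transpose_mul_rho_mul {g : Mat n K} (h : adj g * g = 1) :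
    gᵀ * rho n K * g = rho n K := by
  have := congrArg (fun B => rho n K * B) h
  simp only [adj, ← mul_assoc, rho_mul_rho, one_mul, mul_one] at this
  exact this

theorem trace_adj (A : Mat n K) : (adj A).trace = A.trace := by
  rw [adj, Matrix.trace_mul_comm, ← mul_assoc, rho_mul_rho, one_mul, Matrix.trace_transpose]

/-- A rank-one matrix `P` satisfies `P X P* = 0` for every skew-adjoint `X`: the product is both
skew-adjoint and, being a multiple of `v vᵀ ρ`, self-adjoint. -/
theorem mul_skew_mul_adj [CharZero K] {P X : Mat n K} {v w : Fin (2 * n + 1) → K}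
    (hP : P = Matrix.vecMulVec v w) (hX : adj X = -X) : P * X * adj P = 0 := by
  have h1 : adj (P * X * adj P) = -(P * X * adj P) := by
    rw [adj_mul, adj_mul, adj_adj, hX, neg_mul, mul_neg, mul_assoc]
  have h2 : P * X * adj P = (w ⬝ᵥ ((X * rho n K) *ᵥ w)) • (Matrix.vecMulVec v v * rho n K) := by
    rw [adj, hP, Matrix.transpose_vecMulVec, ← mul_assoc, ← mul_assoc, ← smul_mul_assoc]
    congr 1
    rw [mul_assoc _ X, Matrix.vecMulVec_mul, Matrix.vecMulVec_mul_vecMulVec,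
      Matrix.dotProduct_mulVec]
    ext i k
    simp [Matrix.vecMulVec_apply]
    ring
  have h3 : adj (Matrix.vecMulVec v v * rho n K) = Matrix.vecMulVec v v * rho n K := by
    rw [adj, Matrix.transpose_mul, rho_transpose, Matrix.transpose_vecMulVec, ← mul_assoc,
      rho_mul_rho, one_mul]
  have h4 : adj (P * X * adj P) = P * X * adj P := by rw [h2, adj_smul, h3]
  have h5 : P * X * adj P = -(P * X * adj P) := h4.symm.trans h1
  ext i k
  have h6 := congrFun (congrFun h5 i) k
  rw [Matrix.neg_apply] at h6
  exact CharZero.eq_neg_self_iff.1 h6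

/-- The transposed form of `mul_skew_mul_adj`. -/
theorem adj_mul_skew_mul [CharZero K] {P X : Mat n K} {v w : Fin (2 * n + 1) → K}
    (hP : P = Matrix.vecMulVec v w) (hX : adj X = -X) : adj P * X * P = 0 := by
  have e : adj P = Matrix.vecMulVec (rho n K *ᵥ w) (v ᵥ* rho n K) := by
    rw [adj, hP, Matrix.transpose_vecMulVec, Matrix.mul_vecMulVec, Matrix.vecMulVec_mul]
  simpa [adj_adj] using mul_skew_mul_adj e hX

end Adjoint

/-! ### Formal Laurent series with matrix coefficients -/

section Loops

open Polynomial

variable {n : ℕ}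

/-- The coefficients of `ξ` in degrees below `N` of the variable `λ⁻¹` vanish. -/
def LowBdd (N : ℤ) (ξ : Loop n) : Prop := ∀ i < N, ξ.coeff i = 0

theorem exists_lowBdd (ξ : Loop n) : ∃ N, LowBdd N ξ :=
  ⟨ξ.order, fun _ hi => HahnSeries.coeff_eq_zero_of_lt_order hi⟩

theorem LowBdd.mono {N N' : ℤ} {ξ : Loop n} (h : LowBdd N ξ) (hN : N' ≤ N) : LowBdd N' ξ :=
  fun i hi => h i (hi.trans_le hN)

/-- The coefficients of a product as sums over an explicit interval. -/
theorem coeff_mul_eq_sum {N N' : ℤ} {ξ η : Loop n} (hξ : LowBdd N ξ) (hη : LowBdd N' η) (k : ℤ) :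
    (ξ * η).coeff k = ∑ i ∈ Finset.Icc N (k - N'), ξ.coeff i * η.coeff (k - i) := by
  rw [HahnSeries.coeff_mul]
  refine Finset.sum_of_injOn Prod.fst ?_ ?_ ?_ ?_
  · rintro ⟨a, b⟩ h ⟨c, d⟩ h' (rfl : a = c)
    simp only [SetLike.mem_coe, Finset.mem_antidiagonal] at h h'
    rw [Prod.mk.injEq]
    exact ⟨rfl, by linarith [h.2.2, h'.2.2]⟩
  · rintro ⟨a, b⟩ h
    simp only [SetLike.mem_coe, Finset.mem_antidiagonal, HahnSeries.mem_support] at h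
    obtain ⟨ha, hb, hab⟩ := h
    have h1 : N ≤ a := by
      by_contra hlt
      exact ha (hξ a (not_le.1 hlt))
    have h2 : N' ≤ b := by
      by_contra hlt
      exact hb (hη b (not_le.1 hlt))
    rw [Finset.mem_coe, Finset.mem_Icc]
    exact ⟨h1, by linarith⟩
  · intro i _ hi
    by_cases h1 : ξ.coeff i = 0
    · rw [h1, zero_mul]
    by_cases h2 : η.coeff (k - i) = 0
    · rw [h2, mul_zero]
    refine absurd ⟨(i, k - i), ?_, rfl⟩ hi
    simp only [SetLike.mem_coe, Finset.mem_antidiagonal, HahnSeries.mem_support]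
    exact ⟨h1, h2, by ring⟩
  · rintro ⟨a, b⟩ h
    simp only [Finset.mem_antidiagonal] at h
    rw [← h.2.2, add_sub_cancel_left]

theorem LowBdd.mul {N N' : ℤ} {ξ η : Loop n} (hξ : LowBdd N ξ) (hη : LowBdd N' η) :
    LowBdd (N + N') (ξ * η) := by
  intro k hk
  rw [coeff_mul_eq_sum hξ hη, Finset.Icc_eq_empty (by linarith), Finset.sum_empty]

theorem LowBdd.add {N : ℤ} {ξ η : Loop n} (hξ : LowBdd N ξ) (hη : LowBdd N η) :
    LowBdd N (ξ + η) := fun i hi => by rw [HahnSeries.coeff_add, hξ i hi, hη i hi, add_zero]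

theorem LowBdd.sub {N : ℤ} {ξ η : Loop n} (hξ : LowBdd N ξ) (hη : LowBdd N η) :
    LowBdd N (ξ - η) := fun i hi => by rw [HahnSeries.coeff_sub, hξ i hi, hη i hi, sub_zero]

theorem LowBdd.smul {N : ℤ} {ξ : Loop n} (a : ℝ) (hξ : LowBdd N ξ) : LowBdd N (a • ξ) :=
  fun i hi => by rw [HahnSeries.coeff_smul, hξ i hi, smul_zero]

theorem LowBdd.pow {N : ℤ} {ξ : Loop n} (hξ : LowBdd N ξ) (m : ℕ) : LowBdd (m * N) (ξ ^ m) := by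
  induction m with
  | zero =>
    intro i hi
    rw [pow_zero, HahnSeries.coeff_one, if_neg (by simp at hi; omega)]
  | succ m ih =>
    rw [pow_succ]
    exact (ih.mul hξ).mono (by push_cast; linarith)

/-- The coefficientwise adjoint of a series. -/
noncomputable def loopAdj (ξ : Loop n) : Loop n := ξ.map (adjL n ℝ)

@[simp] theorem coeff_loopAdj (ξ : Loop n) (k : ℤ) : (loopAdj ξ).coeff k = adj (ξ.coeff k) := rfl

theorem loopAdj_mul (ξ η : Loop n) : loopAdj (ξ * η) = loopAdj η * loopAdj ξ := by
  obtain ⟨N, hN⟩ := exists_lowBdd ξ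
  obtain ⟨N', hN'⟩ := exists_lowBdd η
  have h1 : LowBdd N (loopAdj ξ) := fun i hi => by rw [coeff_loopAdj, hN i hi, adj_zero]
  have h2 : LowBdd N' (loopAdj η) := fun i hi => by rw [coeff_loopAdj, hN' i hi, adj_zero]
  ext1
  funext k
  rw [coeff_loopAdj, coeff_mul_eq_sum hN hN', coeff_mul_eq_sum h2 h1, ← adjL_apply, map_sum]
  refine Finset.sum_nbij' (fun i => k - i) (fun i => k - i) ?_ ?_ ?_ ?_ ?_
  · intro i hi
    rw [Finset.mem_Icc] at hi ⊢
    omega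
  · intro i hi
    rw [Finset.mem_Icc] at hi ⊢
    omega
  · intro i _
    ring
  · intro i _
    ring
  · intro i _
    simp [adj_mul]

theorem loopAdj_pow_odd {ξ : Loop n} (h : loopAdj ξ = -ξ) {m : ℕ} (hm : Odd m) :
    loopAdj (ξ ^ m) = -ξ ^ m := by
  have : ∀ m : ℕ, loopAdj (ξ ^ (m + 1)) = (-ξ) ^ (m + 1) := by
    intro m
    induction m with
    | zero => simpa using h
    | succ m ih => rw [pow_succ, loopAdj_mul, ih, h, pow_succ' (-ξ) (m + 1)]
  obtain ⟨k, rfl⟩ := hm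
  rw [this]
  exact Odd.neg_pow ⟨k, rfl⟩ ξ

end Loops

section LoopCalculus

variable {n : ℕ}

/-- `ξ'` is the derivative at `s` of the series-valued function `ξ`, coefficient by coefficient,
where the degrees of `ξ` in `λ` are bounded near `s`. -/
def HasLoopDeriv (ξ : ℝ → Loop n) (ξ' : Loop n) (s : ℝ) : Prop :=
  (∃ N, ∀ᶠ u in nhds s, LowBdd N (ξ u)) ∧
    ∀ k, HasMatDeriv (fun u => (ξ u).coeff k) (ξ'.coeff k) s

namespace HasLoopDeriv

variable {ξ η : ℝ → Loop n} {ξ' η' : Loop n} {s : ℝ}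

theorem unique (h : HasLoopDeriv ξ ξ' s) (h' : HasLoopDeriv ξ η' s) : ξ' = η' := by
  ext1
  funext k
  exact (h.2 k).unique (h'.2 k)

theorem const (c : Loop n) : HasLoopDeriv (fun _ => c) 0 s := by
  obtain ⟨N, hN⟩ := exists_lowBdd c
  exact ⟨⟨N, .of_forall fun _ => hN⟩, fun k => HasMatDeriv.const _⟩

theorem congr_of_eventuallyEq (h : HasLoopDeriv ξ ξ' s) (e : ∀ᶠ u in nhds s, η u = ξ u) :
    HasLoopDeriv η ξ' s := by
  obtain ⟨⟨N, hN⟩, h⟩ := h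
  refine ⟨⟨N, ?_⟩, fun k => (h k).congr_of_eventuallyEq (e.mono fun u hu => by rw [hu])⟩
  filter_upwards [hN, e] with u hu hu'
  rwa [hu']

theorem mul (hξ : HasLoopDeriv ξ ξ' s) (hη : HasLoopDeriv η η' s) :
    HasLoopDeriv (fun u => ξ u * η u) (ξ' * η s + ξ s * η') s := by
  obtain ⟨⟨N₁, hN₁⟩, hξ⟩ := hξ
  obtain ⟨⟨N₂, hN₂⟩, hη⟩ := hη
  obtain ⟨N₃, hN₃⟩ := exists_lowBdd ξ'
  obtain ⟨N₄, hN₄⟩ := exists_lowBdd η'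
  refine ⟨⟨N₁ + N₂, ?_⟩, fun k => ?_⟩
  · filter_upwards [hN₁, hN₂] with u h1 h2
    exact h1.mul h2
  have hN₁' : ∀ᶠ u in nhds s, LowBdd (min N₁ N₃) (ξ u) :=
    hN₁.mono fun u hu => hu.mono (min_le_left _ _)
  have hN₂' : ∀ᶠ u in nhds s, LowBdd (min N₂ N₄) (η u) :=
    hN₂.mono fun u hu => hu.mono (min_le_left _ _)
  rw [HahnSeries.coeff_add, coeff_mul_eq_sum (hN₃.mono (min_le_right N₁ N₃)) hN₂'.self_of_nhds,
    coeff_mul_eq_sum hN₁'.self_of_nhds (hN₄.mono (min_le_right N₂ N₄)), ← Finset.sum_add_distrib]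
  refine (HasMatDeriv.sum fun i _ => (hξ i).mul (hη (k - i))).congr_of_eventuallyEq ?_
  filter_upwards [hN₁', hN₂'] with u h1 h2
  exact coeff_mul_eq_sum h1 h2 k

end HasLoopDeriv

/-- A family of series with smooth coefficients and bounded degrees in `λ`. -/
def SmoothLoop (U : Set (ℝ × ℝ)) (ξ : ℝ × ℝ → Loop n) : Prop :=
  (∃ N, ∀ p ∈ U, LowBdd N (ξ p)) ∧ ∀ k, SmoothMat U fun p => (ξ p).coeff k

namespace SmoothLoop

variable {U : Set (ℝ × ℝ)} {ξ η : ℝ × ℝ → Loop n}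

theorem mul (hξ : SmoothLoop U ξ) (hη : SmoothLoop U η) : SmoothLoop U fun p => ξ p * η p := by
  obtain ⟨⟨N, hN⟩, hξ⟩ := hξ
  obtain ⟨⟨N', hN'⟩, hη⟩ := hη
  refine ⟨⟨N + N', fun p hp => (hN p hp).mul (hN' p hp)⟩, fun k => ?_⟩
  exact (SmoothMat.sum fun i (_ : i ∈ Finset.Icc N (k - N')) => (hξ i).mul (hη (k - i))).congr
    fun p hp => coeff_mul_eq_sum (hN p hp) (hN' p hp) k

theorem pow (hξ : SmoothLoop U ξ) (m : ℕ) : SmoothLoop U fun p => ξ p ^ m := by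
  induction m with
  | zero =>
    obtain ⟨N, hN⟩ := exists_lowBdd (1 : Loop n)
    simp only [pow_zero]
    exact ⟨⟨N, fun p _ => hN⟩, fun k => smoothMat_const _⟩
  | succ m ih =>
    simp only [pow_succ]
    exact ih.mul hξ

theorem hasLoopDerivX (hU : IsOpen U) (hξ : SmoothLoop U ξ) {p : ℝ × ℝ} (hp : p ∈ U) {D : Loop n}
    (hD : ∀ k, D.coeff k = partialX (fun r => (ξ r).coeff k) p) :
    HasLoopDeriv (fun s => ξ (s, p.2)) D p.1 := by
  obtain ⟨⟨N, hN⟩, hξ⟩ := hξ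
  refine ⟨⟨N, ?_⟩, fun k => hD k ▸ (hξ k).hasMatDerivX hU hp⟩
  have hc : ContinuousAt (fun s : ℝ => (s, p.2)) p.1 := by fun_prop
  exact (hc.eventually (hU.mem_nhds hp)).mono fun s hs => hN _ hs

end SmoothLoop

end LoopCalculus

/-! ### Expansion at infinity and evaluation of polynomials -/

section Homs

open Polynomial

variable {n : ℕ}

instance : IsScalarTower ℝ (Loop n) (Loop n) := ⟨fun a ξ η => Algebra.smul_mul_assoc a ξ η⟩

instance : SMulCommClass ℝ (Loop n) (Loop n) := ⟨fun a ξ η => (Algebra.mul_smul_comm a ξ η).symm⟩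

/-- The expansion of a polynomial in `λ` as a series in `λ⁻¹`. -/
noncomputable def loopHom (n : ℕ) : (Mat n ℝ)[X] →ₐ[ℝ] Loop n :=
  eval₂AlgHom { (HahnSeries.C : Mat n ℝ →+* Loop n) with commutes' := fun _ => rfl } (lmono 1 1)
    fun A => by
      change HahnSeries.single 0 A * HahnSeries.single (-1) 1 =
        HahnSeries.single (-1) 1 * HahnSeries.single 0 A
      rw [HahnSeries.single_mul_single, HahnSeries.single_mul_single]
      simp

theorem loopHom_C (A : Mat n ℝ) : loopHom n (C A) = HahnSeries.single 0 A := eval₂_C _ _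

theorem loopHom_X : loopHom n X = HahnSeries.single (-1) 1 := eval₂_X _ _

theorem loopHom_monomial (m : ℕ) (A : Mat n ℝ) :
    loopHom n (monomial m A) = HahnSeries.single (-(m : ℤ)) A := by
  rw [← C_mul_X_pow_eq_monomial, map_mul, map_pow, loopHom_C, loopHom_X, HahnSeries.single_pow,
    HahnSeries.single_mul_single]
  simp

theorem coeff_loopHom (A : (Mat n ℝ)[X]) (k : ℤ) :
    (loopHom n A).coeff k = if k ≤ 0 then A.coeff (-k).toNat else 0 := by
  induction A using Polynomial.induction_on' with
  | add A B hA hB =>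
    rw [map_add, HahnSeries.coeff_add, hA, hB]
    split_ifs <;> simp
  | monomial m c =>
    rw [loopHom_monomial, HahnSeries.coeff_single, coeff_monomial]
    split_ifs <;> first | rfl | omega

/-- The expansion `∑_{k ≥ 1} α^(k-1) λ^(-k)` of `1 / (λ - α)` at infinity. -/
noncomputable def res (n : ℕ) (α : ℝ) : Loop n :=
  HahnSeries.ofSuppBddBelow
    (fun k : ℤ => if 1 ≤ k then α ^ (k - 1).toNat • (1 : Mat n ℝ) else 0)
    ⟨1, fun k hk => by
      by_contra h
      exact hk (if_neg h)⟩

theorem coeff_res (α : ℝ) (k : ℤ) :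
    (res n α).coeff k = if 1 ≤ k then α ^ (k - 1).toNat • (1 : Mat n ℝ) else 0 := rfl

theorem loopHom_lin (α : ℝ) :
    loopHom n (lin (Mat n ℝ) α) = HahnSeries.single (-1) 1 - α • 1 := by
  rw [lin, map_sub, loopHom_X, ← Polynomial.algebraMap_apply, AlgHom.commutes,
    Algebra.algebraMap_eq_smul_one]

theorem res_mul_lin (α : ℝ) : res n α * loopHom n (lin (Mat n ℝ) α) = 1 := by
  ext1
  funext k
  rw [loopHom_lin, mul_sub, HahnSeries.coeff_sub, HahnSeries.coeff_mul_single, mul_smul_comm,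
    mul_one, HahnSeries.coeff_smul, mul_one, coeff_res, coeff_res, HahnSeries.coeff_one]
  rcases lt_trichotomy k 0 with h | h | h
  · rw [if_neg (by omega), if_neg (by omega), if_neg (by omega)]; simp
  · subst h; simp
  · rw [if_pos (by omega), if_pos (by omega), if_neg (by omega)]
    have : (k - -1 - 1).toNat = (k - 1).toNat + 1 := by omega
    rw [this, pow_succ', mul_smul, sub_self]

theorem res_mul_comm (α : ℝ) (ξ : Loop n) : res n α * ξ = ξ * res n α := by
  set l := loopHom n (lin (Mat n ℝ) α) with hl
  have hc : ∀ η : Loop n, l * η = η * l := by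
    intro η
    rw [hl, loopHom_lin, sub_mul, mul_sub, smul_mul_assoc, mul_smul_comm, one_mul, mul_one]
    congr 1
    ext1
    funext k
    rw [HahnSeries.coeff_mul_single, HahnSeries.coeff_single_mul, one_mul, mul_one]
  have h : res n α * l = 1 := res_mul_lin α
  calc res n α * ξ = res n α * ξ * (l * res n α) := by rw [hc, h, mul_one]
    _ = res n α * l * ξ * res n α := by
        rw [← mul_assoc, mul_assoc (res n α) ξ, ← hc, mul_assoc (res n α) l]
    _ = ξ * res n α := by rw [h, one_mul]

theorem lowBdd_res_mul_C (α : ℝ) (A : Mat n ℝ) : LowBdd 1 (res n α * loopHom n (C A)) := by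
  intro k hk
  rw [loopHom_C, HahnSeries.coeff_mul_single_zero, coeff_res, if_neg (by omega), zero_mul]

theorem SmoothLoop.res_mul_C {U : Set (ℝ × ℝ)} (α : ℝ) {A : ℝ × ℝ → Mat n ℝ}
    (hA : SmoothMat U A) (k : ℤ) : SmoothMat U fun p => (res n α * loopHom n (C (A p))).coeff k := by
  simp only [loopHom_C, HahnSeries.coeff_mul_single_zero]
  exact (smoothMat_const _).mul hA

/-- The expansion at infinity of the rational loop `1 + a / (λ - α₂) P - a / (λ - α₁) S`. -/
noncomputable abbrev loopDress (α₁ α₂ : ℝ) (P S : Mat n ℝ) : Loop n :=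
  dress (loopHom n) (res n α₁) (res n α₂) (α₂ - α₁) P S

theorem loopDress_sub_one (α₁ α₂ : ℝ) (P S : Mat n ℝ) : LowBdd 1 (loopDress α₁ α₂ P S - 1) := by
  have : loopDress α₁ α₂ P S - 1 = (α₂ - α₁) • (res n α₂ * loopHom n (C P)) -
      (α₂ - α₁) • (res n α₁ * loopHom n (C S)) := by
    rw [loopDress, dress]; abel
  rw [this]
  exact ((lowBdd_res_mul_C _ _).smul _).sub ((lowBdd_res_mul_C _ _).smul _)

theorem lowBdd_one : LowBdd 0 (1 : Loop n) := fun k hk => by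
  rw [HahnSeries.coeff_one, if_neg (by omega)]

theorem lowBdd_loopDress (α₁ α₂ : ℝ) (P S : Mat n ℝ) : LowBdd 0 (loopDress α₁ α₂ P S) := by
  have h := ((loopDress_sub_one α₁ α₂ P S).mono (by norm_num)).add lowBdd_one
  rwa [sub_add_cancel] at h

theorem smoothLoop_loopDress {U : Set (ℝ × ℝ)} (α₁ α₂ : ℝ) {P S : ℝ × ℝ → Mat n ℝ}
    (hP : SmoothMat U P) (hS : SmoothMat U S) :
    SmoothLoop U fun p => loopDress α₁ α₂ (P p) (S p) := by
  refine ⟨⟨0, fun p _ => lowBdd_loopDress _ _ _ _⟩, fun k => ?_⟩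
  simp only [dress, HahnSeries.coeff_add, HahnSeries.coeff_sub, HahnSeries.coeff_smul]
  exact ((smoothMat_const _).add ((SmoothLoop.res_mul_C _ hP k).const_smul _)).sub
    ((SmoothLoop.res_mul_C _ hS k).const_smul _)

theorem hasLoopDeriv_loopDress (α₁ α₂ : ℝ) {P S : ℝ → Mat n ℝ} {P' S' : Mat n ℝ} {s : ℝ}
    (hP : HasMatDeriv P P' s) (hS : HasMatDeriv S S' s) :
    HasLoopDeriv (fun u => loopDress α₁ α₂ (P u) (S u))
      ((α₂ - α₁) • (res n α₂ * loopHom n (C P')) - (α₂ - α₁) • (res n α₁ * loopHom n (C S'))) s := by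
  refine ⟨⟨0, .of_forall fun _ => lowBdd_loopDress _ _ _ _⟩, fun k => ?_⟩
  simp only [dress, HahnSeries.coeff_add, HahnSeries.coeff_sub, HahnSeries.coeff_smul, loopHom_C,
    HahnSeries.coeff_mul_single_zero]
  have h := ((HasMatDeriv.const ((1 : Loop n).coeff k)).add
    ((hP.const_mul ((res n α₂).coeff k)).const_smul (α₂ - α₁))).sub
    ((hS.const_mul ((res n α₁).coeff k)).const_smul (α₂ - α₁))
  rwa [zero_add] at h

/-- A real matrix viewed as a complex one, as an algebra homomorphism. -/
noncomputable def toCHom (n : ℕ) : Mat n ℝ →ₐ[ℝ] Mat n ℂ := Complex.ofRealAm.mapMatrix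

/-- The value of a polynomial with real matrix coefficients at a complex number. -/
noncomputable def polyEval (n : ℕ) (l : ℂ) : (Mat n ℝ)[X] →ₐ[ℝ] Mat n ℂ :=
  eval₂AlgHom (toCHom n) (algebraMap ℂ _ l) fun A => (Algebra.commutes l (toCHom n A)).symm

theorem polyEval_C (l : ℂ) (A : Mat n ℝ) : polyEval n l (C A) = toC A := eval₂_C _ _

theorem polyEval_monomial (l : ℂ) (m : ℕ) (A : Mat n ℝ) :
    polyEval n l (monomial m A) = l ^ m • toC A := by
  rw [← C_mul_X_pow_eq_monomial, map_mul, map_pow, polyEval_C,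
    show polyEval n l X = algebraMap ℂ _ l from eval₂_X _ _, ← map_pow, ← Algebra.commutes,
    Algebra.smul_def]

theorem polyEval_lin (l : ℂ) (α : ℝ) :
    polyEval n l (lin (Mat n ℝ) α) = (l - α) • 1 := by
  rw [lin, map_sub, show polyEval n l X = algebraMap ℂ _ l from eval₂_X _ _,
    ← Polynomial.algebraMap_apply, AlgHom.commutes, Algebra.algebraMap_eq_smul_one,
    Algebra.algebraMap_eq_smul_one, sub_smul]
  congr 1

theorem polyEval_ofReal (α : ℝ) (A : (Mat n ℝ)[X]) : polyEval n α A = toC (evalR α A) := by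
  obtain ⟨-, A', h, -⟩ := exists_eq_add_lin_mul ⊤ α A fun _ => trivial
  nth_rewrite 1 [h]
  rw [map_add, map_mul, polyEval_lin, sub_self, zero_smul, zero_mul, add_zero, polyEval_C]

theorem gLoop_eq_dress (α₁ α₂ : ℝ) (P : Mat n ℝ) (l : ℂ) :
    gLoop α₁ α₂ P l =
      dress (polyEval n l) ((l - α₁)⁻¹ • 1) ((l - α₂)⁻¹ • 1) (α₂ - α₁) P (sharp P) := by
  rw [gLoop, dress, polyEval_C, polyEval_C, smul_mul_assoc, one_mul, smul_mul_assoc, one_mul]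
  have h : ∀ (c : ℂ) (A : Mat n ℂ), (α₂ - α₁) • c • A = ((α₂ - α₁ : ℂ) * c) • A := by
    intro c A
    ext i k
    simp [mul_assoc]
  rw [h, h, ← div_eq_mul_inv, ← div_eq_mul_inv, sub_eq_add_neg (1 + _), ← neg_smul, ← neg_div,
    neg_sub]

end Homs

/-! ### Transport of a projection by two orthogonal matrices -/

section Transport

variable {n : ℕ} {K : Type*} [Field K]

/-- `Q` is the projection onto `R₁⁻¹ (im P)` along `R₂⁻¹ (ker P)`, where `R₁` and `R₂` are
orthogonal with respect to the form. -/
structure IsTransported (P Q R₁ R₂ : Mat n K) : Prop where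
  orth₁ : adj R₁ * R₁ = 1
  orth₂ : adj R₂ * R₂ = 1
  idem : P * P = P
  idem' : Q * Q = Q
  range_le : (1 - P) * R₁ * Q = 0
  le_range : (1 - Q) * adj R₁ * P = 0
  ker_le : P * R₂ * (1 - Q) = 0
  le_ker : Q * adj R₂ * (1 - P) = 0

namespace IsTransported

variable {P Q R₁ R₂ : Mat n K}

theorem orth₁' (h : IsTransported P Q R₁ R₂) : R₁ * adj R₁ = 1 := mul_eq_one_comm.1 h.orth₁

theorem orth₂' (h : IsTransported P Q R₁ R₂) : R₂ * adj R₂ = 1 := mul_eq_one_comm.1 h.orth₂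

theorem range_eq (h : IsTransported P Q R₁ R₂) : P * R₁ * Q = R₁ * Q := by
  have := h.range_le
  rw [sub_mul, sub_mul, one_mul, sub_eq_zero] at this
  exact this.symm

theorem ker_eq (h : IsTransported P Q R₁ R₂) : Q * adj R₂ * P = Q * adj R₂ := by
  have := h.le_ker
  rw [mul_sub, mul_one, sub_eq_zero] at this
  exact this.symm

theorem adj_range (h : IsTransported P Q R₁ R₂) : adj P * R₁ * (1 - adj Q) = 0 := by
  have := congrArg adj h.le_range
  rwa [adj_mul, adj_mul, adj_adj, adj_sub, adj_one, adj_zero, ← mul_assoc] at this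

theorem adj_ker (h : IsTransported P Q R₁ R₂) : (1 - adj P) * R₂ * adj Q = 0 := by
  have := congrArg adj h.le_ker
  rwa [adj_mul, adj_mul, adj_adj, adj_sub, adj_one, adj_zero, ← mul_assoc] at this

/-- The image of `Q` is isotropic, since that of `P` is. -/
theorem adj_mul_eq_zero (h : IsTransported P Q R₁ R₂) (h0 : adj P * P = 0) : adj Q * Q = 0 := by
  have e : Q = adj R₁ * (P * R₁ * Q) := by
    rw [h.range_eq, ← mul_assoc, h.orth₁, one_mul]
  have e' : adj Q = adj (P * R₁ * Q) * R₁ := by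
    nth_rewrite 1 [e]
    rw [adj_mul, adj_adj]
  calc adj Q * Q = adj (P * R₁ * Q) * R₁ * (adj R₁ * (P * R₁ * Q)) := by rw [← e', ← e]
    _ = adj (R₁ * Q) * (adj P * P) * (R₁ * Q) := by
        rw [mul_assoc, ← mul_assoc R₁ (adj R₁), h.orth₁', one_mul, mul_assoc P, adj_mul P]
        simp only [mul_assoc]
    _ = 0 := by rw [h0, mul_zero, zero_mul]

/-- The kernel of `Q` is coisotropic, since that of `P` is. -/
theorem mul_adj_eq_zero (h : IsTransported P Q R₁ R₂) (h0 : P * adj P = 0) : Q * adj Q = 0 := by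
  have e : Q = Q * adj R₂ * P * R₂ := by
    rw [h.ker_eq, mul_assoc, h.orth₂, mul_one]
  have e' : adj Q = adj R₂ * adj (Q * adj R₂ * P) := by
    nth_rewrite 1 [e]
    rw [adj_mul]
  calc Q * adj Q = Q * adj R₂ * P * R₂ * (adj R₂ * adj (Q * adj R₂ * P)) := by rw [← e', ← e]
    _ = Q * adj R₂ * (P * adj P) * adj (Q * adj R₂) := by
        rw [mul_assoc, ← mul_assoc R₂ (adj R₂), h.orth₂', one_mul, adj_mul]
        simp only [mul_assoc]
    _ = 0 := by rw [h0, mul_zero, zero_mul]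

/-- For a rank-one `P = v wᵀ`, the transported projection is a multiple of `R₁⁻¹ P R₂`. -/
theorem eq_smul (h : IsTransported P Q R₁ R₂) {v w : Fin (2 * n + 1) → K}
    (hP : P = Matrix.vecMulVec v w) (hQ : Q ≠ 0) :
    (P * R₂ * adj R₁).trace ≠ 0 ∧
      Q = (P * R₂ * adj R₁).trace⁻¹ • (adj R₁ * P * R₂) := by
  have rk : ∀ X : Mat n K, P * X * P = (P * X).trace • P := by
    intro X
    rw [hP, Matrix.vecMulVec_mul, Matrix.vecMulVec_mul_vecMulVec, Matrix.trace_vecMulVec]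
    ext i k
    simp [Matrix.vecMulVec_apply, dotProduct_comm]
    ring
  have e1 : R₁ * Q * adj R₂ = P * (R₁ * Q * adj R₂) * P := by
    rw [← mul_assoc, ← mul_assoc, h.range_eq, mul_assoc, mul_assoc, h.ker_eq]
  rw [rk] at e1
  set κ := (P * (R₁ * Q * adj R₂)).trace
  have e2 : Q = κ • (adj R₁ * P * R₂) := by
    have := congrArg (fun Y => adj R₁ * Y * R₂) e1
    simp only [mul_smul_comm, smul_mul_assoc] at this
    rw [← this, mul_assoc R₁ Q, ← mul_assoc (adj R₁), h.orth₁, one_mul, mul_assoc, h.orth₂,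
      mul_one]
  set N := adj R₁ * P * R₂
  set c := (P * R₂ * adj R₁).trace with hc
  have e3 : N * N = c • N := by
    calc N * N = adj R₁ * (P * (R₂ * adj R₁) * P) * R₂ := by simp only [N, mul_assoc]
      _ = c • N := by rw [rk, hc, mul_assoc P, mul_smul_comm, smul_mul_assoc]
  have e4 : (κ * c) • Q = Q := by
    have := h.idem'
    rw [e2, smul_mul_smul_comm, e3] at this
    calc (κ * c) • Q = (κ * κ) • c • N := by
          rw [e2]
          simp only [smul_smul]
          congr 1
          ring
      _ = Q := by rw [this, ← e2]
  have e5 : κ * c = 1 := by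
    by_contra hne
    have : (κ * c - 1) • Q = 0 := by rw [sub_smul, e4, one_smul, sub_self]
    exact hQ ((smul_eq_zero.1 this).resolve_left (sub_ne_zero.2 hne))
  have hc0 : c ≠ 0 := right_ne_zero_of_mul_eq_one e5
  exact ⟨hc0, by rw [← eq_inv_of_mul_eq_one_left e5, ← e2]⟩

end IsTransported

/-- The transported projection follows the equation `Q' = Q A₂ (1 - Q) - (1 - Q) A₁ Q` when the
matrices `R₁` and `R₂` follow `Rᵢ' = Rᵢ Aᵢ`. -/
theorem hasMatDeriv_transported {P : Mat n ℝ} {Q R₁ R₂ : ℝ → Mat n ℝ} {A₁ A₂ Q' : Mat n ℝ} {s : ℝ}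
    (h : ∀ᶠ u in nhds s, IsTransported P (Q u) (R₁ u) (R₂ u))
    (h1 : HasMatDeriv R₁ (R₁ s * A₁) s) (h2 : HasMatDeriv R₂ (R₂ s * A₂) s)
    (hQ : HasMatDeriv Q Q' s) :
    Q' = Q s * A₂ * (1 - Q s) - (1 - Q s) * A₁ * Q s := by
  have hs := h.self_of_nhds
  have d1 : (1 - P) * (R₁ s * A₁) * Q s + (1 - P) * R₁ s * Q' = 0 := by
    have := ((h1.const_mul (1 - P)).mul hQ).unique
      ((HasMatDeriv.const 0).congr_of_eventuallyEq (h.mono fun u hu => hu.range_le))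
    exact this
  have d2 : P * (R₂ s * A₂) * (1 - Q s) + P * R₂ s * (0 - Q') = 0 := by
    have := ((h2.const_mul P).mul ((HasMatDeriv.const 1).sub hQ)).unique
      ((HasMatDeriv.const 0).congr_of_eventuallyEq (h.mono fun u hu => hu.ker_le))
    exact this
  set q := Q s
  have z1 : (1 - q) * adj (R₁ s) * ((1 - P) * R₁ s) = 1 - q := by
    rw [← mul_assoc, mul_assoc (1 - q), mul_sub, mul_one, mul_sub, ← mul_assoc (1 - q),
      hs.le_range, sub_zero, mul_assoc, hs.orth₁, mul_one]
  have z2 : q * adj (R₂ s) * (P * R₂ s) = q := by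
    rw [← mul_assoc, hs.ker_eq, mul_assoc, hs.orth₂, mul_one]
  have k1 : (1 - q) * A₁ * q + (1 - q) * Q' = 0 := by
    have := congrArg (fun Y => (1 - q) * adj (R₁ s) * Y) d1
    simp only [mul_add, mul_zero] at this
    rw [← mul_assoc _ ((1 - P) * R₁ s), z1, ← mul_assoc (1 - P), ← mul_assoc,
      ← mul_assoc ((1 - q) * adj (R₁ s)), z1] at this
    exact this
  have k2 : q * A₂ * (1 - q) + q * (0 - Q') = 0 := by
    have := congrArg (fun Y => q * adj (R₂ s) * Y) d2
    simp only [mul_add, mul_zero] at this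
    rw [← mul_assoc _ (P * R₂ s), z2, ← mul_assoc P, ← mul_assoc,
      ← mul_assoc (q * adj (R₂ s)), z2] at this
    exact this
  have k3 : Q' = q * A₂ * (1 - q) - (1 - q) * A₁ * q +
      (((1 - q) * A₁ * q + (1 - q) * Q') - (q * A₂ * (1 - q) + q * (0 - Q'))) := by
    simp only [sub_mul, mul_sub, one_mul, mul_one, zero_sub, mul_neg]
    abel
  rwa [k1, k2, sub_zero, add_zero] at k3

end Transport

/-! ### Dressing entire matrix functions -/

section Entire

variable {n : ℕ}

theorem eq_of_eq_off_finite {X : Type*} [TopologicalSpace X] [T2Space X] {f g : ℂ → X}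
    (hf : Continuous f) (hg : Continuous g) {s : Set ℂ} (hs : s.Finite)
    (h : ∀ l ∉ s, f l = g l) : f = g :=
  hf.ext_on (hs.countable.dense_compl ℝ) hg fun l hl => h l hl

/-- The difference quotient `(f(l) - f(α)) / (l - α)`, with the value `f'(α)` at `l = α`. -/
noncomputable def diffQuot (f : ℂ → Mat n ℂ) (α l : ℂ) : Mat n ℂ :=
  Matrix.of fun i k => dslope (fun z => f z i k) α l

theorem smul_diffQuot (f : ℂ → Mat n ℂ) (α l : ℂ) :
    (l - α) • diffQuot f α l = f l - f α := by
  ext i k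
  exact sub_smul_dslope (fun z => f z i k) α l

theorem differentiable_diffQuot {f : ℂ → Mat n ℂ} (hf : ∀ i k, Differentiable ℂ fun l => f l i k)
    (α : ℂ) (i k) : Differentiable ℂ fun l => diffQuot f α l i k := by
  have h := (Complex.differentiableOn_dslope (f := fun z => f z i k) (c := α)
    (s := Set.univ) Filter.univ_mem).2 (hf i k).differentiableOn
  exact differentiableOn_univ.1 h

theorem continuous_of_entries {f : ℂ → Mat n ℂ} (hf : ∀ i k, Differentiable ℂ fun l => f l i k) :
    Continuous f :=
  continuous_matrix fun i k => (hf i k).continuous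

theorem continuous_adj : Continuous (adj : Mat n ℂ → Mat n ℂ) :=
  (continuous_const.matrix_mul continuous_id.matrix_transpose).matrix_mul continuous_const

theorem differentiable_mul {f g : ℂ → Mat n ℂ} (hf : ∀ i k, Differentiable ℂ fun l => f l i k)
    (hg : ∀ i k, Differentiable ℂ fun l => g l i k) (i k) :
    Differentiable ℂ fun l => (f l * g l) i k := by
  simp only [Matrix.mul_apply]
  exact Differentiable.fun_sum fun m _ => (hf i m).mul (hg m k)

/-- The logarithmic derivative `f'(α) f(α)⁻¹` of an orthogonal matrix function is skew-adjoint. -/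
theorem adj_diffQuot_mul_adj {f : ℂ → Mat n ℂ} (hf : ∀ i k, Differentiable ℂ fun l => f l i k)
    (horth : ∀ l, adj (f l) * f l = 1) (α : ℂ) :
    adj (diffQuot f α α * adj (f α)) = -(diffQuot f α α * adj (f α)) := by
  have h : (fun l => diffQuot f α l * adj (f l) + f α * adj (diffQuot f α l)) = fun _ => 0 := by
    have hc := continuous_of_entries (differentiable_diffQuot hf α)
    refine eq_of_eq_off_finite ((hc.matrix_mul (continuous_adj.comp (continuous_of_entries hf))).add
      (continuous_const.matrix_mul (continuous_adj.comp hc))) continuous_const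
      (Set.finite_singleton α) fun l hl => ?_
    have h0 : (l - α) • (diffQuot f α l * adj (f l) + f α * adj (diffQuot f α l)) = 0 := by
      rw [smul_add, ← smul_mul_assoc, ← mul_smul_comm, ← adj_smul, smul_diffQuot, adj_sub, sub_mul,
        mul_sub, mul_eq_one_comm.1 (horth l), mul_eq_one_comm.1 (horth α)]
      abel
    exact (smul_eq_zero.1 h0).resolve_left (sub_ne_zero.2 hl)
  have h1 := congrFun h α
  rw [adj_mul, adj_adj]
  exact eq_neg_of_add_eq_zero_right h1

/-- The entire function equal to `(1 + a / (l - α₂) P) f(l) (1 - a / (l - α₁) Q)` for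
`l ≠ α₁, α₂`, where `a = α₂ - α₁`, provided that the residues of this product vanish. -/
noncomputable def entireDarboux (α₁ α₂ : ℂ) (P Q : Mat n ℂ) (f : ℂ → Mat n ℂ) (l : ℂ) : Mat n ℂ :=
  f l + (α₂ - α₁) • (P * diffQuot f α₂ l * (1 - Q)) -
    (α₂ - α₁) • ((1 - P) * diffQuot f α₁ l * Q)

theorem differentiable_entireDarboux {f : ℂ → Mat n ℂ}
    (hf : ∀ i k, Differentiable ℂ fun l => f l i k) (α₁ α₂ : ℂ) (P Q : Mat n ℂ) (i k) :
    Differentiable ℂ fun l => entireDarboux α₁ α₂ P Q f l i k := by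
  have hc : ∀ A : Mat n ℂ, ∀ i k, Differentiable ℂ fun _ : ℂ => A i k :=
    fun A i k => differentiable_const _
  exact ((hf i k).add ((differentiable_mul (differentiable_mul (hc P)
    (differentiable_diffQuot hf α₂)) (hc _) i k).const_smul (α₂ - α₁))).sub
    ((differentiable_mul (differentiable_mul (hc _)
    (differentiable_diffQuot hf α₁)) (hc Q) i k).const_smul (α₂ - α₁))

theorem entireDarboux_eq {α₁ α₂ : ℂ} {P Q : Mat n ℂ} {f : ℂ → Mat n ℂ}
    (h1 : (1 - P) * f α₁ * Q = 0) (h2 : P * f α₂ * (1 - Q) = 0) {l : ℂ} (hl1 : l ≠ α₁)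
    (hl2 : l ≠ α₂) :
    entireDarboux α₁ α₂ P Q f l =
      (1 + ((α₂ - α₁) * (l - α₂)⁻¹) • P) * f l * (1 - ((α₂ - α₁) * (l - α₁)⁻¹) • Q) := by
  have hl1' : l - α₁ ≠ 0 := sub_ne_zero.2 hl1
  have hl2' : l - α₂ ≠ 0 := sub_ne_zero.2 hl2
  have dq : ∀ α : ℂ, l - α ≠ 0 → diffQuot f α l = (l - α)⁻¹ • (f l - f α) := fun α hα => by
    rw [← smul_diffQuot, smul_smul, inv_mul_cancel₀ hα, one_smul]
  rw [entireDarboux, dq _ hl1', dq _ hl2', mul_smul_comm, mul_smul_comm, smul_mul_assoc,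
    smul_mul_assoc, mul_sub P, mul_sub (1 - P), sub_mul (P * f l), sub_mul ((1 - P) * f l), h1, h2,
    sub_zero, sub_zero, smul_smul, smul_smul]
  have hr : (α₂ - α₁) * (l - α₂)⁻¹ * ((α₂ - α₁) * (l - α₁)⁻¹) =
      (α₂ - α₁) * (l - α₂)⁻¹ - (α₂ - α₁) * (l - α₁)⁻¹ := by
    field_simp
    ring
  set c1 := (α₂ - α₁) * (l - α₁)⁻¹
  set c2 := (α₂ - α₁) * (l - α₂)⁻¹
  simp only [mul_sub, sub_mul, add_mul, one_mul, mul_one, smul_mul_assoc, mul_smul_comm]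
  rw [← sub_eq_zero]
  trans (c2 * c1 - (c2 - c1)) • (P * f l * Q)
  · module
  · rw [hr, sub_self, zero_smul]

section TwoSteps

variable {f : ℂ → Mat n ℂ} {α₁ α₂ : ℂ} {P Q : Mat n ℂ} {v w : Fin (2 * n + 1) → ℂ}

theorem mul_diffQuot_mul_adj (hf : ∀ i k, Differentiable ℂ fun l => f l i k)
    (horth : ∀ l, adj (f l) * f l = 1) (hP : P = Matrix.vecMulVec v w)
    (h : IsTransported P Q (f α₁) (f α₂)) : P * diffQuot f α₂ α₂ * adj Q = 0 := by
  have e2 : f α₂ * adj Q = adj P * (f α₂ * adj Q) := by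
    have := h.adj_ker
    rwa [sub_mul, sub_mul, one_mul, sub_eq_zero, mul_assoc] at this
  calc P * diffQuot f α₂ α₂ * adj Q
      = P * (diffQuot f α₂ α₂ * adj (f α₂)) * (f α₂ * adj Q) := by
        rw [← mul_assoc, ← mul_assoc, mul_assoc _ (adj (f α₂)), horth, mul_one]
    _ = P * (diffQuot f α₂ α₂ * adj (f α₂)) * adj P * (f α₂ * adj Q) := by
        rw [mul_assoc _ (adj P), ← e2]
    _ = 0 := by rw [mul_skew_mul_adj hP (adj_diffQuot_mul_adj hf horth α₂), zero_mul]

theorem adj_mul_diffQuot_mul (hf : ∀ i k, Differentiable ℂ fun l => f l i k)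
    (horth : ∀ l, adj (f l) * f l = 1) (hP : P = Matrix.vecMulVec v w)
    (h : IsTransported P Q (f α₁) (f α₂)) : adj P * diffQuot f α₁ α₁ * Q = 0 := by
  have e2 : f α₁ * Q = P * (f α₁ * Q) := by rw [← mul_assoc, h.range_eq]
  calc adj P * diffQuot f α₁ α₁ * Q
      = adj P * (diffQuot f α₁ α₁ * adj (f α₁)) * (f α₁ * Q) := by
        rw [← mul_assoc, ← mul_assoc, mul_assoc _ (adj (f α₁)), horth, mul_one]
    _ = adj P * (diffQuot f α₁ α₁ * adj (f α₁)) * P * (f α₁ * Q) := by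
        rw [mul_assoc _ P, ← e2]
    _ = 0 := by rw [adj_mul_skew_mul hP (adj_diffQuot_mul_adj hf horth α₁), zero_mul]

/-- After the first step, the residue of the second one at `α₂` vanishes. -/
theorem entireDarboux_mul_adj (hf : ∀ i k, Differentiable ℂ fun l => f l i k)
    (horth : ∀ l, adj (f l) * f l = 1) (hP : P = Matrix.vecMulVec v w)
    (hPS : P * adj P = 0) (h : IsTransported P Q (f α₁) (f α₂)) :
    (1 - adj P) * entireDarboux α₁ α₂ P Q f α₂ * adj Q = 0 := by
  have hQS : Q * adj Q = 0 := h.mul_adj_eq_zero hPS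
  have hQ1 : (1 - Q) * adj Q = adj Q := by rw [sub_mul, hQS, one_mul, sub_zero]
  have e1 : entireDarboux α₁ α₂ P Q f α₂ * adj Q =
      f α₂ * adj Q + (α₂ - α₁) • (P * diffQuot f α₂ α₂ * adj Q) := by
    rw [entireDarboux, sub_mul, add_mul, smul_mul_assoc, smul_mul_assoc, mul_assoc _ (1 - Q),
      hQ1, mul_assoc _ Q, hQS, mul_zero, smul_zero, sub_zero]
  rw [mul_assoc, e1, mul_diffQuot_mul_adj hf horth hP h, smul_zero, add_zero, ← mul_assoc,
    h.adj_ker]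

/-- After the first step, the residue of the second one at `α₁` vanishes. -/
theorem adj_mul_entireDarboux (hf : ∀ i k, Differentiable ℂ fun l => f l i k)
    (horth : ∀ l, adj (f l) * f l = 1) (hP : P = Matrix.vecMulVec v w) (hSP : adj P * P = 0)
    (h : IsTransported P Q (f α₁) (f α₂)) :
    adj P * entireDarboux α₁ α₂ P Q f α₁ * (1 - adj Q) = 0 := by
  have hP1 : adj P * (1 - P) = adj P := by rw [mul_sub, hSP, mul_one, sub_zero]
  have e1 : adj P * entireDarboux α₁ α₂ P Q f α₁ =
      adj P * f α₁ - (α₂ - α₁) • (adj P * diffQuot f α₁ α₁ * Q) := by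
    rw [entireDarboux, mul_sub, mul_add, mul_smul_comm, mul_smul_comm, ← mul_assoc, ← mul_assoc,
      hSP, zero_mul, zero_mul, smul_zero, add_zero, ← mul_assoc, ← mul_assoc, hP1]
  rw [e1, adj_mul_diffQuot_mul hf horth hP h, smul_zero, sub_zero, h.adj_range]

/-- If `P` is a projection of rank one with `P P* = P* P = 0`, and `Q` is transported from `P` by
`f(α₁)` and `f(α₂)`, then the dressed function has no poles. The second step is admissible because
the terms `P f'(α) f(α)⁻¹ P*` vanish. -/
theorem exists_entire_dressing (hf : ∀ i k, Differentiable ℂ fun l => f l i k)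
    (horth : ∀ l, adj (f l) * f l = 1) (hP : P = Matrix.vecMulVec v w) (hSP : adj P * P = 0)
    (hPS : P * adj P = 0) (h : IsTransported P Q (f α₁) (f α₂)) :
    ∃ g : ℂ → Mat n ℂ, (∀ i k, Differentiable ℂ fun l => g l i k) ∧
      ∀ l, l ≠ α₁ → l ≠ α₂ → g l =
        (1 + ((α₂ - α₁) * (l - α₂)⁻¹) • P - ((α₂ - α₁) * (l - α₁)⁻¹) • adj P) * f l *
          (1 - ((α₂ - α₁) * (l - α₁)⁻¹) • Q + ((α₂ - α₁) * (l - α₂)⁻¹) • adj Q) := by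
  refine ⟨entireDarboux α₂ α₁ (adj P) (adj Q) (entireDarboux α₁ α₂ P Q f),
    differentiable_entireDarboux (differentiable_entireDarboux hf _ _ _ _) _ _ _ _, ?_⟩
  intro l hl1 hl2
  have hQS : Q * adj Q = 0 := h.mul_adj_eq_zero hPS
  rw [entireDarboux_eq (entireDarboux_mul_adj hf horth hP hPS h)
    (adj_mul_entireDarboux hf horth hP hSP h) hl2 hl1,
    entireDarboux_eq h.range_le h.ker_le hl1 hl2]
  have hd : ∀ c : ℂ, (α₁ - α₂) * c = -((α₂ - α₁) * c) := fun c => by ring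
  rw [hd, hd]
  generalize (α₂ - α₁) * (l - α₁)⁻¹ = c1
  generalize (α₂ - α₁) * (l - α₂)⁻¹ = c2
  have e1 : (1 + (-c1) • adj P) * (1 + c2 • P) = 1 + c2 • P - c1 • adj P := by
    rw [add_mul, mul_add (_ • _), smul_mul_smul_comm, hSP, smul_zero, neg_smul, one_mul, mul_one]
    abel
  have e2 : (1 - c1 • Q) * (1 - (-c2) • adj Q) = 1 - c1 • Q + c2 • adj Q := by
    rw [sub_mul, mul_sub (_ • _), smul_mul_smul_comm, hQS, smul_zero, neg_smul, one_mul, mul_one]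
    abel
  rw [← e1, ← e2]
  simp only [mul_assoc]

end TwoSteps

end Entire

/-! ### Projections and invertible linear maps -/

section Projection

variable {n : ℕ}

theorem mul_eq_zero_of_mulVec {A B : Mat n ℝ}
    (h : ∀ x, A *ᵥ (B *ᵥ x) = 0) : A * B = 0 := by
  refine Matrix.ext_of_mulVec_single fun i => ?_
  rw [← Matrix.mulVec_mulVec, h, Matrix.zero_mulVec]

/-- Conversion of the description by image and kernel into matrix identities. -/
theorem IsProjection.isTransported {P Q R₁ R₂ : Mat n ℝ}
    {V₁ V₂ : Submodule ℝ (Fin (2 * n + 1) → ℝ)} (hP : IsProjection P V₁ V₂)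
    (h1 : adj R₁ * R₁ = 1) (h2 : adj R₂ * R₂ = 1)
    (hQ : IsProjection Q (V₁.map (adj R₁).mulVecLin) (V₂.map (adj R₂).mulVecLin)) :
    IsTransported P Q R₁ R₂ := by
  obtain ⟨hP, rfl, rfl⟩ := hP
  obtain ⟨hQ, hr, hk⟩ := hQ
  have fixP : (1 - P) * P = 0 := by rw [sub_mul, one_mul, hP, sub_self]
  have fixQ : (1 - Q) * Q = 0 := by rw [sub_mul, one_mul, hQ, sub_self]
  have fixP' : P * (1 - P) = 0 := by rw [mul_sub, mul_one, hP, sub_self]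
  have fixQ' : Q * (1 - Q) = 0 := by rw [mul_sub, mul_one, hQ, sub_self]
  have h1' : R₁ * adj R₁ = 1 := mul_eq_one_comm.1 h1
  have h2' : R₂ * adj R₂ = 1 := mul_eq_one_comm.1 h2
  refine ⟨h1, h2, hP, hQ, ?_, ?_, ?_, ?_⟩
  · refine mul_eq_zero_of_mulVec fun x => ?_
    have hx : Q *ᵥ x ∈ LinearMap.range Q.mulVecLin := ⟨x, rfl⟩
    rw [hr] at hx
    obtain ⟨_, ⟨y, rfl⟩, hy⟩ := hx
    simp only [Matrix.mulVecLin_apply] at hy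
    rw [← hy, Matrix.mulVec_mulVec, Matrix.mulVec_mulVec,
      mul_assoc (1 - P), h1', mul_one, fixP, Matrix.zero_mulVec]
  · rw [mul_assoc]
    refine mul_eq_zero_of_mulVec fun x => ?_
    have hx : (adj R₁ * P) *ᵥ x ∈ LinearMap.range Q.mulVecLin := by
      rw [hr]
      exact ⟨P *ᵥ x, ⟨x, rfl⟩, by simp⟩
    obtain ⟨y, hy⟩ := hx
    rw [Matrix.mulVecLin_apply] at hy
    rw [← hy, Matrix.mulVec_mulVec, fixQ, Matrix.zero_mulVec]
  · refine mul_eq_zero_of_mulVec fun x => ?_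
    have hx : (1 - Q) *ᵥ x ∈ LinearMap.ker Q.mulVecLin := by
      rw [LinearMap.mem_ker, Matrix.mulVecLin_apply, Matrix.mulVec_mulVec, fixQ',
        Matrix.zero_mulVec]
    rw [hk] at hx
    obtain ⟨y, hy, hyx⟩ := hx
    simp only [Matrix.mulVecLin_apply] at hyx
    rw [← hyx, Matrix.mulVec_mulVec, mul_assoc, h2', mul_one]
    exact hy
  · rw [mul_assoc]
    refine mul_eq_zero_of_mulVec fun x => ?_
    have hx : (adj R₂ * (1 - P)) *ᵥ x ∈ LinearMap.ker Q.mulVecLin := by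
      rw [hk]
      refine ⟨(1 - P) *ᵥ x, ?_, by simp⟩
      change P *ᵥ ((1 - P) *ᵥ x) = 0
      rw [Matrix.mulVec_mulVec, fixP', Matrix.zero_mulVec]
    exact hx

theorem exists_eq_vecMulVec {P : Mat n ℝ} (h : P.rank = 1) :
    ∃ v w : Fin (2 * n + 1) → ℝ, P = Matrix.vecMulVec v w := by
  obtain ⟨v, -, hv⟩ := finrank_eq_one_iff'.1 h
  choose c hc using fun k => hv ⟨P *ᵥ Pi.single k 1, ⟨_, rfl⟩⟩
  refine ⟨v, c, ?_⟩
  ext i k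
  have := congrFun (congrArg Subtype.val (hc k)) i
  simp only [Submodule.coe_smul, Pi.smul_apply, smul_eq_mul, Matrix.mulVec_single_one] at this
  rw [Matrix.vecMulVec_apply, mul_comm, this, Matrix.col_apply]

end Projection

/-! ### Gauge transformation along a curve -/

section Gauge

open Polynomial

variable {n : ℕ}

theorem toC_injective : Function.Injective (toC : Mat n ℝ → Mat n ℂ) :=
  Matrix.map_injective Complex.ofReal_injective

theorem toC_mul (A B : Mat n ℝ) : toC (A * B) = toC A * toC B := map_mul (toCHom n) A B

theorem toC_add (A B : Mat n ℝ) : toC (A + B) = toC A + toC B := map_add (toCHom n) A B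

theorem toC_sub (A B : Mat n ℝ) : toC (A - B) = toC A - toC B := map_sub (toCHom n) A B

theorem toC_one : toC (1 : Mat n ℝ) = 1 := map_one (toCHom n)

theorem toC_zero : toC (0 : Mat n ℝ) = 0 := map_zero (toCHom n)

theorem toC_rho : toC (rho n ℝ) = rho n ℂ := by
  ext i k
  simp only [toC, rho, Matrix.map_apply, Matrix.of_apply]
  split_ifs <;> simp

theorem toC_adj (A : Mat n ℝ) : toC (adj A) = adj (toC A) := by
  rw [adj, toC_mul, toC_mul, toC_rho]
  rfl

theorem toC_re {A : Mat n ℂ} (h : A.map (starRingEnd ℂ) = A) : toC (A.map Complex.re) = A := by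
  ext i k
  exact Complex.conj_eq_iff_re.1 (congrFun (congrFun h i) k)

theorem map_re_toC (A : Mat n ℝ) : (toC A).map Complex.re = A := by
  ext i k
  simp [toC]

theorem HasMatDeriv.adj {K : Type*} [NormedField K] [NormedAlgebra ℝ K] {f : ℝ → Mat n K}
    {f' : Mat n K} {s : ℝ} (h : HasMatDeriv f f' s) :
    HasMatDeriv (fun u => BHat.adj (f u)) (BHat.adj f') s :=
  (h.transpose.const_mul (rho n K)).mul_const (rho n K)

/-- The logarithmic derivative of a curve of orthogonal matrices is skew-adjoint. -/
theorem adj_eq_neg_of_hasMatDeriv {f : ℝ → Mat n ℂ} {A : Mat n ℂ} {s : ℝ}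
    (h : HasMatDeriv f (f s * A) s) (horth : ∀ u, adj (f u) * f u = 1) : adj A = -A := by
  have h1 := (h.adj.mul h).unique
    ((HasMatDeriv.const (1 : Mat n ℂ)).congr_of_eventuallyEq (.of_forall horth))
  rw [adj_mul, mul_assoc, horth, mul_one, ← mul_assoc, horth, one_mul] at h1
  exact eq_neg_of_add_eq_zero_left h1

/-- The real form of `IsTransported` implies the complex one. -/
theorem IsTransported.toC {P Q R₁ R₂ : Mat n ℝ} (h : IsTransported P Q R₁ R₂) :
    IsTransported (toC P) (toC Q) (toC R₁) (toC R₂) := by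
  have e : ∀ {A B : Mat n ℝ}, A = B → BHat.toC A = BHat.toC B := fun h => by rw [h]
  obtain ⟨h1, h2, h3, h4, h5, h6, h7, h8⟩ := h
  constructor
  · simpa only [toC_mul, toC_adj, toC_one] using e h1
  · simpa only [toC_mul, toC_adj, toC_one] using e h2
  · simpa only [toC_mul] using e h3
  · simpa only [toC_mul] using e h4
  · simpa only [toC_mul, toC_sub, toC_one, toC_zero] using e h5
  · simpa only [toC_mul, toC_sub, toC_one, toC_zero, toC_adj] using e h6
  · simpa only [toC_mul, toC_sub, toC_one, toC_zero] using e h7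
  · simpa only [toC_mul, toC_sub, toC_one, toC_zero, toC_adj] using e h8

/-- The derivative of a transported projection `Q` along the equation with coefficient
polynomial `A`. -/
noncomputable def projDeriv (α₁ α₂ : ℝ) (Q : Mat n ℝ) (A : (Mat n ℝ)[X]) : Mat n ℝ :=
  Q * evalR α₂ A * (1 - Q) - (1 - Q) * evalR α₁ A * Q

theorem hasMatDeriv_projDeriv {α₁ α₂ : ℝ} {P : Mat n ℝ} {F : ℝ → ℂ → Mat n ℂ} {Q : ℝ → Mat n ℝ}
    {Q' : Mat n ℝ} {s : ℝ} {A : (Mat n ℝ)[X]}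
    (hreal : ∀ α : ℝ, (F s α).map (starRingEnd ℂ) = F s α)
    (h : ∀ᶠ u in nhds s,
      IsTransported P (Q u) ((F u α₁).map Complex.re) ((F u α₂).map Complex.re))
    (hF : ∀ l, HasMatDeriv (fun u => F u l) (F s l * polyEval n l A) s)
    (hQ : HasMatDeriv Q Q' s) : HasMatDeriv Q (projDeriv α₁ α₂ (Q s) A) s := by
  have hd : ∀ α : ℝ, HasMatDeriv (fun u => (F u α).map Complex.re)
      ((F s α).map Complex.re * evalR α A) s := by
    intro α
    have := (hF α).re
    rwa [← toC_re (hreal α), polyEval_ofReal, ← toC_mul, map_re_toC] at this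
  rw [projDeriv, ← hasMatDeriv_transported h (hd α₁) (hd α₂) hQ]
  exact hQ

/-- `B` is the gauge transform of the polynomial `A` by the rational loop with the projection `Q`
that moves along the equation with coefficient `A`, after multiplication by
`(λ - α₁)(λ - α₂)`. -/
def IsGauge (α₁ α₂ : ℝ) (Q : Mat n ℝ) (A B : (Mat n ℝ)[X]) : Prop :=
  B * numer α₁ α₂ Q (adj Q) = numer α₁ α₂ Q (adj Q) * A -
    ((α₂ - α₁) • (lin (Mat n ℝ) α₁ * C (projDeriv α₁ α₂ Q A)) -
      (α₂ - α₁) • (lin (Mat n ℝ) α₂ * C (adj (projDeriv α₁ α₂ Q A))))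

theorem adj_projDeriv {α₁ α₂ : ℝ} {Q : Mat n ℝ} {A : (Mat n ℝ)[X]}
    (h1 : adj (evalR α₁ A) = -evalR α₁ A) (h2 : adj (evalR α₂ A) = -evalR α₂ A) :
    adj (projDeriv α₁ α₂ Q A) =
      adj Q * evalR α₁ A * (1 - adj Q) - (1 - adj Q) * evalR α₂ A * adj Q := by
  rw [projDeriv, adj_sub, adj_mul, adj_mul, adj_mul, adj_mul, h1, h2, adj_sub, adj_one]
  simp only [neg_mul, mul_neg, mul_assoc]
  abel

/-- The subspace of skew-adjoint matrices, i.e. `o(n+1,n)`. -/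
def skew (n : ℕ) : Submodule ℝ (Mat n ℝ) where
  carrier := {A | adj A = -A}
  add_mem' {A B} hA hB := by
    change adj (A + B) = -(A + B)
    rw [adj_add, show adj A = -A from hA, show adj B = -B from hB, neg_add]
  zero_mem' := by simp [adj_zero]
  smul_mem' c A hA := by
    change adj (c • A) = -(c • A)
    rw [adj_smul, show adj A = -A from hA, smul_neg]

/-- The gauge transform of a polynomial with coefficients in `o(n+1,n)` is a polynomial. -/
theorem exists_isGauge (α₁ α₂ : ℝ) {Q : Mat n ℝ} {v w : Fin (2 * n + 1) → ℝ}
    (hQ : Q = Matrix.vecMulVec v w) (hQ2 : Q * Q = Q) (hQS : Q * adj Q = 0) (hSQ : adj Q * Q = 0)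
    {A : (Mat n ℝ)[X]} (hA : ∀ i, A.coeff i ∈ skew n) : ∃ B, IsGauge α₁ α₂ Q A B := by
  obtain ⟨s1, A₁, h1, hA₁⟩ := exists_eq_add_lin_mul (skew n) α₁ A hA
  obtain ⟨s2, A₂, h2, hA₂⟩ := exists_eq_add_lin_mul (skew n) α₂ A hA
  obtain ⟨-, B₁, k1, -⟩ := exists_eq_add_lin_mul ⊤ α₁ (darboux (α₂ - α₁) Q A A₁ A₂)
    fun _ => trivial
  obtain ⟨-, B₂, k2, -⟩ := exists_eq_add_lin_mul ⊤ α₂ (darboux (α₂ - α₁) Q A A₁ A₂)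
    fun _ => trivial
  have hS : adj Q * adj Q = adj Q := by rw [← adj_mul, hQ2]
  refine ⟨darboux (α₁ - α₂) (adj Q) (darboux (α₂ - α₁) Q A A₁ A₂) B₂ B₁, ?_⟩
  rw [IsGauge, adj_projDeriv s1 s2]
  exact darboux_darboux_mul hQ2 hS hQS hSQ h1 h2
    (adj_mul_skew_mul hQ (exists_eq_add_lin_mul (skew n) α₁ A₁ hA₁).1)
    (mul_skew_mul_adj hQ (exists_eq_add_lin_mul (skew n) α₂ A₂ hA₂).1) k1 k2

/-- For a polynomial `β λ + u` of degree one, the gauge transform only changes `u`. -/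
theorem isGauge_linear (α₁ α₂ : ℝ) {Q : Mat n ℝ} {v w : Fin (2 * n + 1) → ℝ}
    (hQ : Q = Matrix.vecMulVec v w) (hQ2 : Q * Q = Q) (hQS : Q * adj Q = 0) (hSQ : adj Q * Q = 0)
    {β u : Mat n ℝ} (hβ : adj β = -β) (hu : adj u = -u) :
    IsGauge α₁ α₂ Q (X * C β + C u)
      (X * C β + C (u + (α₁ - α₂) • ⁅β, Q - adj Q⁆)) := by
  have hdiv : ∀ (α : ℝ) (u : Mat n ℝ), X * C β + C u =
      C (evalR α (X * C β + C u)) + lin (Mat n ℝ) α * C β := by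
    intro α u
    simp only [map_add, map_mul, evalR_X, evalR_C, lin, sub_mul]
    abel
  have hd : ∀ (a : ℝ) (Y u : Mat n ℝ), darboux a Y (X * C β + C u) (C β) (C β) =
      X * C β + C (u + a • (Y * β - β * Y)) := by
    intro a Y u
    have e : Y * β * (1 - Y) - (1 - Y) * β * Y = Y * β - β * Y := by
      simp only [mul_sub, sub_mul, one_mul, mul_one]
      abel
    rw [darboux, ← C_mul, ← C_mul, ← C_mul, ← C_mul, smul_C, smul_C, add_sub_assoc, ← C_sub,
      ← smul_sub, e, add_assoc, ← C_add]
  have hS : adj Q * adj Q = adj Q := by rw [← adj_mul, hQ2]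
  have s : ∀ α : ℝ, adj (evalR α (X * C β + C u)) = -evalR α (X * C β + C u) := by
    intro α
    rw [map_add, map_mul, evalR_X, evalR_C, evalR_C, ← Algebra.smul_def, adj_add, adj_smul, hβ, hu,
      smul_neg, neg_add]
  have key := darboux_darboux_mul (α₁ := α₁) (α₂ := α₂) hQ2 hS hQS hSQ (hdiv α₁ u) (hdiv α₂ u)
    (by rw [evalR_C]; exact adj_mul_skew_mul hQ hβ) (by rw [evalR_C]; exact mul_skew_mul_adj hQ hβ)
    (B₁ := C β) (B₂ := C β) (by rw [hd]; exact hdiv _ _)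
    (by rw [hd]; exact hdiv _ _)
  rw [hd, hd] at key
  rw [IsGauge, adj_projDeriv (s α₁) (s α₂)]
  have e : u + (α₁ - α₂) • ⁅β, Q - adj Q⁆ = u + (α₂ - α₁) • (Q * β - β * Q) +
      (α₁ - α₂) • (adj Q * β - β * adj Q) := by
    rw [Ring.lie_def, mul_sub, sub_mul]
    module
  rw [e]
  exact key

theorem IsGauge.loopHom_mul {α₁ α₂ : ℝ} {Q : Mat n ℝ} {A B : (Mat n ℝ)[X]}
    (h : IsGauge α₁ α₂ Q A B) :
    loopHom n B * loopDress α₁ α₂ Q (adj Q) = loopDress α₁ α₂ Q (adj Q) * loopHom n A -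
      ((α₂ - α₁) • (res n α₂ * loopHom n (C (projDeriv α₁ α₂ Q A))) -
        (α₂ - α₁) • (res n α₁ * loopHom n (C (adj (projDeriv α₁ α₂ Q A))))) :=
  map_mul_dress (res_mul_lin α₁) (res_mul_lin α₂) (res_mul_comm α₁) (res_mul_comm α₂) h

theorem smul_one_mul_polyEval_lin {l : ℂ} {α : ℝ} (hl : l ≠ α) :
    ((l - α)⁻¹ • (1 : Mat n ℂ)) * polyEval n l (lin (Mat n ℝ) α) = 1 := by
  rw [polyEval_lin, smul_mul_smul_comm, inv_mul_cancel₀ (sub_ne_zero.2 hl), one_smul, one_mul]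

theorem smul_one_mul_comm (c : ℂ) (A : Mat n ℂ) : (c • (1 : Mat n ℂ)) * A = A * c • 1 := by
  rw [smul_mul_assoc, one_mul, mul_smul_comm, mul_one]

theorem gLoop_mul_gLoop {α₁ α₂ : ℝ} {Q : Mat n ℝ} (hQ2 : Q * Q = Q) (hQS : Q * adj Q = 0)
    (hSQ : adj Q * Q = 0) {l : ℂ} (h1 : l ≠ α₁) (h2 : l ≠ α₂) :
    gLoop α₁ α₂ Q l * gLoop α₂ α₁ Q l = 1 := by
  rw [gLoop_eq_dress, gLoop_eq_dress]
  exact dress_mul_dress (smul_one_mul_polyEval_lin h1) (smul_one_mul_polyEval_lin h2)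
    (smul_one_mul_comm _) (smul_one_mul_comm _) hQ2
    (by rw [← adj_eq_sharp, ← adj_mul, hQ2]) hQS hSQ

theorem loopDress_mul_loopDress (α₁ α₂ : ℝ) {Q : Mat n ℝ} (hQ2 : Q * Q = Q) (hQS : Q * adj Q = 0)
    (hSQ : adj Q * Q = 0) : loopDress α₁ α₂ Q (adj Q) * loopDress α₂ α₁ Q (adj Q) = 1 :=
  dress_mul_dress (res_mul_lin α₁) (res_mul_lin α₂) (res_mul_comm α₁) (res_mul_comm α₂) hQ2
    (by rw [← adj_mul, hQ2]) hQS hSQ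

theorem HasMatDeriv.gLoop {α₁ α₂ : ℝ} {Q : ℝ → Mat n ℝ} {Q' : Mat n ℝ} {s : ℝ}
    (h : HasMatDeriv Q Q' s) (l : ℂ) :
    HasMatDeriv (fun u => gLoop α₁ α₂ (Q u) l)
      ((((α₂ : ℂ) - α₁) / (l - α₂)) • BHat.toC Q' +
        (((α₁ : ℂ) - α₂) / (l - α₁)) • BHat.toC (BHat.adj Q')) s := by
  have := ((HasMatDeriv.const (1 : Mat n ℂ)).add
    (h.toC.const_smul (((α₂ : ℂ) - α₁) / (l - α₂)))).add
    (h.adj.toC.const_smul (((α₁ : ℂ) - α₂) / (l - α₁)))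
  rw [zero_add] at this
  exact this

theorem IsGauge.polyEval_mul {α₁ α₂ : ℝ} {Q : Mat n ℝ} {A B : (Mat n ℝ)[X]}
    (h : IsGauge α₁ α₂ Q A B) {l : ℂ} (h1 : l ≠ α₁) (h2 : l ≠ α₂) :
    polyEval n l B * gLoop α₁ α₂ Q l = gLoop α₁ α₂ Q l * polyEval n l A -
      ((((α₂ : ℂ) - α₁) / (l - α₂)) • toC (projDeriv α₁ α₂ Q A) +
        (((α₁ : ℂ) - α₂) / (l - α₁)) • toC (adj (projDeriv α₁ α₂ Q A))) := by
  have := map_mul_dress (smul_one_mul_polyEval_lin h1) (smul_one_mul_polyEval_lin h2)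
    (smul_one_mul_comm _) (smul_one_mul_comm _) h
  rw [gLoop_eq_dress, ← adj_eq_sharp, this]
  congr 1
  rw [polyEval_C, polyEval_C, smul_mul_assoc, one_mul, smul_mul_assoc, one_mul]
  have h : ∀ (c : ℂ) (A : Mat n ℂ), (α₂ - α₁) • c • A = ((α₂ - α₁ : ℂ) * c) • A := by
    intro c A
    ext i k
    simp [mul_assoc]
  rw [h, h, ← div_eq_mul_inv, ← div_eq_mul_inv, sub_eq_add_neg (_ • _), ← neg_smul, ← neg_div,
    neg_sub]

/-- In any ring, `g' h + g h' = 0` whenever `h = g⁻¹`; together with the gauge identity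
`B g = g A - g'` this gives `A h + h' = h B`. -/
theorem gauge_inverse {R : Type*} [Ring R] {g h g' h' A B : R} (hgh : g * h = 1) (hhg : h * g = 1)
    (hd : g' * h + g * h' = 0) (hB : B * g = g * A - g') : A * h + h' = h * B := by
  have e1 : h' = -(h * g' * h) := by
    have := congrArg (fun x => h * x) hd
    simp only [mul_add, mul_zero, ← mul_assoc, hhg, one_mul] at this
    exact eq_neg_of_add_eq_zero_right this
  have e2 : B = (g * A - g') * h := by rw [← hB, mul_assoc, hgh, mul_one]
  rw [e1, e2, ← mul_assoc, mul_sub, ← mul_assoc, hhg, one_mul, sub_mul]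
  abel

/-- The dressed frame satisfies the gauge transformed linear equation, away from the poles. -/
theorem hasMatDeriv_dressed {α₁ α₂ : ℝ} {P : Mat n ℝ} {F : ℝ → ℂ → Mat n ℂ} {Q : ℝ → Mat n ℝ}
    {s : ℝ} {A B : (Mat n ℝ)[X]} {l : ℂ} (h1 : l ≠ α₁) (h2 : l ≠ α₂)
    (hQ : ∀ᶠ u in nhds s, Q u * Q u = Q u ∧ Q u * adj (Q u) = 0 ∧ adj (Q u) * Q u = 0)
    (hF : HasMatDeriv (fun u => F u l) (F s l * polyEval n l A) s)
    (hD : HasMatDeriv Q (projDeriv α₁ α₂ (Q s) A) s) (hB : IsGauge α₁ α₂ (Q s) A B) :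
    HasMatDeriv (fun u => gLoop α₁ α₂ P l * F u l * gLoop α₂ α₁ (Q u) l)
      (gLoop α₁ α₂ P l * F s l * gLoop α₂ α₁ (Q s) l * polyEval n l B) s := by
  have hg := hD.gLoop (α₁ := α₁) (α₂ := α₂) l
  have hh := hD.gLoop (α₁ := α₂) (α₂ := α₁) l
  obtain ⟨q1, q2, q3⟩ := hQ.self_of_nhds
  have z := (hg.mul hh).unique ((HasMatDeriv.const (1 : Mat n ℂ)).congr_of_eventuallyEq
    (hQ.mono fun u hu => gLoop_mul_gLoop hu.1 hu.2.1 hu.2.2 h1 h2))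
  have e := gauge_inverse (gLoop_mul_gLoop q1 q2 q3 h1 h2) (gLoop_mul_gLoop q1 q2 q3 h2 h1) z
    (hB.polyEval_mul h1 h2)
  have := (hF.const_mul (gLoop α₁ α₂ P l)).mul hh
  have e2 : gLoop α₁ α₂ P l * F s l * gLoop α₂ α₁ (Q s) l * polyEval n l B =
      gLoop α₁ α₂ P l * (F s l * polyEval n l A) * gLoop α₂ α₁ (Q s) l +
      gLoop α₁ α₂ P l * F s l * ((((α₁ : ℂ) - α₂) / (l - α₁)) • toC (projDeriv α₁ α₂ (Q s) A) +
        (((α₂ : ℂ) - α₁) / (l - α₂)) • toC (adj (projDeriv α₁ α₂ (Q s) A))) := by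
    rw [mul_assoc _ (gLoop α₂ α₁ (Q s) l), ← e, mul_add]
    simp only [mul_assoc]
  rw [e2]
  exact this

end Gauge

/-! ### The dressed resolvent -/

section Resolvent

open Polynomial

variable {n : ℕ}

/-- The polynomial `β λ + b + q`. -/
noncomputable def laxPoly (n : ℕ) (q : Mat n ℝ) : (Mat n ℝ)[X] := X * C (beta n) + C (bMat n + q)

theorem loopHom_laxPoly (q : Mat n ℝ) :
    loopHom n (laxPoly n q) = lmono 1 (beta n) + lmono 0 (bMat n + q) := by
  rw [laxPoly, map_add, map_mul, loopHom_X, loopHom_C, loopHom_C, HahnSeries.single_mul_single]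
  simp [lmono]

theorem polyEval_laxPoly (l : ℂ) (q : Mat n ℝ) :
    polyEval n l (laxPoly n q) = l • toC (beta n) + toC (bMat n + q) := by
  rw [laxPoly, X_mul_C, map_add, ← monomial_one_one_eq_X, C_mul_monomial, mul_one,
    polyEval_monomial, pow_one, polyEval_C]

theorem lmono_one_mul_comm (ξ : Loop n) : lmono 1 1 * ξ = ξ * lmono 1 1 := by
  ext1
  funext k
  rw [lmono, HahnSeries.coeff_single_mul, HahnSeries.coeff_mul_single, one_mul, mul_one]

theorem IsResolvent.mono {U O : Set (ℝ × ℝ)} {q : ℝ × ℝ → Mat n ℝ} {T : ℝ × ℝ → Loop n}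
    (h : IsResolvent n U q T) (hO : O ⊆ U) : IsResolvent n O q T where
  smooth i := (h.smooth i).mono hO
  orth p hp := h.orth p (hO hp)
  degree_le p hp := h.degree_le p (hO hp)
  leading p hp := h.leading p (hO hp)
  commute p hp := h.commute p (hO hp)
  power p hp := h.power p (hO hp)

theorem lcoeff_eq_coeff (ξ : Loop n) (k : ℤ) : ξ.coeff k = lcoeff ξ (-k) := by
  rw [lcoeff, neg_neg]

theorem IsResolvent.lowBdd {U : Set (ℝ × ℝ)} {q : ℝ × ℝ → Mat n ℝ} {T : ℝ × ℝ → Loop n}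
    (h : IsResolvent n U q T) {p : ℝ × ℝ} (hp : p ∈ U) : LowBdd (-1) (T p) := fun k hk => by
  rw [lcoeff_eq_coeff, h.degree_le p hp _ (by omega)]

theorem IsResolvent.smoothLoop {U : Set (ℝ × ℝ)} {q : ℝ × ℝ → Mat n ℝ} {T : ℝ × ℝ → Loop n}
    (h : IsResolvent n U q T) : SmoothLoop U T :=
  ⟨⟨-1, fun _ hp => h.lowBdd hp⟩, fun k => by
    simp only [lcoeff_eq_coeff]
    exact h.smooth (-k)⟩

theorem IsResolvent.loopAdj_eq_neg {U : Set (ℝ × ℝ)} {q : ℝ × ℝ → Mat n ℝ} {T : ℝ × ℝ → Loop n}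
    (h : IsResolvent n U q T) {p : ℝ × ℝ} (hp : p ∈ U) : loopAdj (T p) = -T p := by
  ext1
  funext k
  rw [coeff_loopAdj, lcoeff_eq_coeff, isOrthLie_iff.1 (h.orth p hp _), HahnSeries.coeff_neg,
    ← lcoeff_eq_coeff]

/-- The rational loop is orthogonal. -/
theorem loopAdj_loopDress (α₁ α₂ : ℝ) (Q : Mat n ℝ) :
    loopAdj (loopDress α₁ α₂ Q (adj Q)) = loopDress α₂ α₁ Q (adj Q) := by
  have hr : ∀ (α : ℝ) (k : ℤ) (A : Mat n ℝ),
      adj ((res n α).coeff k * A) = (res n α).coeff k * adj A := by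
    intro α k A
    rw [coeff_res]
    split_ifs
    · rw [smul_mul_assoc, one_mul, adj_smul, smul_mul_assoc, one_mul]
    · rw [zero_mul, zero_mul, adj_zero]
  ext1
  funext k
  have h1 : adj ((1 : Loop n).coeff k) = (1 : Loop n).coeff k := by
    rw [HahnSeries.coeff_one]
    split_ifs
    · exact adj_one
    · exact adj_zero
  simp only [coeff_loopAdj, dress, HahnSeries.coeff_add, HahnSeries.coeff_sub,
    HahnSeries.coeff_smul, loopHom_C, HahnSeries.coeff_mul_single_zero, adj_add, adj_sub, adj_smul,
    hr, adj_adj, h1]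
  module

/-- Conjugation by the rational loop does not change the leading coefficient. -/
theorem coeff_neg_one_conj (α₁ α₂ : ℝ) (Q S : Mat n ℝ) {T : Loop n} (hT : LowBdd (-1) T) :
    (loopDress α₁ α₂ Q S * T * loopDress α₂ α₁ Q S).coeff (-1) = T.coeff (-1) := by
  set g := loopDress α₁ α₂ Q S
  set h := loopDress α₂ α₁ Q S
  have e : g * T * h = T + ((g - 1) * T * h + T * (h - 1)) := by
    simp only [sub_mul, mul_sub, one_mul, mul_one]
    abel
  have h1 : LowBdd 0 ((g - 1) * T * h) := by
    simpa using ((loopDress_sub_one α₁ α₂ Q S).mul hT).mul (lowBdd_loopDress α₂ α₁ Q S)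
  have h2 : LowBdd 0 (T * (h - 1)) := by
    simpa using hT.mul (loopDress_sub_one α₂ α₁ Q S)
  rw [e, HahnSeries.coeff_add, (h1.add h2) (-1) (by norm_num), add_zero]

theorem conj_pow {R : Type*} [Ring R] {g h : R} (hhg : h * g = 1) (hgh : g * h = 1) (T : R)
    (m : ℕ) : (g * T * h) ^ m = g * T ^ m * h := by
  induction m with
  | zero => rw [pow_zero, pow_zero, mul_one, hgh]
  | succ m ih =>
    rw [pow_succ, ih, pow_succ]
    calc g * T ^ m * h * (g * T * h) = g * T ^ m * (h * g) * T * h := by simp only [mul_assoc]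
      _ = g * (T ^ m * T) * h := by rw [hhg, mul_one]; simp only [mul_assoc]

/-- If `T' = -[A, T]` and `B` is the gauge transform of `A` by `g`, then the derivative of
`g T g⁻¹` is `-[B, g T g⁻¹]`. -/
theorem deriv_conj_add_lie {R : Type*} [Ring R] {g h g' h' A B T : R} (hgh : g * h = 1)
    (hhg : h * g = 1) (hd : g' * h + g * h' = 0) (hB : B * g = g * A - g') :
    (g' * T + g * (-⁅A, T⁆)) * h + g * T * h' + ⁅B, g * T * h⁆ = 0 := by
  have e := gauge_inverse hgh hhg hd hB
  rw [Ring.lie_def, Ring.lie_def, show B * (g * T * h) = B * g * T * h by simp only [mul_assoc], hB,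
    show g * T * h * B = g * T * (h * B) by simp only [mul_assoc], ← e]
  simp only [mul_add, add_mul, sub_mul, mul_sub, neg_mul, mul_neg, mul_assoc]
  abel

/-- Conjugation of a solution of `[∂ₓ + A, T] = 0` by a gauge transformation. -/
theorem partialX_conj_add_lie {O : Set (ℝ × ℝ)} (hO : IsOpen O) {T g h : ℝ × ℝ → Loop n}
    {A B g' h' : Loop n} (hT : SmoothLoop O T) {p : ℝ × ℝ} (hp : p ∈ O)
    (hTA : ∀ i : ℤ, partialX (fun r => lcoeff (T r) i) p + lcoeff ⁅A, T p⁆ i = 0)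
    (hgh : ∀ p ∈ O, g p * h p = 1) (hhg : h p * g p = 1)
    (hg : HasLoopDeriv (fun s => g (s, p.2)) g' p.1)
    (hh : HasLoopDeriv (fun s => h (s, p.2)) h' p.1) (hB : B * g p = g p * A - g') (i : ℤ) :
    partialX (fun r => lcoeff (g r * T r * h r) i) p + lcoeff ⁅B, g p * T p * h p⁆ i = 0 := by
  have hTd : HasLoopDeriv (fun s => T (s, p.2)) (-⁅A, T p⁆) p.1 := by
    refine hT.hasLoopDerivX hO hp fun k => ?_
    have := hTA (-k)
    simp only [← lcoeff_eq_coeff] at this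
    rw [HahnSeries.coeff_neg]
    exact (eq_neg_of_add_eq_zero_left this).symm
  have hc : ContinuousAt (fun s : ℝ => (s, p.2)) p.1 := by fun_prop
  have z := (hg.mul hh).unique ((HasLoopDeriv.const (1 : Loop n)).congr_of_eventuallyEq
    ((hc.eventually (hO.mem_nhds hp)).mono fun s hs => hgh _ hs))
  have hder := ((hg.mul hTd).mul hh).2 (-i)
  have hzero := deriv_conj_add_lie (T := T p) (hgh p hp) hhg z hB
  rw [partialX_eq (f := fun r => lcoeff (g r * T r * h r) i) (p := p) hder, lcoeff,
    ← HahnSeries.coeff_add, hzero, HahnSeries.coeff_zero]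

/-- Dressing the resolvent: `g T g⁻¹` is the resolvent of the gauge transformed operator. -/
theorem isResolvent_conj {O : Set (ℝ × ℝ)} (hO : IsOpen O) {q q' : ℝ × ℝ → Mat n ℝ}
    {T : ℝ × ℝ → Loop n} (hT : IsResolvent n O q T) {α₁ α₂ : ℝ} {Q : ℝ × ℝ → Mat n ℝ}
    (hQs : SmoothMat O Q)
    (hQ : ∀ p ∈ O, Q p * Q p = Q p ∧ Q p * adj (Q p) = 0 ∧ adj (Q p) * Q p = 0)
    (hD : ∀ p ∈ O,
      HasMatDeriv (fun s => Q (s, p.2)) (projDeriv α₁ α₂ (Q p) (laxPoly n (q p))) p.1)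
    (hB : ∀ p ∈ O, IsGauge α₁ α₂ (Q p) (laxPoly n (q p)) (laxPoly n (q' p))) :
    IsResolvent n O q' fun p =>
      loopDress α₁ α₂ (Q p) (adj (Q p)) * T p * loopDress α₂ α₁ (Q p) (adj (Q p)) := by
  have hadj : SmoothMat O fun p => adj (Q p) :=
    ((smoothMat_const _).mul hQs.transpose).mul (smoothMat_const _)
  have hsm := ((smoothLoop_loopDress α₁ α₂ hQs hadj).mul hT.smoothLoop).mul
    (smoothLoop_loopDress α₂ α₁ hQs hadj)
  have hlow : ∀ p ∈ O, LowBdd (-1)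
      (loopDress α₁ α₂ (Q p) (adj (Q p)) * T p * loopDress α₂ α₁ (Q p) (adj (Q p))) := by
    intro p hp
    simpa using ((lowBdd_loopDress α₁ α₂ _ _).mul (hT.lowBdd hp)).mul (lowBdd_loopDress α₂ α₁ _ _)
  have hgh : ∀ p ∈ O, loopDress α₁ α₂ (Q p) (adj (Q p)) * loopDress α₂ α₁ (Q p) (adj (Q p)) = 1 :=
    fun p hp => loopDress_mul_loopDress α₁ α₂ (hQ p hp).1 (hQ p hp).2.1 (hQ p hp).2.2
  have hhg : ∀ p ∈ O, loopDress α₂ α₁ (Q p) (adj (Q p)) * loopDress α₁ α₂ (Q p) (adj (Q p)) = 1 :=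
    fun p hp => loopDress_mul_loopDress α₂ α₁ (hQ p hp).1 (hQ p hp).2.1 (hQ p hp).2.2
  refine ⟨fun i => hsm.2 (-i), fun p hp i => ?_, fun p hp i hi => hlow p hp _ (by omega),
    fun p hp => ?_, fun p hp i => ?_, fun p hp => ?_⟩
  · have e : loopAdj (loopDress α₁ α₂ (Q p) (adj (Q p)) * T p *
        loopDress α₂ α₁ (Q p) (adj (Q p))) =
        -(loopDress α₁ α₂ (Q p) (adj (Q p)) * T p * loopDress α₂ α₁ (Q p) (adj (Q p))) := by
      rw [loopAdj_mul, loopAdj_mul, loopAdj_loopDress, loopAdj_loopDress, hT.loopAdj_eq_neg hp]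
      exact (congrArg _ (neg_mul (T p) _)).trans
        ((mul_neg _ _).trans (congrArg Neg.neg (mul_assoc _ _ _).symm))
    have := congrArg (fun ξ : Loop n => ξ.coeff (-i)) e
    exact isOrthLie_iff.2 this
  · exact (coeff_neg_one_conj α₁ α₂ _ _ (hT.lowBdd hp)).trans (hT.leading p hp)
  · have hDa := (hD p hp).adj
    have hc := hT.commute p hp
    rw [← loopHom_laxPoly] at hc ⊢
    exact partialX_conj_add_lie hO (g := fun p => loopDress α₁ α₂ (Q p) (adj (Q p)))
      (h := fun p => loopDress α₂ α₁ (Q p) (adj (Q p))) hT.smoothLoop hp hc hgh (hhg p hp)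
      (hasLoopDeriv_loopDress α₁ α₂ (hD p hp) hDa) (hasLoopDeriv_loopDress α₂ α₁ (hD p hp) hDa)
      (hB p hp).loopHom_mul i
  · rw [conj_pow (hhg p hp) (hgh p hp), hT.power p hp, ← mul_assoc, ← lmono_one_mul_comm]
    simp only [mul_assoc]

end Resolvent

/-! ### Polynomial parts of series -/

section Plus

open Polynomial

variable {n : ℕ}

/-- The polynomial `∑_{0 ≤ i ≤ N} ξ_i λ^i`, the polynomial part of a series of degree at most
`N`. -/
noncomputable def plusPoly (N : ℕ) (ξ : Loop n) : (Mat n ℝ)[X] :=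
  ∑ i ∈ Finset.range (N + 1), monomial i (lcoeff ξ i)

theorem polyEval_plusPoly (N : ℕ) (ξ : Loop n) (l : ℂ) :
    polyEval n l (plusPoly N ξ) = plusEval N ξ l := by
  rw [plusPoly, map_sum, plusEval]
  exact Finset.sum_congr rfl fun i _ => polyEval_monomial l i _

theorem coeff_plusPoly (N : ℕ) (ξ : Loop n) (i : ℕ) :
    (plusPoly N ξ).coeff i = if i ≤ N then lcoeff ξ i else 0 := by
  simp only [plusPoly, finsetSum_coeff, coeff_monomial, Finset.sum_ite_eq', Finset.mem_range,
    Nat.lt_succ_iff]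

/-- The polynomial part is the only polynomial that agrees with the series up to negative powers
of `λ`. -/
theorem eq_plusPoly_iff {N : ℕ} {ξ : Loop n} (hξ : LowBdd (-N) ξ) {B : (Mat n ℝ)[X]} :
    B = plusPoly N ξ ↔ LowBdd 1 (ξ - loopHom n B) := by
  constructor
  · rintro rfl k hk
    rw [HahnSeries.coeff_sub, coeff_loopHom, if_pos (by omega), coeff_plusPoly]
    split_ifs with h
    · rw [lcoeff, show -(((-k).toNat : ℕ) : ℤ) = k by omega, sub_self]
    · rw [hξ k (by omega), sub_zero]
  · intro h
    ext1 i
    have h1 := h (-i) (by omega)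
    rw [HahnSeries.coeff_sub, coeff_loopHom, if_pos (by omega), neg_neg, Int.toNat_natCast,
      sub_eq_zero] at h1
    rw [coeff_plusPoly, ← h1]
    split_ifs with h2
    · rfl
    · exact hξ _ (by omega)

/-- Gauge transformation commutes with taking polynomial parts, because the rational loop is the
identity at `λ = ∞`. -/
theorem IsGauge.eq_plusPoly {α₁ α₂ : ℝ} {Q : Mat n ℝ} (hQ2 : Q * Q = Q) (hQS : Q * adj Q = 0)
    (hSQ : adj Q * Q = 0) {N : ℕ} {ξ : Loop n} (hξ : LowBdd (-N) ξ) {B : (Mat n ℝ)[X]}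
    (hB : IsGauge α₁ α₂ Q (plusPoly N ξ) B) :
    B = plusPoly N (loopDress α₁ α₂ Q (adj Q) * ξ * loopDress α₂ α₁ Q (adj Q)) := by
  have hlow : LowBdd (-N) (loopDress α₁ α₂ Q (adj Q) * ξ * loopDress α₂ α₁ Q (adj Q)) := by
    simpa using ((lowBdd_loopDress α₁ α₂ Q (adj Q)).mul hξ).mul (lowBdd_loopDress α₂ α₁ Q (adj Q))
  rw [eq_plusPoly_iff hlow]
  have hgh := loopDress_mul_loopDress α₁ α₂ hQ2 hQS hSQ
  have hN := (eq_plusPoly_iff hξ).1 rfl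
  have key := hB.loopHom_mul
  have hd : LowBdd 1 ((α₂ - α₁) • (res n α₂ * loopHom n (C (projDeriv α₁ α₂ Q (plusPoly N ξ)))) -
        (α₂ - α₁) • (res n α₁ * loopHom n (C (adj (projDeriv α₁ α₂ Q (plusPoly N ξ)))))) :=
    ((lowBdd_res_mul_C _ _).smul _).sub ((lowBdd_res_mul_C _ _).smul _)
  generalize (α₂ - α₁) • (res n α₂ * loopHom n (C (projDeriv α₁ α₂ Q (plusPoly N ξ)))) -
    (α₂ - α₁) • (res n α₁ * loopHom n (C (adj (projDeriv α₁ α₂ Q (plusPoly N ξ))))) = d at key hd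
  have hg := lowBdd_loopDress α₁ α₂ Q (adj Q)
  have hh := lowBdd_loopDress α₂ α₁ Q (adj Q)
  generalize loopDress α₁ α₂ Q (adj Q) = g at *
  generalize loopDress α₂ α₁ Q (adj Q) = h at *
  have e : g * ξ * h - loopHom n B = (g * (ξ - loopHom n (plusPoly N ξ)) + d) * h := by
    have e1 : loopHom n B = loopHom n B * g * h := by rw [mul_assoc, hgh, mul_one]
    rw [e1, key, mul_sub, sub_mul, add_mul, sub_mul]
    abel
  rw [e]
  have h1 : LowBdd 1 (g * (ξ - loopHom n (plusPoly N ξ))) := by simpa using hg.mul hN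
  simpa using (h1.add hd).mul hh

end Plus

/-! ### Frames and solutions of the flow -/

section Flow

variable {n : ℕ}

/-- The partial derivatives of a smooth map commute. -/
theorem partialT_partialX {O : Set (ℝ × ℝ)} (hO : IsOpen O) {G : ℝ × ℝ → Mat n ℂ}
    (hG : SmoothMat O G) {p : ℝ × ℝ} (hp : p ∈ O) :
    partialT (partialX G) p = partialX (partialT G) p := by
  ext i k
  set f : ℝ × ℝ → ℂ := fun r => G r i k with hf
  have hfs : ContDiffOn ℝ ∞ f O := hG i k
  have hc : ContDiffAt ℝ ∞ f p := hfs.contDiffAt (hO.mem_nhds hp)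
  have hsymm : IsSymmSndFDerivAt ℝ f p := hc.isSymmSndFDerivAt (by simpa using ENat.LEInfty.out)
  have hd : ∀ r ∈ O, HasFDerivAt f (fderiv ℝ f r) r := fun r hr =>
    ((hfs.contDiffAt (hO.mem_nhds hr)).differentiableAt (by simp)).hasFDerivAt
  have h2 : HasFDerivAt (fderiv ℝ f) (fderiv ℝ (fderiv ℝ f) p) p :=
    ((hc.fderiv_right (m := 1)
      (by rw [one_add_one_eq_two]; exact ENat.LEInfty.out)).differentiableAt (by simp)).hasFDerivAt
  have hx : ∀ r ∈ O, partialX G r i k = fderiv ℝ f r (1, 0) := fun r hr =>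
    (hasDerivAt_lineX (hd r hr)).deriv
  have ht : ∀ r ∈ O, partialT G r i k = fderiv ℝ f r (0, 1) := fun r hr =>
    (hasDerivAt_lineT (hd r hr)).deriv
  have cx : ContinuousAt (fun s : ℝ => (s, p.2)) p.1 := by fun_prop
  have ct : ContinuousAt (fun s : ℝ => (p.1, s)) p.2 := by fun_prop
  have e1 : HasDerivAt (fun s => partialX G (p.1, s) i k)
      (fderiv ℝ (fderiv ℝ f) p (0, 1) (1, 0)) p.2 := by
    have := (hasDerivAt_lineT h2).clm_apply (hasDerivAt_const p.2 ((1, 0) : ℝ × ℝ))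
    simp only [map_zero, add_zero] at this
    refine this.congr_of_eventuallyEq ?_
    exact (ct.eventually (hO.mem_nhds hp)).mono fun s hs => hx _ hs
  have e2 : HasDerivAt (fun s => partialT G (s, p.2) i k)
      (fderiv ℝ (fderiv ℝ f) p (1, 0) (0, 1)) p.1 := by
    have := (hasDerivAt_lineX h2).clm_apply (hasDerivAt_const p.1 ((0, 1) : ℝ × ℝ))
    simp only [map_zero, add_zero] at this
    refine this.congr_of_eventuallyEq ?_
    exact (cx.eventually (hO.mem_nhds hp)).mono fun s hs => ht _ hs
  change deriv (fun s => partialX G (p.1, s) i k) p.2 = deriv (fun s => partialT G (s, p.2) i k) p.1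
  rw [e1.deriv, e2.deriv]
  exact hsymm _ _

theorem SmoothMat.lcoeff {U : Set (ℝ × ℝ)} {ξ : ℝ × ℝ → Loop n} (h : SmoothLoop U ξ) (i : ℤ) :
    SmoothMat U fun p => lcoeff (ξ p) i := h.2 (-i)

/-- A frame at `λ = 0` yields the flow equation, as the compatibility condition of the two linear
equations for the frame. -/
theorem isSolution_of_isFrame {j : ℕ} {O : Set (ℝ × ℝ)} (hO : IsOpen O) {q : ℝ × ℝ → Mat n ℝ}
    (hq : SmoothMat O q) (hqB : ∀ p ∈ O, IsBorel n (q p)) {F : ℝ × ℝ → ℂ → Mat n ℂ}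
    (hF : IsFrame n j O q F) : IsSolution n j O q := by
  obtain ⟨hsm, -, horth, -, hx, T, hT, ht⟩ := hF
  refine ⟨hq, hqB, T, hT, fun p hp => ?_⟩
  set W : ℝ × ℝ → Mat n ℝ := fun r => lcoeff (T r ^ (2 * j - 1)) 0 with hW
  have hWs : SmoothMat O W := SmoothMat.lcoeff (hT.smoothLoop.pow _) 0
  set G : ℝ × ℝ → Mat n ℂ := fun r => F r 0 with hG
  have hdet : ∀ r ∈ O, IsUnit (G r).det := fun r hr => by rw [hG]; simp [(horth r hr 0).1]
  have gx : ∀ r ∈ O, partialX G r = G r * toC (bMat n + q r) := by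
    intro r hr
    have := congrArg (fun Y => G r * Y) (hx r hr 0)
    simp only [zero_smul, zero_add] at this
    rwa [← mul_assoc, Matrix.mul_nonsing_inv _ (hdet r hr), one_mul] at this
  have hplus : ∀ r, plusEval (2 * j - 1) (T r ^ (2 * j - 1)) 0 = toC (W r) := by
    intro r
    rw [plusEval, Finset.sum_range_succ']
    simp [hW]
  have gt : ∀ r ∈ O, partialT G r = G r * toC (W r) := by
    intro r hr
    have := congrArg (fun Y => G r * Y) (ht r hr 0)
    simp only [hplus] at this
    rwa [← mul_assoc, Matrix.mul_nonsing_inv _ (hdet r hr), one_mul] at this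
  have cx : ContinuousAt (fun s : ℝ => (s, p.2)) p.1 := by fun_prop
  have ct : ContinuousAt (fun s : ℝ => (p.1, s)) p.2 := by fun_prop
  have dGx := (hsm 0).hasMatDerivX hO hp
  have dGt := (hsm 0).hasMatDerivT hO hp
  have dq := ((HasMatDeriv.const (bMat n)).add (hq.hasMatDerivT hO hp)).toC
  have dW := (hWs.hasMatDerivX hO hp).toC
  have e1 : partialT (partialX G) p =
      G p * toC (W p) * toC (bMat n + q p) + G p * toC (partialT q p) := by
    have := (dGt.mul dq).congr_of_eventuallyEq (g := fun s => partialX G (p.1, s))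
      ((ct.eventually (hO.mem_nhds hp)).mono fun s hs => gx _ hs)
    rw [zero_add] at this
    rw [partialT_eq this]
    exact congrArg (fun Y => Y * _ + _) (gt p hp)
  have e2 : partialX (partialT G) p =
      G p * toC (bMat n + q p) * toC (W p) + G p * toC (partialX W p) := by
    have := (dGx.mul dW).congr_of_eventuallyEq (g := fun s => partialT G (s, p.2))
      ((cx.eventually (hO.mem_nhds hp)).mono fun s hs => gt _ hs)
    rw [partialX_eq this]
    exact congrArg (fun Y => Y * _ + _) (gx p hp)
  have e3 := partialT_partialX hO (hsm 0) hp
  change partialT (partialX G) p = partialX (partialT G) p at e3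
  rw [e1, e2, mul_assoc, mul_assoc, ← mul_add, ← mul_add] at e3
  have e4 := congrArg (fun Y => (G p)⁻¹ * Y) e3
  simp only [← mul_assoc, Matrix.nonsing_inv_mul _ (hdet p hp), one_mul] at e4
  rw [← toC_mul, ← toC_mul, ← toC_add, ← toC_add] at e4
  have e5 := toC_injective e4
  rw [Ring.lie_def]
  change partialT q p = partialX W p + ((bMat n + q p) * W p - W p * (bMat n + q p))
  rw [← sub_eq_zero, ← sub_eq_zero.2 e5]
  abel

end Flow

/-! ### Upper triangular matrices -/

section Borel

variable {n : ℕ}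

/-- The lower left corner of a skew-adjoint matrix vanishes. -/
theorem corner_eq_zero {A : Mat n ℝ} (h : adj A = -A) : A (Fin.last (2 * n)) 0 = 0 := by
  have h1 := congrFun (congrFun h (Fin.last (2 * n))) 0
  have h2 : adj A (Fin.last (2 * n)) 0 = A (Fin.last (2 * n)) 0 := by
    have e0 : (Fin.last (2 * n)).rev = 0 := by simp
    have e1 : ∀ i : Fin (2 * n + 1), (0 = i.rev) ↔ i = Fin.last (2 * n) := by
      intro i
      rw [← e0, Fin.rev_inj, eq_comm]
    simp only [adj, Matrix.mul_apply, rho_apply, ite_mul, zero_mul, mul_ite, mul_zero,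
      Finset.sum_ite_eq', Finset.mem_univ, if_true, e0, e1, Matrix.transpose_apply]
    rw [mul_comm, ← mul_assoc, ← mul_pow]
    simp
  rw [h2, Matrix.neg_apply] at h1
  linarith

theorem adj_lie {A B : Mat n ℝ} (hA : adj A = -A) (hB : adj B = -B) : adj ⁅A, B⁆ = -⁅A, B⁆ := by
  rw [Ring.lie_def, adj_sub, adj_mul, adj_mul, hA, hB]
  simp

/-- Bracketing with `β` maps skew-adjoint matrices to upper triangular ones: below the diagonal
only the vanishing lower left corner contributes. -/
theorem lie_beta_upper {A : Mat n ℝ} (hA : adj A = -A) {i k : Fin (2 * n + 1)}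
    (hik : k < i) : ⁅beta n, A⁆ i k = 0 := by
  have hcorner := corner_eq_zero hA
  have c : ∀ a b : Fin (2 * n + 1), (a : ℕ) = 2 * n → (b : ℕ) = 0 → A a b = 0 := by
    intro a b ha hb
    rwa [show a = Fin.last (2 * n) from Fin.ext ha, show b = 0 from Fin.ext hb]
  have hlt : (k : ℕ) < i := hik
  rw [Ring.lie_def, Matrix.sub_apply, Matrix.mul_apply, Matrix.mul_apply,
    Finset.sum_eq_zero, Finset.sum_eq_zero, sub_zero]
  · intro m _
    by_cases h : beta n m k = 0
    · rw [h, mul_zero]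
    · have h' : ((m : ℕ) = 0 ∧ (k : ℕ) + 1 = 2 * n) ∨ ((m : ℕ) = 1 ∧ (k : ℕ) = 2 * n) := by
        by_contra hne
        exact h (if_neg hne)
      rw [c i m (by omega) (by omega), zero_mul]
  · intro m _
    by_cases h : beta n i m = 0
    · rw [h, zero_mul]
    · have h' : ((i : ℕ) = 0 ∧ (m : ℕ) + 1 = 2 * n) ∨ ((i : ℕ) = 1 ∧ (m : ℕ) = 2 * n) := by
        by_contra hne
        exact h (if_neg hne)
      rw [c m k (by omega) (by omega), mul_zero]

end Borel

/-! ### The rational loop -/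

section Rational

variable {n : ℕ}

theorem toC_vecMulVec (v w : Fin (2 * n + 1) → ℝ) :
    toC (Matrix.vecMulVec v w : Mat n ℝ) =
      Matrix.vecMulVec (fun i => (v i : ℂ)) (fun k => (w k : ℂ)) := by
  ext i k
  simp [toC, Matrix.vecMulVec_apply]

theorem gLoop_eq (α₁ α₂ : ℝ) (P : Mat n ℝ) (l : ℂ) :
    gLoop α₁ α₂ P l = 1 + ((α₂ - α₁ : ℂ) * (l - α₂)⁻¹) • toC P -
      ((α₂ - α₁ : ℂ) * (l - α₁)⁻¹) • adj (toC P) := by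
  rw [gLoop, ← adj_eq_sharp, toC_adj, sub_eq_add_neg _ (_ • _), ← neg_smul]
  congr 2
  ring

theorem gLoop_swap_eq (α₁ α₂ : ℝ) (P : Mat n ℝ) (l : ℂ) :
    gLoop α₂ α₁ P l = 1 - ((α₂ - α₁ : ℂ) * (l - α₁)⁻¹) • toC P +
      ((α₂ - α₁ : ℂ) * (l - α₂)⁻¹) • adj (toC P) := by
  rw [gLoop_eq, ← neg_sub (α₂ : ℂ) α₁]
  module

theorem adj_gLoop (α₁ α₂ : ℝ) (P : Mat n ℝ) (l : ℂ) :
    adj (gLoop α₁ α₂ P l) = gLoop α₂ α₁ P l := by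
  rw [gLoop_eq, gLoop_swap_eq, adj_sub, adj_add, adj_smul, adj_smul, adj_one, adj_adj]
  abel

theorem conj_gLoop (α₁ α₂ : ℝ) (P : Mat n ℝ) (l : ℂ) :
    (gLoop α₁ α₂ P (starRingEnd ℂ l)).map (starRingEnd ℂ) = gLoop α₁ α₂ P l := by
  ext i k
  have h : starRingEnd ℂ ((1 : Mat n ℂ) i k) = (1 : Mat n ℂ) i k := by
    rw [Matrix.one_apply]
    split_ifs <;> simp
  simp [gLoop, toC, h]

theorem smoothMat_gLoop {O : Set (ℝ × ℝ)} {Q : ℝ × ℝ → Mat n ℝ} (hQ : SmoothMat O Q)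
    (α₁ α₂ : ℝ) (l : ℂ) : SmoothMat O fun p => gLoop α₁ α₂ (Q p) l :=
  ((smoothMat_const 1).add (hQ.toC.const_smul _)).add
    ((((smoothMat_const (rho n ℝ)).mul hQ.transpose).mul
      (smoothMat_const (rho n ℝ))).toC.const_smul _)

theorem det_one_add_smul_toC {P : Mat n ℝ} {v w : Fin (2 * n + 1) → ℝ}
    (hP : P = Matrix.vecMulVec v w) (c : ℂ) : (1 + c • toC P).det = 1 + c * (P.trace : ℂ) := by
  rw [hP, toC_vecMulVec, ← Matrix.smul_vecMulVec, Matrix.vecMulVec_eq Unit,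
    Matrix.det_one_add_replicateCol_mul_replicateRow, Matrix.trace_vecMulVec]
  simp [dotProduct, Finset.mul_sum, mul_comm, mul_left_comm]

theorem trace_eq_one {P : Mat n ℝ} {v w : Fin (2 * n + 1) → ℝ} (hP : P = Matrix.vecMulVec v w)
    (hP2 : P * P = P) (hP0 : P ≠ 0) : P.trace = 1 := by
  have h : P * P = P.trace • P := by
    rw [hP, Matrix.vecMulVec_mul_vecMulVec, Matrix.trace_vecMulVec, dotProduct_comm,
      Matrix.vecMulVec_smul]
  rw [hP2, ← sub_eq_zero] at h
  nth_rewrite 1 [← one_smul ℝ P] at h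
  rw [← sub_smul] at h
  linarith [(smul_eq_zero.1 h).resolve_right hP0]

/-- For a rank-one projection, the two factors of the rational loop have determinants
`(l - α₁) / (l - α₂)` and `(l - α₂) / (l - α₁)`. -/
theorem det_gLoop {α₁ α₂ : ℝ} {P : Mat n ℝ} {v w : Fin (2 * n + 1) → ℝ}
    (hP : P = Matrix.vecMulVec v w) (hP2 : P * P = P) (hP0 : P ≠ 0) (hSP : adj P * P = 0) {l : ℂ}
    (h1 : l ≠ α₁) (h2 : l ≠ α₂) : (gLoop α₁ α₂ P l).det = 1 := by
  have hadj : adj P = Matrix.vecMulVec (rho n ℝ *ᵥ w) (v ᵥ* rho n ℝ) := by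
    rw [adj, hP, Matrix.transpose_vecMulVec, Matrix.mul_vecMulVec, Matrix.vecMulVec_mul]
  have hf : gLoop α₁ α₂ P l = (1 + (((α₁ : ℂ) - α₂) / (l - α₁)) • toC (adj P)) *
      (1 + (((α₂ : ℂ) - α₁) / (l - α₂)) • toC P) := by
    rw [add_mul, mul_add (_ • _), smul_mul_smul_comm, ← toC_mul, hSP, toC_zero, smul_zero,
      one_mul, mul_one, add_zero]
    rfl
  rw [hf, Matrix.det_mul, det_one_add_smul_toC hadj, det_one_add_smul_toC hP, trace_adj,
    trace_eq_one hP hP2 hP0]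
  have h1' : l - α₁ ≠ 0 := sub_ne_zero.2 h1
  have h2' : l - α₂ ≠ 0 := sub_ne_zero.2 h2
  push_cast
  field_simp
  ring

end Rational

/-! ### Dressing a family of orthogonal matrices -/

section Dressing

open Polynomial

variable {n : ℕ}

theorem eventually_lineX_mem {O : Set (ℝ × ℝ)} (hO : IsOpen O) {p : ℝ × ℝ} (hp : p ∈ O) :
    ∀ᶠ s in nhds p.1, (s, p.2) ∈ O :=
  (show ContinuousAt (fun s : ℝ => (s, p.2)) p.1 by fun_prop) (hO.mem_nhds hp)

theorem eventually_lineT_mem {O : Set (ℝ × ℝ)} (hO : IsOpen O) {p : ℝ × ℝ} (hp : p ∈ O) :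
    ∀ᶠ s in nhds p.2, (p.1, s) ∈ O :=
  (show ContinuousAt (fun s : ℝ => (p.1, s)) p.2 by fun_prop) (hO.mem_nhds hp)

/-- `Q` is the family of projections transported from the rank-one projection `P` by the real
orthogonal matrices `F(p, α₁)` and `F(p, α₂)`. -/
structure IsDressing (α₁ α₂ : ℝ) (O : Set (ℝ × ℝ)) (F : ℝ × ℝ → ℂ → Mat n ℂ) (P : Mat n ℝ)
    (Q : ℝ × ℝ → Mat n ℝ) : Prop where
  rank_one : ∃ v w, P = Matrix.vecMulVec v w
  ne_zero : P ≠ 0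
  mul_adj : P * adj P = 0
  adj_mul : adj P * P = 0
  real : ∀ p ∈ O, ∀ α : ℝ, (F p α).map (starRingEnd ℂ) = F p α
  transported : ∀ p ∈ O,
    IsTransported P (Q p) ((F p α₁).map Complex.re) ((F p α₂).map Complex.re)

namespace IsDressing

variable {α₁ α₂ : ℝ} {O : Set (ℝ × ℝ)} {F : ℝ × ℝ → ℂ → Mat n ℂ} {P : Mat n ℝ}
  {Q : ℝ × ℝ → Mat n ℝ}

theorem ne_zero' (h : IsDressing α₁ α₂ O F P Q) {p : ℝ × ℝ} (hp : p ∈ O) : Q p ≠ 0 := by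
  intro h0
  have ht := h.transported p hp
  have h1 := ht.le_range
  rw [h0, sub_zero, one_mul] at h1
  apply h.ne_zero
  rw [← one_mul P, ← ht.orth₁', mul_assoc, h1, mul_zero]

theorem relations (h : IsDressing α₁ α₂ O F P Q) {p : ℝ × ℝ} (hp : p ∈ O) :
    Q p * Q p = Q p ∧ Q p * adj (Q p) = 0 ∧ adj (Q p) * Q p = 0 :=
  ⟨(h.transported p hp).idem', (h.transported p hp).mul_adj_eq_zero h.mul_adj,
    (h.transported p hp).adj_mul_eq_zero h.adj_mul⟩

theorem rank_one' (h : IsDressing α₁ α₂ O F P Q) {p : ℝ × ℝ} (hp : p ∈ O) :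
    ∃ v w, Q p = Matrix.vecMulVec v w := by
  obtain ⟨v, w, hP⟩ := h.rank_one
  rw [((h.transported p hp).eq_smul hP (h.ne_zero' hp)).2]
  generalize (P * _ * _).trace⁻¹ = κ
  rw [hP, Matrix.mul_vecMulVec, Matrix.vecMulVec_mul, ← Matrix.smul_vecMulVec]
  exact ⟨_, _, rfl⟩

/-- The transported projections are smooth, being given by an explicit formula with nonvanishing
denominator. -/
theorem smoothMat (h : IsDressing α₁ α₂ O F P Q) (hF : ∀ l, SmoothMat O fun p => F p l) :
    SmoothMat O Q := by
  obtain ⟨v, w, hP⟩ := h.rank_one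
  have h1 := (hF α₁).re
  have h2 := (hF α₂).re
  have h1' : SmoothMat O fun p => adj ((F p α₁).map Complex.re) :=
    ((smoothMat_const _).mul h1.transpose).mul (smoothMat_const _)
  have htr : ContDiffOn ℝ ∞ (fun p => (P * (F p α₂).map Complex.re *
      adj ((F p α₁).map Complex.re)).trace) O :=
    ContDiffOn.sum fun i _ => (((smoothMat_const P).mul h2).mul h1') i i
  have hN := (h1'.mul (smoothMat_const P)).mul h2
  intro i k
  refine ((htr.inv fun p hp => ?_).mul (hN i k)).congr fun p hp => ?_
  · exact ((h.transported p hp).eq_smul hP (h.ne_zero' hp)).1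
  · rw [((h.transported p hp).eq_smul hP (h.ne_zero' hp)).2]
    rfl

theorem exists_entire (h : IsDressing α₁ α₂ O F P Q) {p : ℝ × ℝ} (hp : p ∈ O)
    (hF : ∀ i k, Differentiable ℂ fun l => F p l i k) (horth : ∀ l, adj (F p l) * F p l = 1) :
    ∃ g : ℂ → Mat n ℂ, (∀ i k, Differentiable ℂ fun l => g l i k) ∧
      ∀ l : ℂ, l ≠ α₁ → l ≠ α₂ → g l = gLoop α₁ α₂ P l * F p l * gLoop α₂ α₁ (Q p) l := by
  obtain ⟨v, w, hP⟩ := h.rank_one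
  have ht := (h.transported p hp).toC
  rw [toC_re (h.real p hp α₁), toC_re (h.real p hp α₂)] at ht
  obtain ⟨g, hg, hgl⟩ := exists_entire_dressing hF horth
    ((congrArg toC hP).trans (toC_vecMulVec v w))
    (by rw [← toC_adj, ← toC_mul, h.adj_mul, toC_zero])
    (by rw [← toC_adj, ← toC_mul, h.mul_adj, toC_zero]) ht
  refine ⟨g, hg, fun l h1 h2 => ?_⟩
  rw [hgl l h1 h2, gLoop_eq, gLoop_swap_eq]

/-- Entire matrix functions that extend the dressed family are orthogonal of determinant one. -/
theorem isOrthGroup (h : IsDressing α₁ α₂ O F P Q) {p : ℝ × ℝ} (hp : p ∈ O)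
    (hF : ∀ l, IsOrthGroup n (F p l)) {g : ℂ → Mat n ℂ}
    (hg : ∀ i k, Differentiable ℂ fun l => g l i k)
    (hgl : ∀ l : ℂ, l ≠ α₁ → l ≠ α₂ → g l = gLoop α₁ α₂ P l * F p l * gLoop α₂ α₁ (Q p) l)
    (l : ℂ) : IsOrthGroup n (g l) := by
  have hc := continuous_of_entries hg
  have hfin : ({(α₁ : ℂ), (α₂ : ℂ)} : Set ℂ).Finite := Set.toFinite _
  obtain ⟨v, w, hP⟩ := h.rank_one
  obtain ⟨v', w', hQ⟩ := h.rank_one' hp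
  obtain ⟨q1, q2, q3⟩ := h.relations hp
  have ht := h.transported p hp
  have hdet : (fun l => (g l).det) = fun _ => 1 := by
    refine eq_of_eq_off_finite hc.matrix_det continuous_const hfin fun l hl => ?_
    simp only [Set.mem_insert_iff, Set.mem_singleton_iff, not_or] at hl
    rw [hgl l hl.1 hl.2, Matrix.det_mul, Matrix.det_mul,
      det_gLoop hP ht.idem h.ne_zero h.adj_mul hl.1 hl.2,
      det_gLoop hQ q1 (h.ne_zero' hp) q3 hl.2 hl.1, (hF l).1, one_mul, one_mul]
  have horth : (fun l => adj (g l) * g l) = fun _ => 1 := by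
    refine eq_of_eq_off_finite ((continuous_adj.comp hc).matrix_mul hc) continuous_const hfin
      fun l hl => ?_
    simp only [Set.mem_insert_iff, Set.mem_singleton_iff, not_or] at hl
    have e1 := gLoop_mul_gLoop ht.idem h.mul_adj h.adj_mul hl.2 hl.1
    have e2 := gLoop_mul_gLoop q1 q2 q3 hl.1 hl.2
    rw [hgl l hl.1 hl.2, BHat.adj_mul, BHat.adj_mul, adj_gLoop, adj_gLoop]
    calc gLoop α₁ α₂ (Q p) l * (adj (F p l) * gLoop α₂ α₁ P l) *
          (gLoop α₁ α₂ P l * F p l * gLoop α₂ α₁ (Q p) l)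
        = gLoop α₁ α₂ (Q p) l * (adj (F p l) * (gLoop α₂ α₁ P l * gLoop α₁ α₂ P l) * F p l) *
          gLoop α₂ α₁ (Q p) l := by simp only [mul_assoc]
      _ = 1 := by rw [e1, mul_one, adj_mul_self (hF l).2, mul_one, e2]
  exact ⟨congrFun hdet l, transpose_mul_rho_mul (congrFun horth l)⟩

/-- Entire matrix functions that extend the dressed family inherit its reality condition. -/
theorem conj_eq {p : ℝ × ℝ}
    (hF : ∀ l, (F p (starRingEnd ℂ l)).map (starRingEnd ℂ) = F p l) {g : ℂ → Mat n ℂ}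
    (hg : ∀ i k, Differentiable ℂ fun l => g l i k)
    (hgl : ∀ l : ℂ, l ≠ α₁ → l ≠ α₂ → g l = gLoop α₁ α₂ P l * F p l * gLoop α₂ α₁ (Q p) l)
    (l : ℂ) : (g (starRingEnd ℂ l)).map (starRingEnd ℂ) = g l := by
  have hc := continuous_of_entries hg
  have hfin : ({(α₁ : ℂ), (α₂ : ℂ)} : Set ℂ).Finite := Set.toFinite _
  refine congrFun (f := fun l => (g (starRingEnd ℂ l)).map (starRingEnd ℂ))
    (eq_of_eq_off_finite ((hc.comp Complex.continuous_conj).matrix_map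
      Complex.continuous_conj) hc hfin fun l hl => ?_) l
  simp only [Set.mem_insert_iff, Set.mem_singleton_iff, not_or] at hl
  have hne : ∀ α : ℝ, l ≠ α → starRingEnd ℂ l ≠ α := by
    intro α h1 h2
    apply h1
    rw [← Complex.conj_conj l, h2, Complex.conj_ofReal]
  rw [hgl l hl.1 hl.2, hgl _ (hne _ hl.1) (hne _ hl.2), Matrix.map_mul,
    Matrix.map_mul, conj_gLoop, conj_gLoop, hF]

/-- The dressed family extends to an entire family, which satisfies the gauge transformed linear
equations. At the poles, smoothness in `p` and the linear equations follow from Cauchy's formula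
on a circle around them. -/
theorem exists_frame (h : IsDressing α₁ α₂ O F P Q) (hO : IsOpen O)
    (hFs : ∀ l, SmoothMat O fun p => F p l)
    (hFe : ∀ p ∈ O, ∀ i k, Differentiable ℂ fun l => F p l i k)
    (hFo : ∀ p ∈ O, ∀ l, IsOrthGroup n (F p l)) {A B A' B' : ℝ × ℝ → (Mat n ℝ)[X]}
    (dX : ∀ p ∈ O, ∀ l,
      HasMatDeriv (fun s => F (s, p.2) l) (F p l * polyEval n l (A p)) p.1)
    (dT : ∀ p ∈ O, ∀ l,
      HasMatDeriv (fun s => F (p.1, s) l) (F p l * polyEval n l (B p)) p.2)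
    (dQX : ∀ p ∈ O, HasMatDeriv (fun s => Q (s, p.2)) (projDeriv α₁ α₂ (Q p) (A p)) p.1)
    (dQT : ∀ p ∈ O, HasMatDeriv (fun s => Q (p.1, s)) (projDeriv α₁ α₂ (Q p) (B p)) p.2)
    (gX : ∀ p ∈ O, IsGauge α₁ α₂ (Q p) (A p) (A' p))
    (gT : ∀ p ∈ O, IsGauge α₁ α₂ (Q p) (B p) (B' p))
    (hA' : IsPolyFamily O fun p l => polyEval n l (A' p))
    (hB' : IsPolyFamily O fun p l => polyEval n l (B' p)) :
    ∃ G : ℝ × ℝ → ℂ → Mat n ℂ, (∀ l, SmoothMat O fun p => G p l) ∧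
      (∀ p ∈ O, ∀ i k, Differentiable ℂ fun l => G p l i k) ∧
      (∀ p ∈ O, ∀ l, partialX (fun r => G r l) p = G p l * polyEval n l (A' p)) ∧
      (∀ p ∈ O, ∀ l, partialT (fun r => G r l) p = G p l * polyEval n l (B' p)) ∧
      ∀ p ∈ O, ∀ l : ℂ, l ≠ α₁ → l ≠ α₂ →
        G p l = gLoop α₁ α₂ P l * F p l * gLoop α₂ α₁ (Q p) l := by
  have hex : ∀ p, ∃ g : ℂ → Mat n ℂ, p ∈ O → (∀ i k, Differentiable ℂ fun l => g l i k) ∧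
      ∀ l : ℂ, l ≠ α₁ → l ≠ α₂ → g l = gLoop α₁ α₂ P l * F p l * gLoop α₂ α₁ (Q p) l := by
    intro p
    by_cases hp : p ∈ O
    · obtain ⟨g, hg⟩ := h.exists_entire hp (hFe p hp) fun l => adj_mul_self (hFo p hp l).2
      exact ⟨g, fun _ => hg⟩
    · exact ⟨0, fun hp' => absurd hp' hp⟩
  choose G hG using hex
  have hQs := h.smoothMat hFs
  set S : Set ℂ := {(α₁ : ℂ), (α₂ : ℂ)} with hS
  have hd : ∀ l ∉ S, ∀ p ∈ O, ∀ i k, HasFDerivAt (fun r => G r l i k)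
      (pairCLM ((G p l * polyEval n l (A' p)) i k) ((G p l * polyEval n l (B' p)) i k)) p := by
    intro l hl p hp i k
    simp only [hS, Set.mem_insert_iff, Set.mem_singleton_iff, not_or] at hl
    have hsm : SmoothMat O fun p => G p l :=
      (((smoothMat_const _).mul (hFs l)).mul (smoothMat_gLoop hQs α₂ α₁ l)).congr
        fun p hp => (hG p hp).2 l hl.1 hl.2
    have cx := eventually_lineX_mem hO hp
    have ct := eventually_lineT_mem hO hp
    have ex := partialX_eq (f := fun r => G r l) ((hasMatDeriv_dressed (P := P)
      (F := fun s l => F (s, p.2) l) hl.1 hl.2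
      (cx.mono fun s hs => h.relations hs) (dX p hp l) (dQX p hp) (gX p hp)).congr_of_eventuallyEq
      (cx.mono fun s hs => (hG _ hs).2 l hl.1 hl.2))
    have et := partialT_eq (f := fun r => G r l) ((hasMatDeriv_dressed (P := P)
      (F := fun s l => F (p.1, s) l) hl.1 hl.2
      (ct.mono fun s hs => h.relations hs) (dT p hp l) (dQT p hp) (gT p hp)).congr_of_eventuallyEq
      (ct.mono fun s hs => (hG _ hs).2 l hl.1 hl.2))
    have := hsm.hasFDerivAt hO hp i k
    rw [ex, et] at this
    rwa [(hG p hp).2 l hl.1 hl.2]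
  have hall := hasFDerivAt_of_linear hO (Set.toFinite S).isBounded (fun p hp => (hG p hp).1)
    hA' hB' hd
  refine ⟨G, fun l => smoothMat_of_linear hO (hA'.smoothMat l) (hB'.smoothMat l) fun p hp i k =>
    hall l hp i k, fun p hp => (hG p hp).1, fun p hp l => ?_, fun p hp l => ?_,
    fun p hp => (hG p hp).2⟩
  · exact partialX_eq fun i k => by simpa using hasDerivAt_lineX (hall l hp i k)
  · exact partialT_eq fun i k => by simpa using hasDerivAt_lineT (hall l hp i k)

end IsDressing

end Dressing

/-! ### Dressing a frame -/

section Frame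

open Polynomial

variable {n : ℕ}

theorem IsOrthGroup.mul_inv_mul {g : Mat n ℂ} (h : IsOrthGroup n g) {A B : Mat n ℂ}
    (e : g⁻¹ * A = B) : A = g * B := by
  rw [← e, ← mul_assoc, Matrix.mul_nonsing_inv _ (by simp [h.1]), one_mul]

theorem IsOrthGroup.inv_mul_eq {g : Mat n ℂ} (h : IsOrthGroup n g) {A B : Mat n ℂ}
    (e : A = g * B) : g⁻¹ * A = B := by
  rw [e, ← mul_assoc, Matrix.nonsing_inv_mul _ (by simp [h.1]), one_mul]

theorem adj_eq_neg_of_toC {A : Mat n ℝ} (h : adj (toC A) = -toC A) : adj A = -A := by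
  apply toC_injective
  rw [toC_adj, h]
  exact (map_neg (toCHom n) A).symm

theorem isPolyFamily_laxPoly {O : Set (ℝ × ℝ)} {q : ℝ × ℝ → Mat n ℝ} (hq : SmoothMat O q) :
    IsPolyFamily O fun p l => polyEval n l (laxPoly n (q p)) := by
  refine ⟨2, fun i p => if i = 0 then bMat n + q p else beta n, fun i => ?_, fun p _ l => ?_⟩
  · by_cases h : i = 0
    · simpa only [if_pos h] using (smoothMat_const _).add hq
    · simpa only [if_neg h] using smoothMat_const _
  · simp only [polyEval_laxPoly]
    rw [Finset.sum_range_succ, Finset.sum_range_one]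
    simp [add_comm]

theorem isPolyFamily_plusPoly {O : Set (ℝ × ℝ)} {ξ : ℝ × ℝ → Loop n} (hξ : SmoothLoop O ξ)
    (N : ℕ) : IsPolyFamily O fun p l => polyEval n l (plusPoly N (ξ p)) :=
  ⟨N + 1, fun i p => lcoeff (ξ p) i, fun i => SmoothMat.lcoeff hξ i,
    fun p _ l => polyEval_plusPoly N (ξ p) l⟩

/-- The coefficients of the polynomial part of an odd power of the resolvent are skew-adjoint. -/
theorem IsResolvent.coeff_plusPoly_mem_skew {U : Set (ℝ × ℝ)} {q : ℝ × ℝ → Mat n ℝ}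
    {T : ℝ × ℝ → Loop n} (h : IsResolvent n U q T) {p : ℝ × ℝ} (hp : p ∈ U) {m : ℕ} (hm : Odd m)
    (N i : ℕ) : (plusPoly N (T p ^ m)).coeff i ∈ skew n := by
  rw [coeff_plusPoly]
  split_ifs
  · exact congrArg (fun ξ : Loop n => ξ.coeff (-i)) (loopAdj_pow_odd (h.loopAdj_eq_neg hp) hm)
  · exact (skew n).zero_mem

/-- The coefficients of `β λ + b + q` are skew-adjoint: `β` is the leading coefficient of the
resolvent, and `b + q` is the logarithmic derivative of the orthogonal matrices `F(λ = 0)`. -/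
theorem IsFrame.adj_laxPoly {j : ℕ} {q : ℝ × ℝ → Mat n ℝ} {F : ℝ × ℝ → ℂ → Mat n ℂ}
    (hF : IsFrame n j Set.univ q F) (p : ℝ × ℝ) :
    adj (beta n) = -beta n ∧ adj (bMat n + q p) = -(bMat n + q p) := by
  obtain ⟨hsm, -, horth, -, hx, T, hT, -⟩ := hF
  constructor
  · rw [← hT.leading p trivial]
    exact isOrthLie_iff.1 (hT.orth p trivial 1)
  · have h1 := (hsm 0).hasMatDerivX isOpen_univ (Set.mem_univ p)
    rw [(horth p trivial 0).mul_inv_mul (hx p trivial 0), zero_smul, zero_add] at h1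
    exact adj_eq_neg_of_toC (adj_eq_neg_of_hasMatDeriv h1 fun u =>
      adj_mul_self (horth (u, p.2) trivial 0).2)

theorem ne_zero_of_rank_eq_one {P : Mat n ℝ} (h : P.rank = 1) : P ≠ 0 := by
  rintro rfl
  simp at h

/-- Projections onto `F(α₁)⁻¹ V₁` along `F(α₂)⁻¹ V₂` are transported by the real matrices `F(α₁)`
and `F(α₂)`. -/
theorem isDressing_of_isFrame {j : ℕ} {q : ℝ × ℝ → Mat n ℝ} {F : ℝ × ℝ → ℂ → Mat n ℂ}
    (hF : IsFrame n j Set.univ q F) {V₁ V₂ : Submodule ℝ (Fin (2 * n + 1) → ℝ)} {P : Mat n ℝ}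
    (hP : IsProjection P V₁ V₂) (hrank : P.rank = 1) (hP₁ : P * sharp P = 0)
    (hP₂ : sharp P * P = 0) {α₁ α₂ : ℝ} {O : Set (ℝ × ℝ)} {Q : ℝ × ℝ → Mat n ℝ}
    (hQ : ∀ p ∈ O, IsProjection (Q p) (invImage (F p α₁) V₁) (invImage (F p α₂) V₂)) :
    IsDressing α₁ α₂ O F P Q := by
  obtain ⟨-, -, horth, hreal, -⟩ := hF
  have hr : ∀ p, ∀ α : ℝ, (F p α).map (starRingEnd ℂ) = F p α := by
    intro p α
    have := hreal p trivial α
    rwa [Complex.conj_ofReal] at this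
  have ho : ∀ p, ∀ α : ℝ, adj ((F p α).map Complex.re) * (F p α).map Complex.re = 1 := by
    intro p α
    apply toC_injective
    rw [toC_mul, toC_adj, toC_re (hr p α), toC_one]
    exact adj_mul_self (horth p trivial α).2
  have hi : ∀ p, ∀ α : ℝ, ∀ V, invImage (F p α) V =
      V.map (adj ((F p α).map Complex.re)).mulVecLin := by
    intro p α V
    rw [invImage, Matrix.inv_eq_left_inv (ho p α)]
  refine ⟨exists_eq_vecMulVec hrank, ne_zero_of_rank_eq_one hrank, hP₁, hP₂, fun p _ => hr p,
    fun p hp => ?_⟩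
  have := hQ p hp
  rw [hi, hi] at this
  exact hP.isTransported (ho p α₁) (ho p α₂) this

/-- The dressed potential stays in the upper triangular subalgebra. -/
theorem isBorel_dressed {q Q : Mat n ℝ} (hq : IsBorel n q) (hβ : adj (beta n) = -beta n) (a : ℝ) :
    IsBorel n (q + a • ⁅beta n, Q - adj Q⁆) := by
  have hQ : adj (Q - adj Q) = -(Q - adj Q) := by rw [adj_sub, adj_adj, neg_sub]
  constructor
  · rw [isOrthLie_iff, adj_add, adj_smul, adj_lie hβ hQ, isOrthLie_iff.1 hq.1, smul_neg, neg_add]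
  · intro i k hik
    rw [Matrix.add_apply, Matrix.smul_apply, hq.2 i k hik, lie_beta_upper hQ hik, smul_zero,
      add_zero]

theorem smoothMat_dressed {O : Set (ℝ × ℝ)} {q Q : ℝ × ℝ → Mat n ℝ} (hq : SmoothMat O q)
    (hQ : SmoothMat O Q) (a : ℝ) :
    SmoothMat O fun p => q p + a • ⁅beta n, Q p - adj (Q p)⁆ := by
  have hadj : SmoothMat O fun p => adj (Q p) :=
    ((smoothMat_const _).mul hQ.transpose).mul (smoothMat_const _)
  have hb := hQ.sub hadj
  exact hq.add
    ((((smoothMat_const (beta n)).mul hb).sub (hb.mul (smoothMat_const (beta n)))).const_smul _)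

/-- Dressing of a frame: the dressed family is a frame of the dressed potential. -/
theorem exists_isFrame_dressed {j : ℕ} (hj : 1 ≤ j) {q : ℝ × ℝ → Mat n ℝ}
    (hq : SmoothMat Set.univ q) {F : ℝ × ℝ → ℂ → Mat n ℂ} (hF : IsFrame n j Set.univ q F)
    {α₁ α₂ : ℝ} {O : Set (ℝ × ℝ)} (hO : IsOpen O) {P : Mat n ℝ} {Q : ℝ × ℝ → Mat n ℝ}
    (h : IsDressing α₁ α₂ O F P Q) :
    ∃ G, IsFrame n j O (fun p => q p + (α₁ - α₂) • ⁅beta n, Q p - adj (Q p)⁆) G ∧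
      ∀ p ∈ O, ∀ l : ℂ, l ≠ α₁ → l ≠ α₂ →
        G p l = gLoop α₁ α₂ P l * F p l * (gLoop α₁ α₂ (Q p) l)⁻¹ := by
  have hskew := hF.adj_laxPoly
  obtain ⟨hsm, hent, horth, hreal, hx, T, hT, ht⟩ := hF
  set q' : ℝ × ℝ → Mat n ℝ := fun p => q p + (α₁ - α₂) • ⁅beta n, Q p - adj (Q p)⁆ with hq'
  have hsm' : ∀ l, SmoothMat O fun p => F p l := fun l => (hsm l).mono (Set.subset_univ O)
  have hQs := h.smoothMat hsm'
  have hTO := hT.mono (Set.subset_univ O)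
  have dX : ∀ p : ℝ × ℝ, ∀ l, HasMatDeriv (fun s => F (s, p.2) l)
      (F p l * polyEval n l (laxPoly n (q p))) p.1 := by
    intro p l
    have := (hsm l).hasMatDerivX isOpen_univ (Set.mem_univ p)
    rwa [(horth p trivial l).mul_inv_mul (hx p trivial l), ← polyEval_laxPoly] at this
  have dT : ∀ p : ℝ × ℝ, ∀ l, HasMatDeriv (fun s => F (p.1, s) l)
      (F p l * polyEval n l (plusPoly (2 * j - 1) (T p ^ (2 * j - 1)))) p.2 := by
    intro p l
    have := (hsm l).hasMatDerivT isOpen_univ (Set.mem_univ p)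
    rwa [(horth p trivial l).mul_inv_mul (ht p trivial l), ← polyEval_plusPoly] at this
  have dQX : ∀ p ∈ O, HasMatDeriv (fun s => Q (s, p.2))
      (projDeriv α₁ α₂ (Q p) (laxPoly n (q p))) p.1 := fun p hp =>
    hasMatDeriv_projDeriv (F := fun s l => F (s, p.2) l) (h.real p hp)
      ((eventually_lineX_mem hO hp).mono fun s hs => h.transported _ hs)
      (dX p) (hQs.hasMatDerivX hO hp)
  have dQT : ∀ p ∈ O, HasMatDeriv (fun s => Q (p.1, s))
      (projDeriv α₁ α₂ (Q p) (plusPoly (2 * j - 1) (T p ^ (2 * j - 1)))) p.2 := fun p hp =>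
    hasMatDeriv_projDeriv (F := fun s l => F (p.1, s) l) (h.real p hp)
      ((eventually_lineT_mem hO hp).mono fun s hs => h.transported _ hs)
      (dT p) (hQs.hasMatDerivT hO hp)
  have gX : ∀ p ∈ O, IsGauge α₁ α₂ (Q p) (laxPoly n (q p)) (laxPoly n (q' p)) := by
    intro p hp
    obtain ⟨v, w, hQ⟩ := h.rank_one' hp
    obtain ⟨q1, q2, q3⟩ := h.relations hp
    have := isGauge_linear α₁ α₂ hQ q1 q2 q3 (hskew p).1 (hskew p).2
    rwa [add_assoc] at this
  set T' : ℝ × ℝ → Loop n := fun p =>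
    loopDress α₁ α₂ (Q p) (adj (Q p)) * T p * loopDress α₂ α₁ (Q p) (adj (Q p)) with hT'
  have hR : IsResolvent n O q' T' := isResolvent_conj hO hTO hQs (fun p hp => h.relations hp) dQX gX
  have gT : ∀ p ∈ O, IsGauge α₁ α₂ (Q p) (plusPoly (2 * j - 1) (T p ^ (2 * j - 1)))
      (plusPoly (2 * j - 1) (T' p ^ (2 * j - 1))) := by
    intro p hp
    obtain ⟨v, w, hQ⟩ := h.rank_one' hp
    obtain ⟨q1, q2, q3⟩ := h.relations hp
    have hodd : Odd (2 * j - 1) := ⟨j - 1, by omega⟩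
    -- some polynomial `B` is the gauge transform, and the expansion at `λ = ∞` determines it
    obtain ⟨B, hB⟩ := exists_isGauge α₁ α₂ hQ q1 q2 q3
      (hTO.coeff_plusPoly_mem_skew hp hodd (2 * j - 1))
    have hlow : LowBdd (-(2 * j - 1 : ℕ)) (T p ^ (2 * j - 1)) := by
      simpa using (hTO.lowBdd hp).pow (2 * j - 1)
    have e := hB.eq_plusPoly q1 q2 q3 hlow
    rw [← conj_pow (loopDress_mul_loopDress α₂ α₁ q1 q2 q3)
      (loopDress_mul_loopDress α₁ α₂ q1 q2 q3)] at e
    rwa [e] at hB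
  have hq's : SmoothMat O q' := smoothMat_dressed (hq.mono (Set.subset_univ O)) hQs _
  obtain ⟨G, hGs, hGe, hGx, hGt, hGl⟩ := h.exists_frame hO hsm' (fun p _ => hent p trivial)
    (fun p _ => horth p trivial) (fun p _ => dX p) (fun p _ => dT p) dQX dQT gX gT
    (isPolyFamily_laxPoly hq's) (isPolyFamily_plusPoly (hR.smoothLoop.pow _) _)
  have hGo : ∀ p ∈ O, ∀ l, IsOrthGroup n (G p l) := fun p hp =>
    h.isOrthGroup hp (horth p trivial) (hGe p hp) (hGl p hp)
  refine ⟨G, ⟨hGs, hGe, hGo, fun p hp => IsDressing.conj_eq (hreal p trivial) (hGe p hp) (hGl p hp),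
    fun p hp l => (hGo p hp l).inv_mul_eq ?_, T', hR,
    fun p hp l => (hGo p hp l).inv_mul_eq ?_⟩, fun p hp l h1 h2 => ?_⟩
  · rw [hGx p hp l, polyEval_laxPoly]
  · rw [hGt p hp l, polyEval_plusPoly]
  · obtain ⟨q1, q2, q3⟩ := h.relations hp
    rw [hGl p hp l h1 h2, Matrix.inv_eq_right_inv (gLoop_mul_gLoop q1 q2 q3 h1 h2)]

end Frame

end BHat

theorem mainTheorem1 (n j : ℕ) (hn : 1 ≤ n) (hj : 1 ≤ j)
    (q : ℝ × ℝ → BHat.Mat n ℝ) (hq : BHat.IsSolution n j Set.univ q)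
    (F : ℝ × ℝ → ℂ → BHat.Mat n ℂ) (hF : BHat.IsFrame n j Set.univ q F)
    (V₁ V₂ : Submodule ℝ (Fin (2 * n + 1) → ℝ)) (P : BHat.Mat n ℝ)
    (hP : BHat.IsProjection P V₁ V₂) (hrank : P.rank = 1)
    (hP₁ : P * BHat.sharp P = 0) (hP₂ : BHat.sharp P * P = 0)
    (α₁ α₂ : ℝ) (hα : α₁ ≠ α₂)
    (O : Set (ℝ × ℝ)) (hO : IsOpen O)
    (hcompl : ∀ p ∈ O, IsCompl (BHat.invImage (F p α₁) V₁) (BHat.invImage (F p α₂) V₂))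
    (Pt : ℝ × ℝ → BHat.Mat n ℝ)
    (hPt : ∀ p ∈ O,
      BHat.IsProjection (Pt p) (BHat.invImage (F p α₁) V₁) (BHat.invImage (F p α₂) V₂)) :
    (∀ p ∈ O, Pt p * BHat.sharp (Pt p) = 0 ∧ BHat.sharp (Pt p) * Pt p = 0) ∧
    BHat.IsSolution n j O
      (fun p => q p + (α₁ - α₂) • ⁅BHat.beta n, Pt p - BHat.sharp (Pt p)⁆) ∧
    ∃ Ft : ℝ × ℝ → ℂ → BHat.Mat n ℂ,
      BHat.IsFrame n j O
        (fun p => q p + (α₁ - α₂) • ⁅BHat.beta n, Pt p - BHat.sharp (Pt p)⁆) Ft ∧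
      ∀ p ∈ O, ∀ l : ℂ, l ≠ α₁ → l ≠ α₂ →
        Ft p l = BHat.gLoop α₁ α₂ P l * F p l * (BHat.gLoop α₁ α₂ (Pt p) l)⁻¹ := by
  have h := BHat.isDressing_of_isFrame hF hP hrank hP₁ hP₂ hPt
  obtain ⟨Ft, hFt, hFt'⟩ := BHat.exists_isFrame_dressed hj hq.1 hF hO h
  refine ⟨fun p hp => (h.relations hp).2, ?_, Ft, hFt, hFt'⟩
  have hQs := h.smoothMat fun l => (hF.1 l).mono (Set.subset_univ O)
  refine BHat.isSolution_of_isFrame hO ?_ (fun p _ => ?_) hFt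
  · exact BHat.smoothMat_dressed (hq.1.mono (Set.subset_univ O)) hQs _
  · exact BHat.isBorel_dressed (hq.2.1 p trivial) (hF.adj_laxPoly p).1 _
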